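/- **Setting.** Let $x_0\in\mathbb R^n$ be an unknown deterministic parameter and let $\mathcal V=\{1,\dots,N\}$ be a set of nodes. On a probability space, for $k\ge 0$, let $\mathcal A(k)=[w_{ij}(k)]$ be random real $N\times N$ weighted adjacency matrices with zero diagonal (the weights may be negative; node $j$ is an in-neighbour of node $i$, $j\in\mathcal N_i(k)$, iff $w_{ij}(k)\ne 0$), $H_i(k)\in\mathbb R^{n_i\times n}$ random regression matrices, $v_i(k)\in\mathbb R^{n_i}$ measurement noises, $\xi_{ji}(k)\in\mathbb R^n$ communication noises, and let $f_{ji}:\mathbb R^n\to\mathbb R$ be (measurable) noise intensity functions. The observations are $y_i(k)=H_i(k)x_0+v_i(k)$. Starting from deterministic $x_i(0)\in\mathbb R^n$, node $i$ runs $$x_i(k+1)=x_i(k)+a(k)H_i^T(k)\bigl(y_i(k)-H_i(k)x_i(k)\bigr)+b(k)\sum_{j\in\mathcal N_i(k)}w_{ij}(k)\bigl(x_j(k)+f_{ji}(x_j(k)-x_i(k))\xi_{ji}(k)-x_i(k)\bigr)-\lambda(k)x_i(k).$$ For a weighted adjacency matrix $\mathcal A=[w_{ij}]$, the in- and out-degree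 of node $i$ are $\sum_jw_{ij}$ and $\sum_jw_{ji}$; $\mathcal A$ is balanced if they agree for every $i$; the Laplacian of $\mathcal A$ is the diagonal matrix of in-degrees minus $\mathcal A$. Let $\mathcal L(k)$ be the Laplacian of $\mathcal A(k)$ and $\mathcal L^{\mathrm{sym}}(k)$ that of $\frac12(\mathcal A(k)+\mathcal A^T(k))$. Let $\mathcal H(k)=\mathrm{diag}(H_1(k),\dots,H_N(k))$ be block diagonal, and let $v(k)$, $\xi(k)$ stack all $v_i(k)$, respectively all $\xi_{ji}(k)$. Let $\mathcal F(k)=\sigma(\mathcal A(s),H_i(s),v_i(s),\xi_{ji}(s):\ i,j\in\mathcal V,\ 0\le s\le k)$, with $\mathcal F(-1)$ trivial. $\|\cdot\|$ is the Euclidean norm of vectors and the spectral norm of matrices, $\lambda_{\min}$ and $\lambda_2$ are the smallest and the second smallest eigenvalue (with multiplicity) of a real symmetric matrix. **Assumptions.** - (Balanced conditional graphs.) For every $k\ge 0$, almost surely $\mathbb E[\mathcal A(k)\mid\mathcal F(k-1)]$ has nonnegative entries and is balanced. - (A1) There are constants $\sigma,b_0$ with $|f_{ji}(x)|\le\sigma\|x\|+b_0$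 for all $x\in\mathbb R^n$ and $i,j\in\mathcal V$. - (A2) $\{v(k),\mathcal F(k)\}_{k\ge0}$ and $\{\xi(k),\mathcal F(k)\}_{k\ge0}$ are martingale difference sequences; the noise process $\{v(k),\xi(k)\}_{k\ge0}$ is independent of the process $\{\mathcal H(k),\mathcal A(k)\}_{k\ge0}$; and there is a constant $\beta_v$ with $\sup_{k\ge0}\mathbb E[\|v(k)\|^2+\|\xi(k)\|^2\mid\mathcal F(k-1)]\le\beta_v$ a.s. - (Gains.) $a(k)=b(k)=\dfrac{c_1}{(k+1)^{\tau}}$ and $\lambda(k)=\dfrac{c_2}{(k+1)^{2\tau}}$ with $c_1,c_2>0$ and $0.5<\tau<1$. - (i) (The symmetrized graphs are uniformly conditionally jointly connected.) There are an integer $h_1\ge1$ and $\theta_1>0$ with $\inf_{k\ge0}\lambda_2\Bigl(\sum_{s=kh_1}^{(k+1)h_1-1}\mathbb E[\mathcal L^{\mathrm{sym}}(s)\mid\mathcal F(kh_1-1)]\Bigr)\ge\theta_1$ a.s. - (ii) (The regression matrices are uniformly conditionally spatio-temporally jointly observable.) There are an integer $h_2\ge1$ and $\theta_2>0$ with $\inf_{k\ge0}\lambda_{\min}\Bigl(\sum_{i=1}^N\sum_{s=kh_2}^{(k+1)h_2-1}\mathbb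 E[H_i^T(s)H_i(s)\mid\mathcal F(kh_2-1)]\Bigr)\ge\theta_2$ a.s. - (iii) There are an integer $h\ge1$ and $\rho_0>0$ such that, with $p=2^{\max\{h,2\}}$, $\sup_{k\ge0}\Bigl(\|\mathcal L(k)\|+\bigl(\mathbb E[\|\mathcal H^T(k)\mathcal H(k)\|^{p}\mid\mathcal F(k-1)]\bigr)^{1/p}\Bigr)\le\rho_0$ a.s. **Conclusion.** Let $l_{j,t}(x)=\frac12\|H_j(t)x-y_j(t)\|^2$. All the losses $l_{j,t}(x)$, $x\in\mathbb R^n$, and $l_{j,t}(x_i(t))$ are integrable; for every $T$ the function $x\mapsto\sum_{t=0}^T\sum_{j=1}^N\mathbb E[l_{j,t}(x)]$ on $\mathbb R^n$ has a minimizer; and, for any choice of a minimizer $x^*_{\mathrm{LMS}}=x^*_{\mathrm{LMS}}(T)$ for each $T$, the regret of every node $i\in\mathcal V$, $$\mathrm{Regret}_{\mathrm{LMS}}(i,T)=\sum_{t=0}^T\sum_{j=1}^N\mathbb E[l_{j,t}(x_i(t))]-\sum_{t=0}^T\sum_{j=1}^N\mathbb E[l_{j,t}(x^*_{\mathrm{LMS}})],$$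 satisfies $$\mathrm{Regret}_{\mathrm{LMS}}(i,T)=\mathcal O\bigl(T^{1-\tau}\ln T\bigr)\qquad(T\to\infty).$$ -/

import Mathlib

open MeasureTheory ProbabilityTheory Filter
open scoped Matrix.Norms.L2Operator

/-- The `r`-th smallest eigenvalue (`r = 1, 2, …`, counted with multiplicity) of a real symmetric
matrix; `0` if the matrix is not symmetric or has fewer than `r` eigenvalues. -/
noncomputable def nthSmallestEigenvalue {ι : Type*} [Fintype ι] [DecidableEq ι]
    (r : ℕ) (S : Matrix ι ι ℝ) : ℝ :=
  if h : S.IsHermitian ∧ 0 < r ∧ r ≤ Fintype.card ι then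
    h.1.eigenvalues₀ ⟨Fintype.card ι - r, by omega⟩
  else 0

/-- The minimum eigenvalue of a real symmetric matrix. -/
noncomputable def lambdaMin {ι : Type*} [Fintype ι] [DecidableEq ι] (S : Matrix ι ι ℝ) : ℝ :=
  nthSmallestEigenvalue 1 S

/-- The second smallest eigenvalue of a real symmetric matrix. -/
noncomputable def lambdaTwo {ι : Type*} [Fintype ι] [DecidableEq ι] (S : Matrix ι ι ℝ) : ℝ :=
  nthSmallestEigenvalue 2 S

/-- The (entrywise) conditional expectation of a random real matrix. -/
noncomputable def condExpMatrix {Ω ι κ : Type*} {mΩ : MeasurableSpace Ω} (μ : Measure Ω)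
    (𝓖 : MeasurableSpace Ω) (X : Ω → Matrix ι κ ℝ) (ω : Ω) : Matrix ι κ ℝ :=
  Matrix.of fun i j => (μ[fun ω' => X ω' i j | 𝓖]) ω

/-- In-degree of node `i` in the weighted digraph with weighted adjacency matrix `W`
(`W i j` is the weight of the edge from `j` to `i`). -/
def inDegree {N : ℕ} (W : Matrix (Fin N) (Fin N) ℝ) (i : Fin N) : ℝ := ∑ j, W i j

/-- Out-degree of node `i` in the weighted digraph with weighted adjacency matrix `W`. -/
def outDegree {N : ℕ} (W : Matrix (Fin N) (Fin N) ℝ) (i : Fin N) : ℝ := ∑ j, W j i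

/-- The weighted digraph with weighted adjacency matrix `W` is balanced. -/
def IsBalanced {N : ℕ} (W : Matrix (Fin N) (Fin N) ℝ) : Prop :=
  ∀ i, inDegree W i = outDegree W i

/-- The Laplacian matrix (diagonal in-degree matrix minus weighted adjacency matrix). -/
def graphLaplacian {N : ℕ} (W : Matrix (Fin N) (Fin N) ℝ) : Matrix (Fin N) (Fin N) ℝ :=
  Matrix.diagonal (inDegree W) - W

/-- The weighted adjacency matrix of the symmetrized graph. -/
noncomputable def symmetrizedAdjacency {N : ℕ} (W : Matrix (Fin N) (Fin N) ℝ) :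
    Matrix (Fin N) (Fin N) ℝ :=
  (1 / 2 : ℝ) • (W + W.transpose)

/-- Martingale difference sequence with respect to a filtration shifted by one:
`past k` plays the role of the information up to time `k - 1`. -/
def IsMartingaleDifference {Ω E : Type*} [MeasurableSpace Ω] [NormedAddCommGroup E]
    [NormedSpace ℝ E] [CompleteSpace E] [MeasurableSpace E]
    (μ : Measure Ω) (past : ℕ → MeasurableSpace Ω) (X : ℕ → Ω → E) : Prop :=
  ∀ k, Measurable[past (k + 1)] (X k) ∧ Integrable (X k) μ ∧ μ[X k | past k] =ᵐ[μ] 0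

/-- Uniform conditional joint connectedness of a sequence of random undirected graphs, given by
their weighted adjacency matrices. -/
def UniformlyCondJointlyConnected {Ω : Type*} [MeasurableSpace Ω] {N : ℕ} (μ : Measure Ω)
    (past : ℕ → MeasurableSpace Ω) (W : ℕ → Ω → Matrix (Fin N) (Fin N) ℝ) : Prop :=
  ∃ h : ℕ, 0 < h ∧ ∃ θ : ℝ, 0 < θ ∧ ∀ᵐ ω ∂μ, ∀ k : ℕ,
    θ ≤ lambdaTwo (∑ s ∈ Finset.Ico (k * h) ((k + 1) * h),
      condExpMatrix μ (past (k * h)) (fun ω' => graphLaplacian (W s ω')) ω)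

/-- Uniform conditional spatio-temporal joint observability of regression matrices. -/
def UniformlyCondJointlyObservable {Ω : Type*} [MeasurableSpace Ω] {N n : ℕ} {m : Fin N → ℕ}
    (μ : Measure Ω) (past : ℕ → MeasurableSpace Ω)
    (H : (i : Fin N) → ℕ → Ω → Matrix (Fin (m i)) (Fin n) ℝ) : Prop :=
  ∃ h : ℕ, 0 < h ∧ ∃ θ : ℝ, 0 < θ ∧ ∀ᵐ ω ∂μ, ∀ k : ℕ,
    θ ≤ lambdaMin (∑ i, ∑ s ∈ Finset.Ico (k * h) ((k + 1) * h),
      condExpMatrix μ (past (k * h)) (fun ω' => (H i s ω').transpose * H i s ω') ω)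

/-- The data of decentralized linear regression over a random time-varying network with `N` nodes:
the parameter lies in `ℝⁿ`, and node `i` observes vectors in `ℝ^(m i)`. -/
structure RegressionNetwork (Ω : Type*) [MeasurableSpace Ω] (N n : ℕ) (m : Fin N → ℕ) where
  /-- the unknown true parameter vector -/
  trueParam : EuclideanSpace ℝ (Fin n)
  /-- the initial estimate of each node -/
  init : Fin N → EuclideanSpace ℝ (Fin n)
  /-- `A k` is the random weighted adjacency matrix at instant `k` -/
  A : ℕ → Ω → Matrix (Fin N) (Fin N) ℝ
  /-- `H i k` is the random regression matrix of node `i` at instant `k` -/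
  H : (i : Fin N) → ℕ → Ω → Matrix (Fin (m i)) (Fin n) ℝ
  /-- `v i k` is the measurement noise of node `i` at instant `k` -/
  v : (i : Fin N) → ℕ → Ω → EuclideanSpace ℝ (Fin (m i))
  /-- `ξ j i k` is the communication noise from node `j` to node `i` at instant `k` -/
  ξ : Fin N → Fin N → ℕ → Ω → EuclideanSpace ℝ (Fin n)
  /-- `f j i` is the noise intensity function of the channel from node `j` to node `i` -/
  f : Fin N → Fin N → EuclideanSpace ℝ (Fin n) → ℝ
  A_diag : ∀ k ω i, A k ω i i = 0
  measurable_A : ∀ k i j, Measurable fun ω => A k ω i j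
  measurable_H : ∀ i k r c, Measurable fun ω => H i k ω r c
  measurable_v : ∀ i k, Measurable (v i k)
  measurable_ξ : ∀ j i k, Measurable (ξ j i k)
  measurable_f : ∀ j i, Measurable (f j i)

namespace RegressionNetwork

variable {Ω : Type*} [MeasurableSpace Ω] {N n : ℕ} {m : Fin N → ℕ}

/-- The observation `y_i(k) = H_i(k) x₀ + v_i(k)`. -/
noncomputable def y (M : RegressionNetwork Ω N n m) (i : Fin N) (k : ℕ) (ω : Ω) :
    EuclideanSpace ℝ (Fin (m i)) :=
  Matrix.toEuclideanLin (M.H i k ω) M.trueParam + M.v i k ω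

/-- The in-neighbours of node `i`: the edge from `j` to `i` is present iff its weight is nonzero. -/
noncomputable def neighbors (M : RegressionNetwork Ω N n m) (k : ℕ) (ω : Ω) (i : Fin N) :
    Finset (Fin N) :=
  Finset.univ.filter fun j => M.A k ω i j ≠ 0

/-- The decentralized online regularized algorithm with innovation gain `a`, consensus gain `b`
and regularization gain `lam`: `M.estimate a b lam k ω i` is the estimate of node `i` at
instant `k`. Node `i` receives `x_j(k) + f_{ji}(x_j(k) - x_i(k)) ξ_{ji}(k)` from neighbour `j`. -/
noncomputable def estimate (M : RegressionNetwork Ω N n m) (a b lam : ℕ → ℝ) :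
    ℕ → Ω → Fin N → EuclideanSpace ℝ (Fin n)
  | 0, _, i => M.init i
  | k + 1, ω, i =>
    let x := M.estimate a b lam k ω
    let received : Fin N → EuclideanSpace ℝ (Fin n) := fun j =>
      x j + M.f j i (x j - x i) • M.ξ j i k ω
    x i
      + a k • Matrix.toEuclideanLin (M.H i k ω).transpose
          (M.y i k ω - Matrix.toEuclideanLin (M.H i k ω) (x i))
      + b k • ∑ j ∈ M.neighbors k ω i, M.A k ω i j • (received j - x i)
      - lam k • x i

/-- The block diagonal matrix of the regression matrices of all nodes at instant `k`. -/
def blockH (M : RegressionNetwork Ω N n m) (k : ℕ) (ω : Ω) :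
    Matrix (Σ i, Fin (m i)) (Σ _ : Fin N, Fin n) ℝ :=
  Matrix.blockDiagonal' fun i => M.H i k ω

/-- The stacked measurement noise at instant `k`. -/
noncomputable def stackedV (M : RegressionNetwork Ω N n m) (k : ℕ) (ω : Ω) :
    EuclideanSpace ℝ (Σ i, Fin (m i)) :=
  WithLp.toLp 2 fun p => M.v p.1 k ω p.2

/-- The stacked communication noise at instant `k`. -/
noncomputable def stackedξ (M : RegressionNetwork Ω N n m) (k : ℕ) (ω : Ω) :
    EuclideanSpace ℝ (Fin N × Fin N × Fin n) :=
  WithLp.toLp 2 fun p => M.ξ p.1 p.2.1 k ω p.2.2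

/-- The σ-algebra generated by the graph and the regression matrices at instant `k`. -/
@[reducible] def dataSigma (M : RegressionNetwork Ω N n m) (k : ℕ) : MeasurableSpace Ω :=
  (⨆ i, ⨆ j, MeasurableSpace.comap (fun ω => M.A k ω i j) inferInstance) ⊔
    ⨆ i, ⨆ r, ⨆ c, MeasurableSpace.comap (fun ω => M.H i k ω r c) inferInstance

/-- The σ-algebra generated by all the noises at instant `k`. -/
@[reducible] def noiseSigma (M : RegressionNetwork Ω N n m) (k : ℕ) : MeasurableSpace Ω :=
  (⨆ i, MeasurableSpace.comap (M.v i k) inferInstance) ⊔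
    ⨆ j, ⨆ i, MeasurableSpace.comap (M.ξ j i k) inferInstance

/-- `M.past k` is the σ-algebra generated by the graphs, regression matrices and noises at the
instants `s < k` (the trivial σ-algebra for `k = 0`). -/
@[reducible] def past (M : RegressionNetwork Ω N n m) (k : ℕ) : MeasurableSpace Ω :=
  ⨆ (s : ℕ) (_ : s < k), M.dataSigma s ⊔ M.noiseSigma s

/-- The noise intensity functions grow at most linearly. -/
def LinearNoiseIntensity (M : RegressionNetwork Ω N n m) : Prop :=
  ∃ σ b : ℝ, ∀ j i x, |M.f j i x| ≤ σ * ‖x‖ + b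

/-- Both noises are martingale difference sequences, the noises are independent of the regression
matrices and graphs (as processes), and their conditional second moments are uniformly bounded. -/
def NoiseAssumption (M : RegressionNetwork Ω N n m) (μ : Measure Ω) : Prop :=
  IsMartingaleDifference μ M.past M.stackedV ∧
  IsMartingaleDifference μ M.past M.stackedξ ∧
  Indep (⨆ k, M.noiseSigma k) (⨆ k, M.dataSigma k) μ ∧
  (∀ k, Integrable (fun ω => ‖M.stackedV k ω‖ ^ 2 + ‖M.stackedξ k ω‖ ^ 2) μ) ∧
  ∃ β : ℝ, ∀ᵐ ω ∂μ, ∀ k,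
    (μ[fun ω' => ‖M.stackedV k ω'‖ ^ 2 + ‖M.stackedξ k ω'‖ ^ 2 | M.past k]) ω ≤ β

/-- The graphs are conditionally balanced: the conditional expectation of the adjacency matrix
given the past is almost surely nonnegative and the adjacency matrix of a balanced digraph. -/
def CondBalanced (M : RegressionNetwork Ω N n m) (μ : Measure Ω) : Prop :=
  ∀ k, ∀ᵐ ω ∂μ, (∀ i j, 0 ≤ condExpMatrix μ (M.past k) (M.A k) ω i j) ∧
    IsBalanced (condExpMatrix μ (M.past k) (M.A k) ω)

/-- `sup_k (‖L(k)‖ + (E[‖𝓗ᵀ(k) 𝓗(k)‖^p | past])^(1/p)) ≤ ρ` almost surely, where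
`p = 2 ^ max h 2` and the norms are spectral norms; that the conditional moment is bounded
contains that the moment is finite. -/
def MomentBound (M : RegressionNetwork Ω N n m) (μ : Measure Ω) (h : ℕ) (ρ : ℝ) : Prop :=
  (∀ k, Integrable (fun ω => ‖(M.blockH k ω).transpose * M.blockH k ω‖ ^ 2 ^ max h 2) μ) ∧
  ∀ᵐ ω ∂μ, ∀ k,
    ‖graphLaplacian (M.A k ω)‖ +
      ((μ[fun ω' => ‖(M.blockH k ω').transpose * M.blockH k ω'‖ ^ 2 ^ max h 2 | M.past k]) ω)
        ^ (1 / (2 ^ max h 2 : ℝ)) ≤ ρ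

/-- The (random) loss of node `j` at instant `t`. -/
noncomputable def loss (M : RegressionNetwork Ω N n m) (j : Fin N) (t : ℕ)
    (z : EuclideanSpace ℝ (Fin n)) (ω : Ω) : ℝ :=
  (1 / 2) * ‖Matrix.toEuclideanLin (M.H j t ω) z - M.y j t ω‖ ^ 2

/-- `z` is a linear optimal estimated parameter up to time `T`: it minimizes the cumulative
expected loss of the network. -/
def IsLinearOptimal (M : RegressionNetwork Ω N n m) (μ : Measure Ω) (T : ℕ)
    (z : EuclideanSpace ℝ (Fin n)) : Prop :=
  IsMinOn (fun z' => ∑ t ∈ Finset.range (T + 1), ∑ j, ∫ ω, M.loss j t z' ω ∂μ) Set.univ z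

/-- The regret at time `T` of node `i`, running the algorithm with the given gains, against the
fixed parameter `z`. -/
noncomputable def regret (M : RegressionNetwork Ω N n m) (μ : Measure Ω) (a b lam : ℕ → ℝ)
    (i : Fin N) (T : ℕ) (z : EuclideanSpace ℝ (Fin n)) : ℝ :=
  (∑ t ∈ Finset.range (T + 1), ∑ j, ∫ ω, M.loss j t (M.estimate a b lam t ω i) ω ∂μ) -
    ∑ t ∈ Finset.range (T + 1), ∑ j, ∫ ω, M.loss j t z ω ∂μ

end RegressionNetwork

/-! ### Quadratic forms bounded below by eigenvalues -/

section LinearAlgebra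

variable {ι : Type*} [Fintype ι]

/-! The argument is a mean-square Lyapunov estimate for the errors `err`, the differences between
the estimates and the true parameter, followed by summation. Let e(k) be their `energy`, the sum
over the nodes of the second moments, and let D(k) be the sum of `obsForm` and `graphForm` at the
current errors: the mean quadratic forms of the Gram matrices and of the symmetrized Laplacian.

One step of the algorithm gives e(k+1) ≤ e(k) - 2a(k)D(k) + C a(k)²(e(k)+1) (`exists_step_bound`).
The noise cross terms vanish because independence lets the martingale-difference property survive
conditioning on the current graph and regression matrices (`condExp_eq_zero_of_noise`). Balance
turns the directed consensus term into the symmetrized form (`sum_integral_weight_inner`). Since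
λ(k) = O(a(k)²), the regularization only enters the error term.

A single D(k) need not dominate e(k), but over a window it does, up to second order. Connectedness
controls the deviations from the network average and observability controls the average
(`exists_coercive`). Both hypotheses condition on the past of the window start, so they apply only
to errors frozen there. Within the window the errors move by O(a²(e+1)) in mean square
(`exists_energy_diff_le`), so freezing costs a second-order term.

The resulting recursion along windows is of Chung type and yields e(t) = O(t^(-τ))
(`exists_le_mul_rpow_neg_of_window`). By `loss_expansion` an expected loss is a noise floor plus
half of E‖H u‖², with u the deviation from the true parameter. Hence the true parameter is optimal,
the regret is a sum of such excesses, and it is at most a constant times the sum of e(t), which is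
O(T^(1-τ)). -/

lemma Matrix.abs_apply_le_l2_opNorm {κ : Type*} [Fintype κ] [DecidableEq κ]
    (A : Matrix ι κ ℝ) (i : ι) (j : κ) : |A i j| ≤ ‖A‖ := by
  have h := A.l2_opNorm_mulVec (EuclideanSpace.single j (1 : ℝ))
  have h2 := PiLp.norm_apply_le ((EuclideanSpace.equiv ι ℝ).symm <|
    A.mulVec (EuclideanSpace.single j (1 : ℝ))) i
  simp at h h2
  exact h2.trans h

variable [DecidableEq ι]

lemma Matrix.IsHermitian.dotProduct_mulVec_eq_sum_eigenvalues {S : Matrix ι ι ℝ}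
    (hS : S.IsHermitian) (x : ι → ℝ) :
    x ⬝ᵥ S.mulVec x =
      ∑ i, hS.eigenvalues i * (inner ℝ (hS.eigenvectorBasis i) (WithLp.toLp 2 x)) ^ 2 := by
  have h1 : x ⬝ᵥ S.mulVec x
      = inner ℝ (WithLp.toLp 2 x) (Matrix.toEuclideanLin S (WithLp.toLp 2 x)) := by
    simp [EuclideanSpace.inner_eq_star_dotProduct, Matrix.toLpLin_apply, dotProduct_comm]
  rw [h1, ← OrthonormalBasis.sum_inner_mul_inner hS.eigenvectorBasis]
  refine Finset.sum_congr rfl fun i _ => ?_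
  have hsym := Matrix.isSymmetric_toEuclideanLin_iff.mpr hS
  rw [← hsym]
  have : Matrix.toEuclideanLin S (hS.eigenvectorBasis i)
      = hS.eigenvalues i • hS.eigenvectorBasis i := by
    ext j
    have := congrFun (hS.mulVec_eigenvectorBasis i) j
    simpa [Matrix.toLpLin_apply] using this
  rw [this, inner_smul_left, real_inner_comm]
  simp
  ring

lemma sum_inner_eigenvectorBasis_sq {S : Matrix ι ι ℝ} (hS : S.IsHermitian) (x : ι → ℝ) :
    ∑ i, (inner ℝ (hS.eigenvectorBasis i) (WithLp.toLp 2 x)) ^ 2 = x ⬝ᵥ x := by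
  have := OrthonormalBasis.sum_sq_inner_right hS.eigenvectorBasis (WithLp.toLp 2 x)
  rw [this, EuclideanSpace.norm_sq_eq]
  simp [dotProduct, sq]

lemma lambdaMin_mul_dotProduct_le {S : Matrix ι ι ℝ} {θ : ℝ} (hθ : 0 < θ)
    (h : θ ≤ lambdaMin S) (x : ι → ℝ) : θ * (x ⬝ᵥ x) ≤ x ⬝ᵥ S.mulVec x := by
  unfold lambdaMin nthSmallestEigenvalue at h
  split_ifs at h with hc
  · rw [hc.1.dotProduct_mulVec_eq_sum_eigenvalues, ← sum_inner_eigenvectorBasis_sq hc.1,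
      Finset.mul_sum]
    refine Finset.sum_le_sum fun i _ => mul_le_mul_of_nonneg_right (h.trans ?_) (sq_nonneg _)
    exact hc.1.eigenvalues₀_antitone (Fin.mk_le_mk.mpr (Nat.le_sub_one_of_lt (Fin.is_lt _)))
  -- In the degenerate case the eigenvalue defaults to 0, so positivity of θ is what forces S to be
  -- symmetric.
  · exact absurd h (not_le.mpr hθ)

/-- Every eigenvector except the one listed last has eigenvalue at least θ > 0, hence is orthogonal
to the kernel vector 1. So 1 is a multiple of the last eigenvector, and a vector of zero sum has no
component along it. The sign of the last eigenvalue plays no role. -/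
lemma lambdaTwo_mul_dotProduct_le {S : Matrix ι ι ℝ} {θ : ℝ} (hθ : 0 < θ)
    (h : θ ≤ lambdaTwo S) (hker : S.mulVec 1 = 0) (x : ι → ℝ) (hx : ∑ i, x i = 0) :
    θ * (x ⬝ᵥ x) ≤ x ⬝ᵥ S.mulVec x := by
  unfold lambdaTwo nthSmallestEigenvalue at h
  split_ifs at h with hc
  swap
  · exact absurd h (not_le.mpr hθ)
  have hS := hc.1
  have hcard := hc.2.2
  -- This is the reindexing between `eigenvalues₀`, which is decreasing, and `eigenvalues`; `last`
  -- carries the smallest eigenvalue.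
  set e : Fin (Fintype.card ι) ≃ ι := Fintype.equivOfCardEq (Fintype.card_fin _) with he
  set last : ι := e ⟨Fintype.card ι - 1, by omega⟩ with hlast
  have hev : ∀ i, i ≠ last → θ ≤ hS.eigenvalues i := by
    intro i hi
    refine h.trans (hS.eigenvalues₀_antitone (Fin.mk_le_mk.mpr ?_))
    have h1 := Fin.is_lt (e.symm i)
    have h2 : e.symm i ≠ ⟨Fintype.card ι - 1, by omega⟩ := fun hcon => hi (by
      rw [hlast, ← hcon, Equiv.apply_symm_apply])
    have h3 : (e.symm i : ℕ) ≠ Fintype.card ι - 1 := fun hcon => h2 (Fin.ext hcon)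
    change (e.symm i : ℕ) ≤ _
    omega
  set one : EuclideanSpace ℝ ι := WithLp.toLp 2 1
  have hone : ∀ i, i ≠ last → inner ℝ (hS.eigenvectorBasis i) one = 0 := by
    intro i hi
    have hsym := Matrix.isSymmetric_toEuclideanLin_iff.mpr hS
    have h1 : Matrix.toEuclideanLin S (hS.eigenvectorBasis i)
        = hS.eigenvalues i • hS.eigenvectorBasis i := by
      ext j
      have := congrFun (hS.mulVec_eigenvectorBasis i) j
      simpa [Matrix.toLpLin_apply] using this
    have h2 := hsym (hS.eigenvectorBasis i) one
    have h3 : Matrix.toEuclideanLin S one = 0 := by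
      ext j; simp [one, Matrix.toLpLin_apply, hker]
    rw [h1, h3, inner_smul_left, inner_zero_right] at h2
    have := hev i hi
    rcases mul_eq_zero.mp h2 with h4 | h4
    · simp at h4; linarith
    · exact h4
  have hx0 : inner ℝ (hS.eigenvectorBasis last) (WithLp.toLp 2 x) = 0 := by
    have h1 : inner ℝ one (WithLp.toLp 2 x) = 0 := by
      simpa [one, EuclideanSpace.inner_eq_star_dotProduct, dotProduct] using hx
    rw [← OrthonormalBasis.sum_inner_mul_inner hS.eigenvectorBasis,
      Finset.sum_eq_single last] at h1
    · rcases mul_eq_zero.mp h1 with h2 | h2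
      · exfalso
        -- Otherwise 1 would be orthogonal to the whole eigenbasis, although its squared norm is the
        -- cardinality, which is at least 2.
        have h3 := OrthonormalBasis.sum_sq_inner_right hS.eigenvectorBasis one
        rw [Finset.sum_eq_single last] at h3
        · rw [real_inner_comm, h2, EuclideanSpace.norm_sq_eq] at h3
          have h4 : (0 : ℝ) < Fintype.card ι := by exact_mod_cast (by omega)
          simp [one] at h3
          simp [h3] at h4
        · intro i _ hi; rw [hone i hi]; simp
        · simp
      · exact h2
    · intro i _ hi; rw [real_inner_comm, hone i hi]; simp
    · simp
  rw [hS.dotProduct_mulVec_eq_sum_eigenvalues, ← sum_inner_eigenvectorBasis_sq hS, Finset.mul_sum]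
  refine Finset.sum_le_sum fun i _ => ?_
  by_cases hi : i = last
  · rw [hi, hx0]; simp
  · exact mul_le_mul_of_nonneg_right (hev i hi) (sq_nonneg _)

end LinearAlgebra

/-! ### Conditional moments and conditional orthogonality -/

section ConditionalExpectation

variable {Ω : Type*} {F G G₁ D m mΩ : MeasurableSpace Ω} {μ : Measure Ω}

/-- The bound on the conditional expectation says that the measure with density X is at most C times
μ on sets of F; integrating an F-measurable g against both gives the claim. Working with `lintegral`
avoids presupposing that X g is integrable. -/
lemma lintegral_ofReal_mul_le_of_condExp_le [IsFiniteMeasure μ]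
    (hF : F ≤ mΩ) {X : Ω → ℝ} (hX : Integrable X μ) (hX0 : 0 ≤ᵐ[μ] X) {C : ℝ}
    (hC : ∀ᵐ ω ∂μ, (μ[X | F]) ω ≤ C) {g : Ω → ENNReal} (hg : Measurable[F] g) :
    ∫⁻ ω, ENNReal.ofReal (X ω) * g ω ∂μ ≤ ENNReal.ofReal C * ∫⁻ ω, g ω ∂μ := by
  have hXm : AEMeasurable (fun ω => ENNReal.ofReal (X ω)) μ := hX.aemeasurable.ennreal_ofReal
  have hgm : Measurable g := hg.mono hF le_rfl
  have hle : (μ.withDensity fun ω => ENNReal.ofReal (X ω)).trim hF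
      ≤ (ENNReal.ofReal C • μ).trim hF := by
    refine Measure.le_iff.mpr fun s hs => ?_
    rw [trim_measurableSet_eq hF hs, trim_measurableSet_eq hF hs,
      withDensity_apply _ (hF s hs),
      ← ofReal_integral_eq_lintegral_ofReal hX.integrableOn (ae_restrict_of_ae hX0),
      ← setIntegral_condExp hF hX hs]
    have h1 : ∫ ω in s, (μ[X | F]) ω ∂μ ≤ ∫ _ in s, C ∂μ :=
      integral_mono_ae integrable_condExp.integrableOn (integrable_const _)
        (ae_restrict_of_ae hC)
    have h0 : 0 ≤ ∫ ω in s, (μ[X | F]) ω ∂μ :=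
      integral_nonneg_of_ae (ae_restrict_of_ae (condExp_nonneg hX0))
    rw [setIntegral_const, smul_eq_mul] at h1
    rcases eq_or_ne (μ s) 0 with hs0 | hs0
    · rw [measureReal_def, hs0] at h1
      rw [ENNReal.ofReal_eq_zero.mpr (by simpa using h1)]; simp
    · calc _ ≤ ENNReal.ofReal (μ.real s * C) := ENNReal.ofReal_le_ofReal h1
        _ = _ := by
          rw [ENNReal.ofReal_mul measureReal_nonneg, ofReal_measureReal, mul_comm]; simp
  calc ∫⁻ ω, ENNReal.ofReal (X ω) * g ω ∂μ
      = ∫⁻ ω, g ω ∂(μ.withDensity fun ω => ENNReal.ofReal (X ω)) := by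
        rw [lintegral_withDensity_eq_lintegral_mul₀ hXm hgm.aemeasurable]; rfl
    _ = ∫⁻ ω, g ω ∂(μ.withDensity fun ω => ENNReal.ofReal (X ω)).trim hF :=
        (lintegral_trim hF hg).symm
    _ ≤ ∫⁻ ω, g ω ∂(ENNReal.ofReal C • μ).trim hF := lintegral_mono' hle le_rfl
    _ = _ := by rw [lintegral_trim hF hg, lintegral_smul_measure]; rfl

lemma integrable_mul_of_condExp_le [IsFiniteMeasure μ]
    (hF : F ≤ mΩ) {X : Ω → ℝ} (hX : Integrable X μ) (hX0 : 0 ≤ᵐ[μ] X) {C : ℝ} (hC0 : 0 ≤ C)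
    (hC : ∀ᵐ ω ∂μ, (μ[X | F]) ω ≤ C) {g : Ω → ℝ} (hg : Measurable[F] g) (hg0 : ∀ ω, 0 ≤ g ω)
    (hgi : Integrable g μ) :
    Integrable (fun ω => X ω * g ω) μ ∧ ∫ ω, X ω * g ω ∂μ ≤ C * ∫ ω, g ω ∂μ := by
  have key := lintegral_ofReal_mul_le_of_condExp_le hF hX hX0 hC hg.ennreal_ofReal
  rw [← ofReal_integral_eq_lintegral_ofReal hgi (ae_of_all _ hg0), ← ENNReal.ofReal_mul hC0] at key
  have hnn : 0 ≤ᵐ[μ] fun ω => X ω * g ω := by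
    filter_upwards [hX0] with ω h using mul_nonneg h (hg0 ω)
  have haesm : AEStronglyMeasurable (fun ω => X ω * g ω) μ :=
    hX.aestronglyMeasurable.mul hgi.aestronglyMeasurable
  have heq : ∫⁻ ω, ENNReal.ofReal (X ω) * ENNReal.ofReal (g ω) ∂μ
      = ∫⁻ ω, ENNReal.ofReal (X ω * g ω) ∂μ := by
    refine lintegral_congr fun ω => ?_
    rw [ENNReal.ofReal_mul' (hg0 ω)]
  rw [heq] at key
  have hint : Integrable (fun ω => X ω * g ω) μ := by
    refine ⟨haesm, ?_⟩
    rw [hasFiniteIntegral_iff_ofReal hnn]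
    exact key.trans_lt ENNReal.ofReal_lt_top
  refine ⟨hint, ?_⟩
  rw [← ofReal_integral_eq_lintegral_ofReal hint hnn] at key
  exact (ENNReal.ofReal_le_ofReal_iff (mul_nonneg hC0 (integral_nonneg hg0))).mp key

/-- If `Z` is independent of `D` jointly with `G₁`, and the conditional expectation of `Z` given
`G₁` vanishes, then so does the one given `G₁ ⊔ D`. -/
lemma condExp_sup_eq_zero_of_indep [IsProbabilityMeasure μ] {E : Type*} [NormedAddCommGroup E]
    [NormedSpace ℝ E] [CompleteSpace E]
    (hG : G ≤ mΩ) (hG₁ : G₁ ≤ G) (hD : D ≤ mΩ) (hind : Indep G D μ) {Z : Ω → E}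
    (hZ : StronglyMeasurable[G] Z) (hZi : Integrable Z μ)
    (hZ0 : μ[Z | G₁] =ᵐ[μ] 0) : μ[Z | G₁ ⊔ D] =ᵐ[μ] 0 := by
  have hG₁' : G₁ ≤ mΩ := hG₁.trans hG
  have hm : G₁ ⊔ D ≤ mΩ := sup_le hG₁' hD
  -- It suffices to integrate over the sets s ∩ t with s in `G₁` and t in `D`: they form a π-system
  -- generating the join.
  have hset : ∀ s, MeasurableSet[G₁ ⊔ D] s → ∫ ω in s, Z ω ∂μ = 0 := by
    have hzero : ∀ s, MeasurableSet[G₁] s → ∫ ω in s, Z ω ∂μ = 0 := by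
      intro s hs
      rw [← setIntegral_condExp hG₁' hZi hs, setIntegral_congr_ae (g := fun _ => (0 : E)) (hG₁' s hs)
        (by filter_upwards [hZ0] with ω h _ using h)]
      simp
    have hgen : G₁ ⊔ D = MeasurableSpace.generateFrom
        (Set.image2 (· ∩ ·) {s | MeasurableSet[G₁] s} {s | MeasurableSet[D] s}) := by
      refine le_antisymm (sup_le ?_ ?_) ?_
      · intro s hs
        exact MeasurableSpace.measurableSet_generateFrom ⟨s, hs, Set.univ, MeasurableSet.univ, by simp⟩
      · intro s hs
        exact MeasurableSpace.measurableSet_generateFrom ⟨Set.univ, MeasurableSet.univ, s, hs, by simp⟩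
      · refine MeasurableSpace.generateFrom_le ?_
        rintro _ ⟨s, hs, t, ht, rfl⟩
        exact MeasurableSet.inter (le_sup_left (a := G₁) s hs) (le_sup_right (a := G₁) t ht)
    have hpi : IsPiSystem (Set.image2 (· ∩ ·) {s | MeasurableSet[G₁] s} {s | MeasurableSet[D] s}) := by
      rintro _ ⟨s, hs, t, ht, rfl⟩ _ ⟨s', hs', t', ht', rfl⟩ _
      exact ⟨s ∩ s', MeasurableSet.inter hs hs', t ∩ t', MeasurableSet.inter ht ht',
        Set.inter_inter_inter_comm _ _ _ _⟩
    intro s hs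
    induction s, hs using MeasurableSpace.induction_on_inter hgen hpi with
    | empty => simp
    | basic s hs =>
      obtain ⟨s, hs, t, ht, rfl⟩ := hs
      -- The indicator of s times Z is `G`-measurable, so given `D` its conditional expectation is
      -- the constant ∫ over s of Z, which is zero.
      have h1 := condExp_indep_eq hG hD
        (hZ.indicator (hG₁ s hs)) hind
      have h2 : ∫ ω in t, s.indicator Z ω ∂μ = 0 := by
        rw [← setIntegral_condExp hD (hZi.indicator (hG₁' s hs)) ht,
          setIntegral_congr_ae (g := fun _ => (0 : E)) (hD t ht)]
        · simp
        · filter_upwards [h1] with ω h _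
          rw [h, integral_indicator (hG₁' s hs), hzero s hs]
      rw [setIntegral_indicator (hG₁' s hs)] at h2
      change ∫ ω in s ∩ t, Z ω ∂μ = 0
      rwa [Set.inter_comm]
    | compl s hs ih =>
      have := integral_add_compl (hm s hs) hZi
      rw [ih, zero_add] at this
      rw [this, ← setIntegral_univ]
      exact hzero _ MeasurableSet.univ
    | iUnion f hdisj hf ih =>
      rw [integral_iUnion (fun i => hm _ (hf i)) hdisj hZi.integrableOn]
      simp [ih]
  refine (ae_eq_condExp_of_forall_setIntegral_eq hm hZi (g := 0) (fun s _ _ => ?_)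
    (fun s hs _ => ?_) ?_).symm
  · exact (integrable_zero Ω E μ).integrableOn
  · simp [hset s hs]
  · exact aestronglyMeasurable_zero

lemma integral_inner_eq_zero_of_condExp_eq_zero [IsFiniteMeasure μ] {E : Type*}
    [NormedAddCommGroup E] [InnerProductSpace ℝ E] [CompleteSpace E]
    (hm : m ≤ mΩ) {Y Z : Ω → E} (hY : StronglyMeasurable[m] Y) (hZ : Integrable Z μ)
    (hYZ : Integrable (fun ω => inner ℝ (Y ω) (Z ω)) μ) (hZ0 : μ[Z | m] =ᵐ[μ] 0) :
    ∫ ω, inner ℝ (Y ω) (Z ω) ∂μ = 0 := by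
  have h := condExp_bilin_of_stronglyMeasurable_left (innerSL ℝ) hY hYZ hZ
  have h0 : μ[fun ω => innerSL ℝ (Y ω) (Z ω) | m] =ᵐ[μ] fun _ => (0 : ℝ) := by
    filter_upwards [h, hZ0] with ω h1 h2
    rw [h1, h2]; simp
  rw [← integral_condExp hm]
  exact (integral_congr_ae h0).trans (integral_zero Ω ℝ)

end ConditionalExpectation

/-! ### Deterministic recursions and sums of powers -/

section RealSequences

lemma tendsto_nat_add_one_rpow_neg {s : ℝ} (hs : 0 < s) :
    Tendsto (fun m : ℕ => ((m : ℝ) + 1) ^ (-s)) atTop (nhds 0) :=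
  (tendsto_rpow_neg_atTop hs).comp
    (tendsto_atTop_add_const_right _ _ tendsto_natCast_atTop_atTop)

lemma self_le_rpow_of_le_one {x τ : ℝ} (hx : 0 < x) (hx1 : x ≤ 1) (hτ : τ ≤ 1) : x ≤ x ^ τ := by
  simpa using Real.rpow_le_rpow_of_exponent_ge hx hx1 hτ

/-- The decrement of q(m) = (m+1)^(-τ) is at most q(m)/(m+1). Writing 1/(m+1) as q(m) times a null
sequence shows that it is o(q(m)²), the form that the induction below needs. -/
lemma rpow_neg_sub_rpow_neg_succ_le {τ : ℝ} (hτ' : τ < 1) (m : ℕ) :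
    ((m : ℝ) + 1) ^ (-τ) - ((m : ℝ) + 2) ^ (-τ)
      ≤ ((m : ℝ) + 1) ^ (-τ) * (((m : ℝ) + 1) ^ (-τ) * ((m : ℝ) + 1) ^ (-(1 - τ))) := by
  have hm : (0 : ℝ) < (m : ℝ) + 1 := by positivity
  have h1 : ((m : ℝ) + 1) ^ (-τ) * ((m : ℝ) + 1) ^ (-(1 - τ)) = 1 / ((m : ℝ) + 1) := by
    rw [← Real.rpow_add hm]
    have : -τ + -(1 - τ) = -1 := by ring
    rw [this, Real.rpow_neg_one, one_div]
  rw [h1]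
  have h2 : ((m : ℝ) + 1) / (m + 2) ≤ (((m : ℝ) + 1) / (m + 2)) ^ τ :=
    self_le_rpow_of_le_one (by positivity) (by rw [div_le_one (by positivity)]; linarith) hτ'.le
  have h3 : ((m : ℝ) + 2) ^ (-τ)
      = ((m : ℝ) + 1) ^ (-τ) * (((m : ℝ) + 1) / (m + 2)) ^ τ := by
    rw [Real.div_rpow hm.le (by positivity), Real.rpow_neg hm.le, Real.rpow_neg (by positivity)]
    have := (Real.rpow_pos_of_pos hm τ).ne'
    field_simp
  have h4 : 1 - 1 / ((m : ℝ) + 1) ≤ ((m : ℝ) + 1) / (m + 2) := by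
    rw [sub_le_iff_le_add, div_add_div _ _ (by positivity) hm.ne', le_div_iff₀ (by positivity)]
    nlinarith
  rw [h3]
  have := Real.rpow_pos_of_pos hm (-τ)
  nlinarith

/-- A version of Chung's lemma. -/
lemma exists_le_mul_rpow_neg_of_recursion {u : ℕ → ℝ} {τ c C : ℝ} (hτ : 0 < τ) (hτ' : τ < 1)
    (hc : 0 < c) (hC : 0 ≤ C) (hu : ∀ m, 0 ≤ u m)
    (hrec : ∀ m : ℕ, u (m + 1) ≤ u m - c * ((m : ℝ) + 1) ^ (-τ) * u m
      + C * (((m : ℝ) + 1) ^ (-τ)) ^ 2 * (u m + 1)) :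
    ∃ K, 0 ≤ K ∧ ∀ m : ℕ, u m ≤ K * ((m : ℝ) + 1) ^ (-τ) := by
  set q : ℕ → ℝ := fun m => ((m : ℝ) + 1) ^ (-τ) with hq
  have hqpos : ∀ m, 0 < q m := fun m => Real.rpow_pos_of_pos (by positivity) _
  have hq0 : Tendsto q atTop (nhds 0) := tendsto_nat_add_one_rpow_neg hτ
  have hr0 := tendsto_nat_add_one_rpow_neg (s := 1 - τ) (by linarith)
  have e1 : ∀ᶠ m in atTop, (C + c) * q m < min (c / 2) 1 := by
    have : Tendsto (fun m => (C + c) * q m) atTop (nhds 0) := by simpa using hq0.const_mul (C + c)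
    exact this.eventually_lt_const (by positivity)
  have e2 : ∀ᶠ m : ℕ in atTop, ((m : ℝ) + 1) ^ (-(1 - τ)) < c / 4 :=
    hr0.eventually_lt_const (by positivity)
  -- From M on, the second-order term in u absorbs at most half of the contraction, the contraction
  -- factor stays nonnegative, and q decreases by at most (c/4) q².
  obtain ⟨M, hM⟩ := eventually_atTop.mp (e1.and e2)
  -- The first entry makes the forcing term C q² at most K (c/4) q²; the second starts the induction
  -- at M.
  set K := max (4 * C / c) (u M / q M) with hK
  have hK0 : 0 ≤ K := le_max_of_le_left (by positivity)
  have hlarge : ∀ m, M ≤ m → u m ≤ K * q m := by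
    intro m hm
    induction m, hm using Nat.le_induction with
    | base => exact (div_le_iff₀ (hqpos M)).mp (le_max_right _ _)
    | succ m hm ih =>
      obtain ⟨h1, h2⟩ := hM m hm
      have h1a := h1.trans_le (min_le_left _ _)
      have h1b := h1.trans_le (min_le_right _ _)
      have hqm := hqpos m
      have h3 := rpow_neg_sub_rpow_neg_succ_le hτ' m
      have h4 : q (m + 1) = ((m : ℝ) + 2) ^ (-τ) := by
        simp only [hq]; push_cast; ring_nf
      rw [← h4] at h3
      change q m - q (m + 1) ≤ q m * (q m * _) at h3
      have h5 : q m - q (m + 1) ≤ q m * (q m * (c / 4)) :=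
        h3.trans (by gcongr)
      have h6 : C ≤ K * (c / 4) := by
        have := le_max_left (4 * C / c) (u M / q M)
        rw [div_le_iff₀ hc] at this
        linarith
      have h7 := hrec m
      change u (m + 1) ≤ u m - c * q m * u m + C * q m ^ 2 * (u m + 1) at h7
      have hCq : C * q m ≤ c / 2 := by nlinarith
      have h8 : C * q m ^ 2 * u m ≤ c / 2 * q m * u m := by
        have := mul_le_mul_of_nonneg_right hCq (mul_nonneg hqm.le (hu m))
        linarith
      have h9 : 0 ≤ 1 - c / 2 * q m := by nlinarith
      calc u (m + 1) ≤ (1 - c / 2 * q m) * u m + C * q m ^ 2 := by linarith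
        _ ≤ (1 - c / 2 * q m) * (K * q m) + K * (c / 4) * q m ^ 2 := by gcongr
        _ = K * (q m - q m * (q m * (c / 4))) := by ring
        _ ≤ K * q (m + 1) := by gcongr; linarith
  -- The added sum covers the finitely many indices below M.
  refine ⟨K + ∑ j ∈ Finset.range M, u j / q j,
    add_nonneg hK0 (Finset.sum_nonneg fun j _ => div_nonneg (hu j) (hqpos j).le), fun m => ?_⟩
  have hs0 : 0 ≤ ∑ j ∈ Finset.range M, u j / q j :=
    Finset.sum_nonneg fun j _ => div_nonneg (hu j) (hqpos j).le
  rcases le_or_gt M m with hm | hm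
  · refine (hlarge m hm).trans (mul_le_mul_of_nonneg_right (by linarith) (hqpos m).le)
  · have : u m / q m ≤ ∑ j ∈ Finset.range M, u j / q j :=
      Finset.single_le_sum (f := fun j => u j / q j)
        (fun j _ => div_nonneg (hu j) (hqpos j).le) (Finset.mem_range.mpr hm)
    rw [← div_le_iff₀ (hqpos m)]
    linarith

/-- Concavity of x^(1-τ), in the form of Bernoulli's inequality at T+1, bounds each term by 1/(1-τ)
times an increment of T^(1-τ), and the sum telescopes. -/
lemma sum_range_rpow_neg_le {τ : ℝ} (hτ : 0 < τ) (hτ' : τ < 1) (T : ℕ) :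
    ∑ t ∈ Finset.range T, ((t : ℝ) + 1) ^ (-τ) ≤ 1 / (1 - τ) * (T : ℝ) ^ (1 - τ) := by
  induction T with
  | zero => simp [Real.zero_rpow (by linarith : (1 : ℝ) - τ ≠ 0)]
  | succ T ih =>
    rw [Finset.sum_range_succ]
    have hT : (0 : ℝ) < (T : ℝ) + 1 := by positivity
    have h1 := _root_.rpow_one_add_le_one_add_mul_self (s := -(1 / ((T : ℝ) + 1)))
      (neg_le_neg (by rw [div_le_one hT]; simp)) (p := 1 - τ) (by linarith) (by linarith)
    have h2 : 1 + -(1 / ((T : ℝ) + 1)) = T / ((T : ℝ) + 1) := by field_simp; ring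
    rw [h2, Real.div_rpow (by positivity) hT.le, div_le_iff₀ (Real.rpow_pos_of_pos hT _)] at h1
    have h3 : ((T : ℝ) + 1) ^ (-τ) = 1 / ((T : ℝ) + 1) * ((T : ℝ) + 1) ^ (1 - τ) := by
      rw [Real.rpow_sub hT, Real.rpow_one, Real.rpow_neg hT.le]; field_simp
    have h4 : (T : ℝ) ^ (1 - τ) + (1 - τ) * ((T : ℝ) + 1) ^ (-τ) ≤ ((T : ℝ) + 1) ^ (1 - τ) := by
      rw [h3]; linarith
    have h5 : ((T : ℝ) + 1) ^ (-τ) ≤ 1 / (1 - τ) * (((T : ℝ) + 1) ^ (1 - τ) - (T : ℝ) ^ (1 - τ)) := by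
      rw [one_div, ← div_eq_inv_mul, le_div_iff₀ (by linarith)]; linarith
    push_cast
    linarith

/-- If `e` decreases on windows of length `h` with gain `a k = c₁ / (k + 1) ^ τ`, up to errors of
second order in the gain, then `e k = O(k ^ (-τ))`. -/
lemma exists_le_mul_rpow_neg_of_window {e D a : ℕ → ℝ} {τ c₁ c C : ℝ} {h : ℕ} (hh : 0 < h)
    (hc₁ : 0 < c₁) (hτ : 0 < τ) (hτ' : τ < 1) (ha : ∀ k : ℕ, a k = c₁ / ((k : ℝ) + 1) ^ τ)
    (he : ∀ k, 0 ≤ e k) (hD : ∀ k, 0 ≤ D k) (hc : 0 < c) (hC : 0 ≤ C)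
    (hstep : ∀ k, e (k + 1) ≤ e k - 2 * a k * D k + C * a k ^ 2 * (e k + 1))
    (hwin : ∀ m, c * e (m * h) - C * a (m * h) ^ 2 * (e (m * h) + 1)
      ≤ ∑ s ∈ Finset.Ico (m * h) ((m + 1) * h), D s) :
    ∃ K, 0 ≤ K ∧ ∀ t : ℕ, e t ≤ K * ((t : ℝ) + 1) ^ (-τ) := by
  have ha' : ∀ k : ℕ, a k = c₁ * ((k : ℝ) + 1) ^ (-τ) := fun k => by
    rw [ha, Real.rpow_neg (by positivity), div_eq_mul_inv]
  have hapos : ∀ k, 0 < a k := fun k => by rw [ha]; positivity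
  have hanti : Antitone a := fun k l hkl => by
    rw [ha, ha]
    have : (k : ℝ) ≤ l := by exact_mod_cast hkl
    gcongr
  have hac : ∀ k, a k ≤ c₁ := fun k => by
    have := hanti (Nat.zero_le k)
    rw [ha 0] at this
    simpa using this
  have hh1 : (1 : ℝ) ≤ h := by exact_mod_cast hh
  set B : ℝ := 1 + C * (c₁ ^ 2 + 1) with hB
  have hB1 : 1 ≤ B := by rw [hB]; nlinarith [mul_nonneg hC (by positivity : (0 : ℝ) ≤ c₁ ^ 2 + 1)]
  -- Adding the fixed quantity a(k)² makes the inhomogeneous one-step bound multiplicative, with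
  -- factor B.
  have hgrow : ∀ k j, e (k + j) + a k ^ 2 ≤ B ^ j * (e k + a k ^ 2) := by
    intro k j
    induction j with
    | zero => simp
    | succ j ih =>
      have h1 := hstep (k + j)
      have h2 : a (k + j) ^ 2 ≤ a k ^ 2 :=
        pow_le_pow_left₀ (hapos _).le (hanti (Nat.le_add_right k j)) 2
      have h3 : a (k + j) ^ 2 ≤ c₁ ^ 2 := pow_le_pow_left₀ (hapos _).le (hac _) 2
      have h4 : 0 ≤ 2 * a (k + j) * D (k + j) := by have := hapos (k + j); have := hD (k + j); positivity
      have h5 : C * a (k + j) ^ 2 * e (k + j) ≤ C * c₁ ^ 2 * e (k + j) := by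
        have := he (k + j); gcongr
      have h6 : C * a (k + j) ^ 2 ≤ C * a k ^ 2 := by gcongr
      have h7 : e (k + (j + 1)) + a k ^ 2 ≤ B * (e (k + j) + a k ^ 2) := by
        rw [hB, ← add_assoc]
        have h8 : 0 ≤ C * e (k + j) := mul_nonneg hC (he _)
        have h9 : 0 ≤ C * c₁ ^ 2 * a k ^ 2 := by positivity
        nlinarith
      calc _ ≤ B * (e (k + j) + a k ^ 2) := h7
        _ ≤ B * (B ^ j * (e k + a k ^ 2)) := by gcongr
        _ = _ := by ring
  have hgrow' : ∀ k j, j ≤ h → e (k + j) ≤ B ^ h * (e k + a k ^ 2) := by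
    intro k j hj
    have h1 := hgrow k j
    have h2 : B ^ j * (e k + a k ^ 2) ≤ B ^ h * (e k + a k ^ 2) := by
      have := he k
      gcongr
    nlinarith [sq_nonneg (a k)]
  -- All the dissipation is weighted by the gain at the end of the window, the smallest one, since D
  -- ≥ 0 and a is decreasing.
  have hsum : ∀ k j, e (k + j) ≤ e k - 2 * a (k + j) * (∑ s ∈ Finset.Ico k (k + j), D s)
      + ∑ s ∈ Finset.Ico k (k + j), C * a s ^ 2 * (e s + 1) := by
    intro k j
    induction j with
    | zero => simp
    | succ j ih =>
      rw [← add_assoc, Finset.sum_Ico_succ_top (Nat.le_add_right k j),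
        Finset.sum_Ico_succ_top (Nat.le_add_right k j)]
      have h1 := hstep (k + j)
      have h2 : a (k + j + 1) ≤ a (k + j) := hanti (Nat.le_succ _)
      have h3 : 0 ≤ ∑ s ∈ Finset.Ico k (k + j), D s := Finset.sum_nonneg fun s _ => hD s
      have h4 := mul_le_mul_of_nonneg_right h2 h3
      have h5 := mul_le_mul_of_nonneg_right h2 (hD (k + j))
      linarith
  set C' : ℝ := 2 * C * c₁ + C * h * (B ^ h * (1 + c₁ ^ 2)) + C * h with hC'
  have hC'0 : 0 ≤ C' := by positivity
  have hblock : ∀ m : ℕ, e ((m + 1) * h) ≤ e (m * h) - 2 * c / (h + 1) * a (m * h) * e (m * h)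
      + C' * a (m * h) ^ 2 * (e (m * h) + 1) := by
    intro m
    set k := m * h with hk
    have hkh : (m + 1) * h = k + h := by rw [hk]; ring
    have hw := hwin m
    rw [← hk, hkh] at hw
    rw [hkh]
    have h1 := hsum k h
    have hDn : 0 ≤ ∑ s ∈ Finset.Ico k (k + h), D s := Finset.sum_nonneg fun s _ => hD s
    -- Gains within one window are comparable: (k+1)/(k+h+1) ≥ 1/(h+1), and x ≤ x^τ on (0, 1].
    have h2 : a k / (h + 1) ≤ a (k + h) := by
      rw [ha, ha, div_div]
      apply div_le_div_of_nonneg_left hc₁.le (by positivity)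
      have h3 : 1 / ((h : ℝ) + 1) ≤ (((k : ℝ) + 1) / ((k + h : ℕ) + 1)) ^ τ := by
        refine le_trans ?_ (self_le_rpow_of_le_one (by positivity) ?_ hτ'.le)
        · rw [div_le_div_iff₀ (by positivity) (by positivity)]
          push_cast
          nlinarith [mul_nonneg (Nat.cast_nonneg (α := ℝ) k) (Nat.cast_nonneg (α := ℝ) h)]
        · rw [div_le_one (by positivity)]; push_cast; linarith
      rw [Real.div_rpow (by positivity) (by positivity), div_le_div_iff₀ (by positivity)
        (by positivity)] at h3
      linarith
    have h3 : ∑ s ∈ Finset.Ico k (k + h), C * a s ^ 2 * (e s + 1)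
        ≤ h * (C * a k ^ 2 * (B ^ h * (e k + a k ^ 2) + 1)) := by
      have : ∀ s ∈ Finset.Ico k (k + h), C * a s ^ 2 * (e s + 1)
          ≤ C * a k ^ 2 * (B ^ h * (e k + a k ^ 2) + 1) := by
        intro s hs
        rw [Finset.mem_Ico] at hs
        have h4 := hgrow' k (s - k) (by omega)
        rw [Nat.add_sub_cancel' hs.1] at h4
        have h5 := hanti hs.1
        have h6 := he s
        have h7 := (hapos s).le
        gcongr
      simpa using Finset.sum_le_card_nsmul _ _ _ this
    have h4 : a k / (h + 1) * (c * e k - C * a k ^ 2 * (e k + 1))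
        ≤ a (k + h) * ∑ s ∈ Finset.Ico k (k + h), D s := by
      calc _ ≤ a k / (h + 1) * ∑ s ∈ Finset.Ico k (k + h), D s := by
            have := (hapos k).le; gcongr
        _ ≤ _ := by gcongr
    have h5 : a k / (h + 1) * (C * a k ^ 2 * (e k + 1)) ≤ c₁ * (C * a k ^ 2 * (e k + 1)) := by
      have := he k
      gcongr
      exact (div_le_self (hapos k).le (by linarith)).trans (hac k)
    have h6 : B ^ h * (e k + a k ^ 2) ≤ B ^ h * (1 + c₁ ^ 2) * (e k + 1) := by
      rw [mul_assoc]
      gcongr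
      have := pow_le_pow_left₀ (hapos k).le (hac k) 2
      nlinarith [he k, mul_nonneg (sq_nonneg c₁) (he k)]
    have h7 : C * a k ^ 2 * (B ^ h * (e k + a k ^ 2) + 1)
        ≤ C * a k ^ 2 * (B ^ h * (1 + c₁ ^ 2) * (e k + 1) + (e k + 1)) := by
      gcongr
      linarith [he k]
    have h8 := mul_le_mul_of_nonneg_left h7 (Nat.cast_nonneg (α := ℝ) h)
    have h9 : 2 * c / (h + 1) * a k * e k = 2 * (a k / (h + 1) * (c * e k)) := by ring
    rw [h9, hC']
    nlinarith
  have hpos1 : ∀ m : ℕ, 0 < ((m : ℝ) + 1) ^ (-τ) := fun m => Real.rpow_pos_of_pos (by positivity) _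
  have hup : ∀ m : ℕ, a (m * h) ≤ c₁ * ((m : ℝ) + 1) ^ (-τ) := by
    intro m
    rw [← ha']
    exact hanti (Nat.le_mul_of_pos_right m hh)
  have hlow : ∀ m : ℕ, c₁ / h * ((m : ℝ) + 1) ^ (-τ) ≤ a (m * h) := by
    intro m
    rw [ha, Real.rpow_neg (by positivity), ← div_eq_mul_inv, div_div]
    apply div_le_div_of_nonneg_left hc₁.le (by positivity)
    calc (((m * h : ℕ) : ℝ) + 1) ^ τ ≤ ((h : ℝ) * (m + 1)) ^ τ := by
          apply Real.rpow_le_rpow (by positivity) _ hτ.le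
          push_cast; nlinarith
      _ = (h : ℝ) ^ τ * ((m : ℝ) + 1) ^ τ := Real.mul_rpow (by positivity) (by positivity)
      _ ≤ h * ((m : ℝ) + 1) ^ τ := by
          gcongr
          simpa using Real.rpow_le_rpow_of_exponent_le hh1 hτ'.le
  -- Chung's lemma is applied along the window starts, where a(mh) lies between c₁/h and c₁ times
  -- (m+1)^(-τ).
  obtain ⟨K, hK0, hK⟩ := exists_le_mul_rpow_neg_of_recursion (u := fun m => e (m * h))
    (c := 2 * c / (h + 1) * (c₁ / h)) (C := C' * c₁ ^ 2) hτ hτ' (by positivity) (by positivity)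
    (fun m => he _) (by
      intro m
      refine (hblock m).trans ?_
      have h1 := he (m * h)
      have h2 : 2 * c / (h + 1) * (c₁ / h) * ((m : ℝ) + 1) ^ (-τ) * e (m * h)
          ≤ 2 * c / (h + 1) * a (m * h) * e (m * h) := by
        have := hlow m
        rw [mul_assoc (2 * c / (h + 1))]
        gcongr
      have h3 : C' * a (m * h) ^ 2 * (e (m * h) + 1)
          ≤ C' * c₁ ^ 2 * (((m : ℝ) + 1) ^ (-τ)) ^ 2 * (e (m * h) + 1) := by
        rw [mul_assoc C' (c₁ ^ 2), ← mul_pow]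
        have := hup m
        have := (hapos (m * h)).le
        gcongr
      linarith)
  -- B^h propagates the bound from a window start into the window; the last factor h bounds the h^τ
  -- that arises on replacing m + 1 by (t + 1)/h.
  refine ⟨B ^ h * (K + c₁ ^ 2) * h, by positivity, fun t => ?_⟩
  have h1 := hgrow' (t / h * h) (t % h) (Nat.mod_lt _ hh).le
  rw [Nat.div_add_mod'] at h1
  set m := t / h with hm
  have hq1 : ((m : ℝ) + 1) ^ (-τ) ≤ 1 :=
    Real.rpow_le_one_of_one_le_of_nonpos (by simp) (by linarith)
  have h2 : a (m * h) ^ 2 ≤ c₁ ^ 2 * ((m : ℝ) + 1) ^ (-τ) := by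
    calc a (m * h) ^ 2 ≤ (c₁ * ((m : ℝ) + 1) ^ (-τ)) ^ 2 :=
          pow_le_pow_left₀ (hapos _).le (hup m) 2
      _ = c₁ ^ 2 * (((m : ℝ) + 1) ^ (-τ) * ((m : ℝ) + 1) ^ (-τ)) := by ring
      _ ≤ c₁ ^ 2 * (((m : ℝ) + 1) ^ (-τ) * 1) := by have := (hpos1 m).le; gcongr
      _ = _ := by ring
  have h3 : ((m : ℝ) + 1) ^ (-τ) ≤ h * ((t : ℝ) + 1) ^ (-τ) := by
    have h4 : ((t : ℝ) + 1) / h ≤ (m : ℝ) + 1 := by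
      rw [div_le_iff₀ (by positivity)]
      have h5 : t + 1 ≤ (m + 1) * h := by
        have := Nat.div_add_mod' t h
        have := Nat.mod_lt t hh
        rw [hm, add_mul]; omega
      exact_mod_cast h5
    calc ((m : ℝ) + 1) ^ (-τ) ≤ (((t : ℝ) + 1) / h) ^ (-τ) :=
          Real.rpow_le_rpow_of_nonpos (by positivity) h4 (by linarith)
      _ = (h : ℝ) ^ τ * ((t : ℝ) + 1) ^ (-τ) := by
          rw [Real.div_rpow (by positivity) (by positivity), Real.rpow_neg (Nat.cast_nonneg h),
            div_inv_eq_mul, mul_comm]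
      _ ≤ h * ((t : ℝ) + 1) ^ (-τ) := by
          have := (hpos1 t).le
          gcongr
          simpa using Real.rpow_le_rpow_of_exponent_le hh1 hτ'.le
  calc e t ≤ B ^ h * (e (m * h) + a (m * h) ^ 2) := h1
    _ ≤ B ^ h * (K * ((m : ℝ) + 1) ^ (-τ) + c₁ ^ 2 * ((m : ℝ) + 1) ^ (-τ)) := by
        have := hK m
        gcongr
    _ = B ^ h * (K + c₁ ^ 2) * ((m : ℝ) + 1) ^ (-τ) := by ring
    _ ≤ B ^ h * (K + c₁ ^ 2) * (h * ((t : ℝ) + 1) ^ (-τ)) := by gcongr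
    _ = _ := by ring

lemma isBigO_rpow_mul_log_of_sum_le {r e : ℕ → ℝ} {τ K C : ℝ} (hτ : 0 < τ) (hτ' : τ < 1)
    (hK : 0 ≤ K) (hC : 0 ≤ C) (he : ∀ t : ℕ, e t ≤ K * ((t : ℝ) + 1) ^ (-τ))
    (hr0 : ∀ T, 0 ≤ r T) (hr : ∀ T, r T ≤ C * ∑ t ∈ Finset.range (T + 1), e t) :
    r =O[atTop] fun T : ℕ => (T : ℝ) ^ (1 - τ) * Real.log T := by
  have hτ1 : 0 < 1 - τ := by linarith
  refine Asymptotics.IsBigO.of_bound (C * (K * (1 / (1 - τ) * 2 ^ (1 - τ)))) ?_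
  -- Past e the logarithm is at least 1, so it may be inserted into a bound of order T^(1-τ).
  filter_upwards [eventually_ge_atTop 3] with T hT
  have hT3 : (3 : ℝ) ≤ T := by exact_mod_cast hT
  have hlog : 1 ≤ Real.log T := by
    rw [Real.le_log_iff_exp_le (by linarith)]
    linarith [Real.exp_one_lt_d9]
  have hTp : 0 ≤ (T : ℝ) ^ (1 - τ) := by positivity
  rw [Real.norm_of_nonneg (hr0 T), Real.norm_of_nonneg (by positivity)]
  have h1 : ∑ t ∈ Finset.range (T + 1), e t
      ≤ K * (1 / (1 - τ) * ((T + 1 : ℕ) : ℝ) ^ (1 - τ)) := by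
    refine (Finset.sum_le_sum fun t _ => he t).trans ?_
    rw [← Finset.mul_sum]
    exact mul_le_mul_of_nonneg_left (sum_range_rpow_neg_le hτ hτ' _) hK
  have h2 : ((T + 1 : ℕ) : ℝ) ^ (1 - τ) ≤ 2 ^ (1 - τ) * (T : ℝ) ^ (1 - τ) := by
    rw [← Real.mul_rpow (by norm_num) (by positivity)]
    apply Real.rpow_le_rpow (by positivity) _ hτ1.le
    push_cast; linarith
  calc r T ≤ C * ∑ t ∈ Finset.range (T + 1), e t := hr T
    _ ≤ C * (K * (1 / (1 - τ) * (2 ^ (1 - τ) * (T : ℝ) ^ (1 - τ)))) := by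
        refine mul_le_mul_of_nonneg_left (h1.trans ?_) hC
        gcongr
    _ = C * (K * (1 / (1 - τ) * 2 ^ (1 - τ))) * ((T : ℝ) ^ (1 - τ) * 1) := by ring
    _ ≤ _ := by gcongr

end RealSequences

/-! ### Matrices acting on Euclidean vectors -/

section MatrixAction

variable {ι κ : Type*} [Fintype κ] [DecidableEq κ]

lemma measurable_toEuclideanLin {Ω : Type*} {m : MeasurableSpace Ω} {A : Ω → Matrix ι κ ℝ}
    {x : Ω → EuclideanSpace ℝ κ} (hA : ∀ i j, Measurable fun ω => A ω i j) (hx : Measurable x) :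
    Measurable fun ω => Matrix.toEuclideanLin (A ω) (x ω) := by
  have hxj : ∀ j, Measurable fun ω => x ω j := fun j =>
    (EuclideanSpace.proj (𝕜 := ℝ) j).continuous.measurable.comp hx
  simp only [Matrix.toLpLin_apply]
  refine (WithLp.measurable_toLp 2 _).comp (measurable_pi_iff.mpr fun i => ?_)
  simp only [Matrix.mulVec, dotProduct]
  exact Finset.measurable_sum _ fun j _ => (hA i j).mul (hxj j)

variable [Fintype ι]

lemma norm_sq_toEuclideanLin_le (A : Matrix ι κ ℝ) (x : EuclideanSpace ℝ κ) :
    ‖Matrix.toEuclideanLin A x‖ ^ 2 ≤ (∑ i, ∑ j, A i j ^ 2) * ‖x‖ ^ 2 := by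
  rw [EuclideanSpace.norm_sq_eq, EuclideanSpace.norm_sq_eq, Finset.sum_mul]
  refine Finset.sum_le_sum fun i _ => ?_
  simpa [Matrix.toLpLin_apply, Matrix.mulVec, dotProduct] using
    Finset.sum_mul_sq_le_sq_mul_sq Finset.univ (A i) x

lemma inner_toEuclideanLin_transpose [DecidableEq ι] (A : Matrix ι κ ℝ) (x : EuclideanSpace ℝ κ)
    (y : EuclideanSpace ℝ ι) :
    inner ℝ x (Matrix.toEuclideanLin A.transpose y) = inner ℝ (Matrix.toEuclideanLin A x) y := by
  simp only [EuclideanSpace.inner_eq_star_dotProduct, Matrix.toLpLin_apply, star_trivial]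
  rw [Matrix.mulVec_transpose, ← Matrix.dotProduct_mulVec]

lemma norm_sq_toEuclideanLin (A : Matrix ι κ ℝ) (x : EuclideanSpace ℝ κ) :
    ‖Matrix.toEuclideanLin A x‖ ^ 2
      = ∑ c, ∑ d, (A.transpose * A) c d * (x c * x d) := by
  have h : ∀ r, ‖Matrix.toEuclideanLin A x r‖ ^ 2 = ∑ c, ∑ d, A r c * x c * (A r d * x d) := by
    intro r
    rw [Real.norm_eq_abs, sq_abs, sq, ← Finset.sum_mul_sum]
    rfl
  rw [EuclideanSpace.norm_sq_eq, Finset.sum_congr rfl fun r _ => h r, Finset.sum_comm]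
  refine Finset.sum_congr rfl fun c _ => ?_
  rw [Finset.sum_comm]
  refine Finset.sum_congr rfl fun d _ => ?_
  rw [Matrix.mul_apply, Finset.sum_mul]
  exact Finset.sum_congr rfl fun r _ => by rw [Matrix.transpose_apply]; ring

end MatrixAction

lemma norm_sq_toEuclideanLin_transpose_le {ι κ : Type*} [Fintype ι] [DecidableEq ι] [Fintype κ]
    (A : Matrix ι κ ℝ)
    (x : EuclideanSpace ℝ ι) :
    ‖Matrix.toEuclideanLin A.transpose x‖ ^ 2 ≤ (∑ i, ∑ j, A i j ^ 2) * ‖x‖ ^ 2 := by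
  rw [Finset.sum_comm]
  exact norm_sq_toEuclideanLin_le A.transpose x

/-- The continuous linear map `x ↦ x ∘ g` on Euclidean spaces. -/
noncomputable def euclideanPullback {ι κ : Type*} [Fintype ι] [Fintype κ] (g : κ → ι) :
    EuclideanSpace ℝ ι →L[ℝ] EuclideanSpace ℝ κ :=
  LinearMap.toContinuousLinearMap
    { toFun := fun x => WithLp.toLp 2 fun r => x (g r)
      map_add' := fun _ _ => rfl
      map_smul' := fun _ _ => rfl }

lemma norm_euclideanPullback_le {ι κ : Type*} [Fintype ι] [Fintype κ] {g : κ → ι}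
    (hg : Function.Injective g) (x : EuclideanSpace ℝ ι) : ‖euclideanPullback g x‖ ≤ ‖x‖ := by
  classical
  rw [EuclideanSpace.norm_eq, EuclideanSpace.norm_eq]
  refine Real.sqrt_le_sqrt ?_
  change ∑ r, ‖x (g r)‖ ^ 2 ≤ _
  rw [← Finset.sum_image (s := Finset.univ) (g := g) (f := fun p => ‖x p‖ ^ 2) (fun a _ b _ h => hg h)]
  exact Finset.sum_le_sum_of_subset_of_nonneg (Finset.subset_univ _) fun _ _ _ => sq_nonneg _

/-! ### Square-integrable random vectors -/

section SquareIntegrable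

variable {Ω E : Type*} [MeasurableSpace Ω] {μ : Measure Ω} [NormedAddCommGroup E]

lemma MeasureTheory.MemLp.integrable_norm_sq {f : Ω → E} (hf : MemLp f 2 μ) :
    Integrable (fun ω => ‖f ω‖ ^ 2) μ :=
  (memLp_two_iff_integrable_sq_norm hf.1).mp hf

lemma MeasureTheory.MemLp.integrable_inner [InnerProductSpace ℝ E] {f g : Ω → E}
    (hf : MemLp f 2 μ) (hg : MemLp g 2 μ) : Integrable (fun ω => inner ℝ (f ω) (g ω)) μ := by
  refine (hf.integrable_norm_sq.add hg.integrable_norm_sq).mono'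
    (hf.1.inner hg.1) (ae_of_all _ fun ω => ?_)
  have h := norm_inner_le_norm (𝕜 := ℝ) (f ω) (g ω)
  simp only [Pi.add_apply]
  nlinarith [sq_nonneg (‖f ω‖ - ‖g ω‖), sq_nonneg (‖f ω‖), sq_nonneg (‖g ω‖)]

lemma memLp_two_of_norm_sq_le {f : Ω → E} (hf : AEStronglyMeasurable f μ) {g : Ω → ℝ}
    (hg : Integrable g μ) (h : ∀ᵐ ω ∂μ, ‖f ω‖ ^ 2 ≤ g ω) : MemLp f 2 μ := by
  refine (memLp_two_iff_integrable_sq_norm hf).mpr (hg.mono' (hf.norm.pow 2) ?_)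
  filter_upwards [h] with ω hω
  rwa [Real.norm_of_nonneg (sq_nonneg _)]

lemma norm_add_sq_le_two_mul (x y : E) : ‖x + y‖ ^ 2 ≤ 2 * ‖x‖ ^ 2 + 2 * ‖y‖ ^ 2 := by
  have h := norm_add_le x y
  have h0 := norm_nonneg (x + y)
  nlinarith [sq_nonneg (‖x‖ - ‖y‖)]

lemma norm_sub_sq_le_two_mul (x y : E) : ‖x - y‖ ^ 2 ≤ 2 * ‖x‖ ^ 2 + 2 * ‖y‖ ^ 2 := by
  simpa [sub_eq_add_neg] using norm_add_sq_le_two_mul x (-y)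

lemma norm_sum_sq_le_card_mul {ι : Type*} (s : Finset ι) (f : ι → E) :
    ‖∑ i ∈ s, f i‖ ^ 2 ≤ s.card * ∑ i ∈ s, ‖f i‖ ^ 2 :=
  (pow_le_pow_left₀ (norm_nonneg _) (norm_sum_le s f) 2).trans sq_sum_le_card_mul_sum_sq

lemma integral_norm_add_sq_le {f g : Ω → E} (hf : MemLp f 2 μ) (hg : MemLp g 2 μ) :
    ∫ ω, ‖f ω + g ω‖ ^ 2 ∂μ ≤ 2 * ∫ ω, ‖f ω‖ ^ 2 ∂μ + 2 * ∫ ω, ‖g ω‖ ^ 2 ∂μ := by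
  rw [← integral_const_mul, ← integral_const_mul,
    ← integral_add (hf.integrable_norm_sq.const_mul _) (hg.integrable_norm_sq.const_mul _)]
  exact integral_mono (hf.add hg).integrable_norm_sq
    ((hf.integrable_norm_sq.const_mul _).add (hg.integrable_norm_sq.const_mul _))
    fun ω => norm_add_sq_le_two_mul _ _

lemma integral_norm_sub_sq_le {f g : Ω → E} (hf : MemLp f 2 μ) (hg : MemLp g 2 μ) :
    ∫ ω, ‖f ω - g ω‖ ^ 2 ∂μ ≤ 2 * ∫ ω, ‖f ω‖ ^ 2 ∂μ + 2 * ∫ ω, ‖g ω‖ ^ 2 ∂μ := by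
  simpa [sub_eq_add_neg] using integral_norm_add_sq_le hf hg.neg

lemma integral_norm_sum_sq_le {ι : Type*} (s : Finset ι) {f : ι → Ω → E}
    (hf : ∀ i ∈ s, MemLp (f i) 2 μ) :
    ∫ ω, ‖∑ i ∈ s, f i ω‖ ^ 2 ∂μ ≤ s.card * ∑ i ∈ s, ∫ ω, ‖f i ω‖ ^ 2 ∂μ := by
  rw [← integral_finsetSum _ (fun i hi => (hf i hi).integrable_norm_sq), ← integral_const_mul]
  exact integral_mono (memLp_finsetSum s hf).integrable_norm_sq
    ((integrable_finsetSum s fun i hi => (hf i hi).integrable_norm_sq).const_mul _)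
    fun ω => norm_sum_sq_le_card_mul _ _

end SquareIntegrable

/-! ### Information structure, moments and noises of the network -/

namespace RegressionNetwork

variable {Ω : Type*} [mΩ : MeasurableSpace Ω] {μ : Measure Ω} {N n : ℕ} {m : Fin N → ℕ}
  (M : RegressionNetwork Ω N n m)

lemma dataSigma_le (k : ℕ) : M.dataSigma k ≤ mΩ :=
  sup_le (iSup_le fun i => iSup_le fun j => (M.measurable_A k i j).comap_le)
    (iSup_le fun i => iSup_le fun r => iSup_le fun c => (M.measurable_H i k r c).comap_le)

lemma noiseSigma_le (k : ℕ) : M.noiseSigma k ≤ mΩ :=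
  sup_le (iSup_le fun i => (M.measurable_v i k).comap_le)
    (iSup_le fun j => iSup_le fun i => (M.measurable_ξ j i k).comap_le)

lemma past_le (k : ℕ) : M.past k ≤ mΩ :=
  iSup₂_le fun s _ => sup_le (M.dataSigma_le s) (M.noiseSigma_le s)

lemma past_mono {k l : ℕ} (h : k ≤ l) : M.past k ≤ M.past l :=
  iSup₂_le fun s hs => le_iSup₂_of_le s (hs.trans_le h) le_rfl

lemma dataSigma_le_past_succ (k : ℕ) : M.dataSigma k ≤ M.past (k + 1) :=
  le_sup_left.trans (le_iSup₂_of_le k (Nat.lt_succ_self k) le_rfl)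

lemma noiseSigma_le_past_succ (k : ℕ) : M.noiseSigma k ≤ M.past (k + 1) :=
  le_sup_right.trans (le_iSup₂_of_le k (Nat.lt_succ_self k) le_rfl)

lemma measurable_A_dataSigma (k : ℕ) (i j : Fin N) :
    Measurable[M.dataSigma k] fun ω => M.A k ω i j :=
  Measurable.mono (comap_measurable _) (le_sup_of_le_left (le_iSup₂_of_le
    (f := fun i j => MeasurableSpace.comap (fun ω => M.A k ω i j) inferInstance) i j le_rfl)) le_rfl

lemma measurable_H_dataSigma (i : Fin N) (k : ℕ) (r : Fin (m i)) (c : Fin n) :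
    Measurable[M.dataSigma k] fun ω => M.H i k ω r c :=
  Measurable.mono (comap_measurable _) (le_sup_of_le_right (le_iSup_of_le
    (f := fun i => ⨆ r, ⨆ c, MeasurableSpace.comap (fun ω => M.H i k ω r c) inferInstance) i
    (le_iSup₂_of_le (f := fun r c => MeasurableSpace.comap (fun ω => M.H i k ω r c) inferInstance)
      r c le_rfl))) le_rfl

lemma measurable_v_noiseSigma (i : Fin N) (k : ℕ) : Measurable[M.noiseSigma k] (M.v i k) :=
  Measurable.mono (comap_measurable _) (le_sup_of_le_left (le_iSup_of_le
    (f := fun i => MeasurableSpace.comap (M.v i k) inferInstance) i le_rfl)) le_rfl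

lemma measurable_ξ_noiseSigma (j i : Fin N) (k : ℕ) : Measurable[M.noiseSigma k] (M.ξ j i k) :=
  Measurable.mono (comap_measurable _) (le_sup_of_le_right (le_iSup₂_of_le
    (f := fun j i => MeasurableSpace.comap (M.ξ j i k) inferInstance) j i le_rfl)) le_rfl

/-- The squared Frobenius norm of the regression matrix of node `i`. -/
noncomputable def frobSq (i : Fin N) (k : ℕ) (ω : Ω) : ℝ := ∑ r, ∑ c, M.H i k ω r c ^ 2

lemma frobSq_nonneg (i : Fin N) (k : ℕ) (ω : Ω) : 0 ≤ M.frobSq i k ω :=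
  Finset.sum_nonneg fun _ _ => Finset.sum_nonneg fun _ _ => sq_nonneg _

lemma measurable_frobSq (i : Fin N) (k : ℕ) : Measurable[M.dataSigma k] (M.frobSq i k) :=
  Finset.measurable_sum _ fun r _ => Finset.measurable_sum _ fun c _ =>
    (M.measurable_H_dataSigma i k r c).pow_const 2

/-- The squared Frobenius norm is the trace of the i-th n × n diagonal block of the stacked Gram
matrix, and every entry is at most the spectral norm. -/
lemma frobSq_le (i : Fin N) (k : ℕ) (ω : Ω) :
    M.frobSq i k ω ≤ n * ‖(M.blockH k ω).transpose * M.blockH k ω‖ := by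
  have h : M.frobSq i k ω
      = ∑ c, ((M.blockH k ω).transpose * M.blockH k ω) ⟨i, c⟩ ⟨i, c⟩ := by
    rw [frobSq, Finset.sum_comm]
    refine Finset.sum_congr rfl fun c _ => ?_
    rw [blockH, Matrix.blockDiagonal'_transpose, ← Matrix.blockDiagonal'_mul,
      Matrix.blockDiagonal'_apply_eq, Matrix.mul_apply]
    exact Finset.sum_congr rfl fun r _ => by rw [Matrix.transpose_apply, sq]
  rw [h]
  refine (Finset.sum_le_card_nsmul _ _ _ fun c _ => (le_abs_self _).trans
    (Matrix.abs_apply_le_l2_opNorm _ _ _)).trans ?_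
  simp

lemma abs_gram_apply_le (i : Fin N) (k : ℕ) (ω : Ω) (c d : Fin n) :
    |((M.H i k ω).transpose * M.H i k ω) c d| ≤ M.frobSq i k ω := by
  rw [Matrix.mul_apply, frobSq]
  refine (Finset.abs_sum_le_sum_abs _ _).trans (Finset.sum_le_sum fun r _ => ?_)
  rw [Matrix.transpose_apply, abs_mul]
  have h0 : ∀ c, M.H i k ω r c ^ 2 ≤ ∑ c, M.H i k ω r c ^ 2 := fun c =>
    Finset.single_le_sum (f := fun c => M.H i k ω r c ^ 2) (fun _ _ => sq_nonneg _)
      (Finset.mem_univ c)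
  have h1 := h0 c
  have h2 := h0 d
  nlinarith [sq_nonneg (|M.H i k ω r c| - |M.H i k ω r d|), sq_abs (M.H i k ω r c),
    sq_abs (M.H i k ω r d)]

section Moments

variable {M} {h : ℕ} {ρ : ℝ}

lemma MomentBound.ae_condExp_nonneg (k : ℕ) :
    ∀ᵐ ω ∂μ, 0 ≤ (μ[fun ω' => ‖(M.blockH k ω').transpose * M.blockH k ω'‖ ^ 2 ^ max h 2 |
      M.past k]) ω :=
  condExp_nonneg (ae_of_all _ fun ω => by positivity)

/-- Off the diagonal, weights are negated Laplacian entries, hence bounded by the spectral norm; on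
the diagonal they vanish. -/
lemma MomentBound.ae_abs_A_le (hmom : M.MomentBound μ h ρ) :
    ∀ᵐ ω ∂μ, ∀ k i j, |M.A k ω i j| ≤ ρ := by
  filter_upwards [hmom.2, ae_all_iff.mpr fun k => MomentBound.ae_condExp_nonneg (M := M) (h := h) k]
    with ω h1 h2 k i j
  have h3 : ‖graphLaplacian (M.A k ω)‖ ≤ ρ := by
    have := Real.rpow_nonneg (h2 k) (1 / (2 ^ max h 2 : ℝ))
    linarith [h1 k]
  by_cases hij : i = j
  · subst hij
    rw [M.A_diag, abs_zero]
    exact (norm_nonneg _).trans h3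
  · have h4 := Matrix.abs_apply_le_l2_opNorm (graphLaplacian (M.A k ω)) i j
    rw [graphLaplacian, Matrix.sub_apply, Matrix.diagonal_apply_ne _ hij, zero_sub, abs_neg] at h4
    exact h4.trans h3

variable [IsProbabilityMeasure μ]

/-- Since p ≥ 2, x² ≤ 1 + x^p for x ≥ 0, so the conditional p-th moment controls the conditional
second moment of the squared Frobenius norm. This is the moment that E‖HᵀH u‖² requires. -/
lemma MomentBound.frobSq_sq (hmom : M.MomentBound μ h ρ) : ∃ C, 0 ≤ C ∧ ∀ k i,
    Integrable (fun ω => M.frobSq i k ω ^ 2) μ ∧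
      ∀ᵐ ω ∂μ, (μ[fun ω' => M.frobSq i k ω' ^ 2 | M.past k]) ω ≤ C := by
  set p : ℕ := 2 ^ max h 2 with hp
  have hp2 : 2 ≤ p := (by norm_num : 2 ≤ 2 ^ 1).trans
    (Nat.pow_le_pow_right (by norm_num) ((by norm_num : 1 ≤ 2).trans (le_max_right _ _)))
  have hρ : 0 ≤ n ^ 2 * (1 + |ρ| ^ p) := by positivity
  refine ⟨n ^ 2 * (1 + |ρ| ^ p), hρ, fun k i => ?_⟩
  set X : Ω → ℝ := fun ω => ‖(M.blockH k ω).transpose * M.blockH k ω‖ with hX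
  have hXi : Integrable (fun ω => X ω ^ p) μ := hmom.1 k
  have hle : ∀ ω, M.frobSq i k ω ^ 2 ≤ n ^ 2 * (1 + X ω ^ p) := by
    intro ω
    have hX0 : 0 ≤ X ω := norm_nonneg _
    have h1 : X ω ^ 2 ≤ 1 + X ω ^ p := by
      rcases le_total (X ω) 1 with h1 | h1
      · have := pow_le_one₀ hX0 h1 (n := 2)
        have := pow_nonneg hX0 p
        linarith
      · have := pow_le_pow_right₀ h1 hp2
        linarith
    calc M.frobSq i k ω ^ 2 ≤ (n * X ω) ^ 2 :=
          pow_le_pow_left₀ (M.frobSq_nonneg i k ω) (M.frobSq_le i k ω) 2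
      _ = n ^ 2 * X ω ^ 2 := by ring
      _ ≤ _ := by gcongr
  have hbi : Integrable (fun ω => (n : ℝ) ^ 2 * (1 + X ω ^ p)) μ :=
    ((integrable_const 1).add hXi).const_mul _
  have hint : Integrable (fun ω => M.frobSq i k ω ^ 2) μ := by
    refine hbi.mono' (((M.measurable_frobSq i k).mono (M.dataSigma_le k) le_rfl).pow_const
      2).aestronglyMeasurable (ae_of_all _ fun ω => ?_)
    rw [Real.norm_of_nonneg (sq_nonneg _)]
    exact hle ω
  refine ⟨hint, ?_⟩
  have h1 : μ[fun ω => (n : ℝ) ^ 2 * (1 + X ω ^ p) | M.past k]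
      =ᵐ[μ] fun ω => (n : ℝ) ^ 2 * (1 + (μ[fun ω => X ω ^ p | M.past k]) ω) := by
    have h2 := condExp_smul (m := M.past k) ((n : ℝ) ^ 2) (fun ω => 1 + X ω ^ p) (μ := μ)
    have h3 := condExp_add (m := M.past k) (integrable_const (1 : ℝ)) hXi (μ := μ)
    rw [condExp_const (M.past_le k)] at h3
    filter_upwards [h2, h3] with ω h2 h3
    refine h2.trans ?_
    rw [Pi.smul_apply, smul_eq_mul]
    congr 1
  filter_upwards [condExp_mono (m := M.past k) hint hbi (ae_of_all _ hle), h1, hmom.2,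
    MomentBound.ae_condExp_nonneg (M := M) (h := h) k] with ω h2 h3 h4 h5
  refine h2.trans (h3.trans_le ?_)
  have h6 : ((μ[fun ω' => X ω' ^ p | M.past k]) ω) ^ (1 / (p : ℝ)) ≤ |ρ| := by
    have h7 := norm_nonneg (graphLaplacian (M.A k ω))
    have h8 := h4 k
    have h9 : (2 ^ max h 2 : ℝ) = (p : ℝ) := by rw [hp]; push_cast; rfl
    rw [h9] at h8
    exact le_trans (by linarith) (le_abs_self ρ)
  have h7 : (μ[fun ω' => X ω' ^ p | M.past k]) ω ≤ |ρ| ^ p := by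
    have h8 := pow_le_pow_left₀ (Real.rpow_nonneg h5 _) h6 p
    rwa [one_div, Real.rpow_inv_natCast_pow h5 (by omega)] at h8
  gcongr

lemma integrable_frobSq {C : ℝ} {k : ℕ} {i : Fin N}
    (hF : Integrable (fun ω => M.frobSq i k ω ^ 2) μ ∧
      ∀ᵐ ω ∂μ, (μ[fun ω' => M.frobSq i k ω' ^ 2 | M.past k]) ω ≤ C) :
    Integrable (M.frobSq i k) μ ∧ ∀ᵐ ω ∂μ, (μ[M.frobSq i k | M.past k]) ω ≤ 1 + C := by
  have hbi : Integrable (fun ω => 1 + M.frobSq i k ω ^ 2) μ := (integrable_const 1).add hF.1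
  have hle : ∀ ω, M.frobSq i k ω ≤ 1 + M.frobSq i k ω ^ 2 := fun ω => by
    nlinarith [sq_nonneg (M.frobSq i k ω - 1)]
  have hint : Integrable (M.frobSq i k) μ := by
    refine hbi.mono' ((M.measurable_frobSq i k).mono (M.dataSigma_le k)
      le_rfl).aestronglyMeasurable (ae_of_all _ fun ω => ?_)
    rw [Real.norm_of_nonneg (M.frobSq_nonneg i k ω)]
    exact hle ω
  refine ⟨hint, ?_⟩
  have h3 := condExp_add (m := M.past k) (integrable_const (1 : ℝ)) hF.1 (μ := μ)
  rw [condExp_const (M.past_le k)] at h3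
  filter_upwards [condExp_mono (m := M.past k) hint hbi (ae_of_all _ hle), h3, hF.2]
    with ω h1 h2 h4
  refine h1.trans (h2.trans_le ?_)
  rw [Pi.add_apply]
  linarith

end Moments

section Noise

/-- The σ-algebra generated by the noises at the instants `s < k`. -/
@[reducible] def pastNoise (k : ℕ) : MeasurableSpace Ω := ⨆ (s : ℕ) (_ : s < k), M.noiseSigma s

variable {M}

/-- The noise at instant k is multiplied by A(k) and H(k), which the past does not contain, so the
martingale-difference property alone is not enough. Condition down to the past noises, adjoin the
entire data process by independence, and return by the tower property to the past together with the
current data. -/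
lemma condExp_eq_zero_of_noise [IsProbabilityMeasure μ] (hA2 : M.NoiseAssumption μ) {E : Type*} [NormedAddCommGroup E]
    [NormedSpace ℝ E] [CompleteSpace E] {Z : Ω → E} {k : ℕ}
    (hZm : StronglyMeasurable[M.noiseSigma k] Z) (hZi : Integrable Z μ)
    (hZ : μ[Z | M.past k] =ᵐ[μ] 0) : μ[Z | M.past k ⊔ M.dataSigma k] =ᵐ[μ] 0 := by
  have hpast : M.pastNoise k ≤ M.past k :=
    iSup₂_le fun s hs => le_sup_right.trans (le_iSup₂_of_le s hs le_rfl)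
  have hG : (⨆ k, M.noiseSigma k) ≤ mΩ := iSup_le M.noiseSigma_le
  have hD : (⨆ k, M.dataSigma k) ≤ mΩ := iSup_le M.dataSigma_le
  have h1 : μ[Z | M.pastNoise k] =ᵐ[μ] 0 := by
    refine (condExp_condExp_of_le hpast (M.past_le k)).symm.trans
      ((condExp_congr_ae hZ).trans ?_)
    rw [condExp_zero]
  have h2 := condExp_sup_eq_zero_of_indep hG (iSup₂_le fun s _ => le_iSup M.noiseSigma s) hD
    hA2.2.2.1 (hZm.mono (le_iSup M.noiseSigma k)) hZi h1
  have hle : M.past k ⊔ M.dataSigma k ≤ M.pastNoise k ⊔ ⨆ k, M.dataSigma k := by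
    refine sup_le (iSup₂_le fun s hs => sup_le ?_ ?_) ?_
    · exact (le_iSup M.dataSigma s).trans le_sup_right
    · exact (le_iSup₂_of_le (f := fun s (_ : s < k) => M.noiseSigma s) s hs le_rfl).trans le_sup_left
    · exact (le_iSup M.dataSigma k).trans le_sup_right
  have hle' : M.pastNoise k ⊔ ⨆ k, M.dataSigma k ≤ mΩ := sup_le (hpast.trans (M.past_le k)) hD
  refine (condExp_condExp_of_le hle hle').symm.trans ((condExp_congr_ae h2).trans ?_)
  rw [condExp_zero]

lemma v_eq_euclideanPullback (i : Fin N) (k : ℕ) :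
    M.v i k = euclideanPullback (fun r : Fin (m i) => (⟨i, r⟩ : Σ i, Fin (m i))) ∘ M.stackedV k :=
  rfl

lemma ξ_eq_euclideanPullback (j i : Fin N) (k : ℕ) :
    M.ξ j i k = euclideanPullback (fun c : Fin n => (j, i, c)) ∘ M.stackedξ k :=
  rfl

lemma norm_v_le (i : Fin N) (k : ℕ) (ω : Ω) : ‖M.v i k ω‖ ≤ ‖M.stackedV k ω‖ := by
  rw [v_eq_euclideanPullback]
  exact norm_euclideanPullback_le (fun a b h => by simpa using h) _

lemma norm_ξ_le (j i : Fin N) (k : ℕ) (ω : Ω) : ‖M.ξ j i k ω‖ ≤ ‖M.stackedξ k ω‖ := by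
  rw [ξ_eq_euclideanPullback]
  exact norm_euclideanPullback_le (fun a b h => by simpa using h) _

lemma NoiseAssumption.memLp_v (hA2 : M.NoiseAssumption μ) (i : Fin N) (k : ℕ) :
    MemLp (M.v i k) 2 μ :=
  memLp_two_of_norm_sq_le (M.measurable_v i k).aestronglyMeasurable (hA2.2.2.2.1 k)
    (ae_of_all _ fun ω => by
      have := pow_le_pow_left₀ (norm_nonneg _) (M.norm_v_le i k ω) 2
      nlinarith [sq_nonneg ‖M.stackedξ k ω‖])

lemma NoiseAssumption.memLp_ξ (hA2 : M.NoiseAssumption μ) (j i : Fin N) (k : ℕ) :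
    MemLp (M.ξ j i k) 2 μ :=
  memLp_two_of_norm_sq_le (M.measurable_ξ j i k).aestronglyMeasurable (hA2.2.2.2.1 k)
    (ae_of_all _ fun ω => by
      have := pow_le_pow_left₀ (norm_nonneg _) (M.norm_ξ_le j i k ω) 2
      nlinarith [sq_nonneg ‖M.stackedV k ω‖])

variable [IsProbabilityMeasure μ]

lemma NoiseAssumption.condExp_v (hA2 : M.NoiseAssumption μ) (i : Fin N) (k : ℕ) :
    μ[M.v i k | M.past k ⊔ M.dataSigma k] =ᵐ[μ] 0 := by
  refine condExp_eq_zero_of_noise hA2 (M.measurable_v_noiseSigma i k).stronglyMeasurable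
    ((hA2.memLp_v i k).integrable (by norm_num)) ?_
  rw [v_eq_euclideanPullback]
  refine (ContinuousLinearMap.comp_condExp_comm (hA2.1 k).2.1 _).symm.trans ?_
  filter_upwards [(hA2.1 k).2.2] with ω hω
  simp [hω]

lemma NoiseAssumption.condExp_ξ (hA2 : M.NoiseAssumption μ) (j i : Fin N) (k : ℕ) :
    μ[M.ξ j i k | M.past k ⊔ M.dataSigma k] =ᵐ[μ] 0 := by
  refine condExp_eq_zero_of_noise hA2 (M.measurable_ξ_noiseSigma j i k).stronglyMeasurable
    ((hA2.memLp_ξ j i k).integrable (by norm_num)) ?_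
  rw [ξ_eq_euclideanPullback]
  refine (ContinuousLinearMap.comp_condExp_comm (hA2.2.1 k).2.1 _).symm.trans ?_
  filter_upwards [(hA2.2.1 k).2.2] with ω hω
  simp [hω]

/-- For v an unconditional bound suffices, because v(k) is only multiplied by H(k), which is
independent of it. For ξ the bound must be conditional, because ξ(k) is multiplied by intensities
depending on past errors. -/
lemma NoiseAssumption.exists_bound (hA2 : M.NoiseAssumption μ) : ∃ β, 0 ≤ β ∧ ∀ k,
    (∀ i, ∫ ω, ‖M.v i k ω‖ ^ 2 ∂μ ≤ β) ∧
    ∀ j i, ∀ᵐ ω ∂μ, (μ[fun ω' => ‖M.ξ j i k ω'‖ ^ 2 | M.past k]) ω ≤ β := by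
  obtain ⟨β, hβ⟩ := hA2.2.2.2.2
  refine ⟨|β|, abs_nonneg β, fun k => ⟨fun i => ?_, fun j i => ?_⟩⟩
  · have hint := hA2.2.2.2.1 k
    calc ∫ ω, ‖M.v i k ω‖ ^ 2 ∂μ
        ≤ ∫ ω, (‖M.stackedV k ω‖ ^ 2 + ‖M.stackedξ k ω‖ ^ 2) ∂μ := by
          refine integral_mono (hA2.memLp_v i k).integrable_norm_sq hint fun ω => ?_
          have := pow_le_pow_left₀ (norm_nonneg _) (M.norm_v_le i k ω) 2
          dsimp only
          nlinarith [sq_nonneg ‖M.stackedξ k ω‖]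
      _ = ∫ ω, (μ[fun ω' => ‖M.stackedV k ω'‖ ^ 2 + ‖M.stackedξ k ω'‖ ^ 2 | M.past k]) ω ∂μ :=
          (integral_condExp (M.past_le k)).symm
      _ ≤ ∫ _, |β| ∂μ := by
          refine integral_mono_ae integrable_condExp (integrable_const _) ?_
          filter_upwards [hβ] with ω hω using (hω k).trans (le_abs_self β)
      _ = |β| := by simp
  · filter_upwards [hβ, condExp_mono (m := M.past k) (hA2.memLp_ξ j i k).integrable_norm_sq
      (hA2.2.2.2.1 k) (ae_of_all _ fun ω => by
        have := pow_le_pow_left₀ (norm_nonneg _) (M.norm_ξ_le j i k ω) 2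
        dsimp only
        nlinarith [sq_nonneg ‖M.stackedV k ω‖])] with ω h1 h2
    exact h2.trans ((h1 k).trans (le_abs_self β))

end Noise

end RegressionNetwork

/-! ### Mean-square bounds for the terms of the algorithm -/

namespace RegressionNetwork

variable {Ω : Type*} [mΩ : MeasurableSpace Ω] {μ : Measure Ω} {N n : ℕ} {m : Fin N → ℕ}
  {M : RegressionNetwork Ω N n m} {K : ℝ}

/-- A common bound for the weights, the conditional moments of the regression matrices, the
conditional second moments of the noises, and the growth of the noise intensities. -/
structure UniformBounds (M : RegressionNetwork Ω N n m) (μ : Measure Ω) (K : ℝ) : Prop where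
  nonneg : 0 ≤ K
  abs_A_le : ∀ᵐ ω ∂μ, ∀ k i j, |M.A k ω i j| ≤ K
  integrable_frobSq_sq : ∀ k i, Integrable (fun ω => M.frobSq i k ω ^ 2) μ
  condExp_frobSq_sq_le : ∀ k i, ∀ᵐ ω ∂μ, (μ[fun ω' => M.frobSq i k ω' ^ 2 | M.past k]) ω ≤ K
  integrable_frobSq : ∀ k i, Integrable (M.frobSq i k) μ
  condExp_frobSq_le : ∀ k i, ∀ᵐ ω ∂μ, (μ[M.frobSq i k | M.past k]) ω ≤ K
  integral_v_le : ∀ k i, ∫ ω, ‖M.v i k ω‖ ^ 2 ∂μ ≤ K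
  condExp_ξ_le : ∀ k j i, ∀ᵐ ω ∂μ, (μ[fun ω' => ‖M.ξ j i k ω'‖ ^ 2 | M.past k]) ω ≤ K
  abs_f_le : ∀ j i x, |M.f j i x| ≤ K * ‖x‖ + K

lemma exists_uniformBounds [IsProbabilityMeasure μ] (hA1 : M.LinearNoiseIntensity)
    (hA2 : M.NoiseAssumption μ) {h : ℕ} {ρ : ℝ} (hmom : M.MomentBound μ h ρ) :
    ∃ K, M.UniformBounds μ K := by
  obtain ⟨σ, b, hσb⟩ := hA1
  obtain ⟨C, hC, hF⟩ := hmom.frobSq_sq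
  obtain ⟨β, hβ, hnoise⟩ := hA2.exists_bound
  have hρ := abs_nonneg ρ
  have hσ := abs_nonneg σ
  have hb := abs_nonneg b
  refine ⟨|ρ| + (1 + C) + β + |σ| + |b|, by positivity, ?_, fun k i => (hF k i).1,
    fun k i => ?_, fun k i => (integrable_frobSq (hF k i)).1, fun k i => ?_, fun k i => ?_,
    fun k j i => ?_, fun j i x => ?_⟩
  · filter_upwards [hmom.ae_abs_A_le] with ω hω k i j
    linarith [hω k i j, le_abs_self ρ]
  · filter_upwards [(hF k i).2] with ω hω
    linarith
  · filter_upwards [(integrable_frobSq (hF k i)).2] with ω hω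
    linarith
  · linarith [(hnoise k).1 i]
  · filter_upwards [(hnoise k).2 j i] with ω hω
    linarith
  · refine (hσb j i x).trans (add_le_add (mul_le_mul_of_nonneg_right ?_ (norm_nonneg x)) ?_)
    · linarith [le_abs_self σ]
    · linarith [le_abs_self b]

lemma measurable_norm_sq {Ω E : Type*} {𝓖 : MeasurableSpace Ω} [NormedAddCommGroup E]
    [MeasurableSpace E] [OpensMeasurableSpace E] {u : Ω → E} (hu : Measurable u) :
    Measurable fun ω => ‖u ω‖ ^ 2 :=
  hu.norm.pow_const 2

namespace UniformBounds

variable (B : M.UniformBounds μ K)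
include B

lemma weight_mul {k : ℕ} (i j : Fin N) {g : Ω → ℝ} (hg : Integrable g μ) :
    Integrable (fun ω => M.A k ω i j * g ω) μ := by
  refine hg.bdd_mul (M.measurable_A k i j).aestronglyMeasurable (c := K) ?_
  filter_upwards [B.abs_A_le] with ω hω using hω k i j

lemma weight_smul {k : ℕ} (i j : Fin N) {E : Type*} [NormedAddCommGroup E] [NormedSpace ℝ E]
    {u : Ω → E} (hu : MemLp u 2 μ) :
    MemLp (fun ω => M.A k ω i j • u ω) 2 μ ∧
      ∫ ω, ‖M.A k ω i j • u ω‖ ^ 2 ∂μ ≤ K ^ 2 * ∫ ω, ‖u ω‖ ^ 2 ∂μ := by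
  have hle : ∀ᵐ ω ∂μ, ‖M.A k ω i j • u ω‖ ^ 2 ≤ K ^ 2 * ‖u ω‖ ^ 2 := by
    filter_upwards [B.abs_A_le] with ω hω
    rw [norm_smul, mul_pow]
    exact mul_le_mul_of_nonneg_right (pow_le_pow_left₀ (norm_nonneg _) (hω k i j) 2) (sq_nonneg _)
  have hi := hu.integrable_norm_sq.const_mul (K ^ 2)
  have hm := memLp_two_of_norm_sq_le
    ((M.measurable_A k i j).aestronglyMeasurable.smul hu.1) hi hle
  refine ⟨hm, (integral_mono_ae hm.integrable_norm_sq hi hle).trans_eq ?_⟩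
  rw [integral_const_mul]

variable [IsProbabilityMeasure μ]

lemma obs {k : ℕ} (i : Fin N) {u : Ω → EuclideanSpace ℝ (Fin n)} (hu : Measurable[M.past k] u)
    (hu2 : MemLp u 2 μ) :
    MemLp (fun ω => Matrix.toEuclideanLin (M.H i k ω) (u ω)) 2 μ ∧
      ∫ ω, ‖Matrix.toEuclideanLin (M.H i k ω) (u ω)‖ ^ 2 ∂μ ≤ K * ∫ ω, ‖u ω‖ ^ 2 ∂μ := by
  have h := integrable_mul_of_condExp_le (M.past_le k) (B.integrable_frobSq k i)
    (ae_of_all _ (M.frobSq_nonneg i k)) B.nonneg (B.condExp_frobSq_le k i)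
    (measurable_norm_sq hu) (fun ω => sq_nonneg _) hu2.integrable_norm_sq
  have hle : ∀ ω, ‖Matrix.toEuclideanLin (M.H i k ω) (u ω)‖ ^ 2 ≤ M.frobSq i k ω * ‖u ω‖ ^ 2 :=
    fun ω => norm_sq_toEuclideanLin_le _ _
  have hm := memLp_two_of_norm_sq_le (μ := μ) (measurable_toEuclideanLin
      (fun r c => (M.measurable_H_dataSigma i k r c).mono (M.dataSigma_le k) le_rfl)
    (hu.mono (M.past_le k) le_rfl)).aestronglyMeasurable h.1 (ae_of_all _ hle)
  exact ⟨hm, (integral_mono hm.integrable_norm_sq h.1 hle).trans h.2⟩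

lemma gram {k : ℕ} (i : Fin N) {u : Ω → EuclideanSpace ℝ (Fin n)} (hu : Measurable[M.past k] u)
    (hu2 : MemLp u 2 μ) :
    MemLp (fun ω => Matrix.toEuclideanLin (M.H i k ω).transpose
        (Matrix.toEuclideanLin (M.H i k ω) (u ω))) 2 μ ∧
      ∫ ω, ‖Matrix.toEuclideanLin (M.H i k ω).transpose
        (Matrix.toEuclideanLin (M.H i k ω) (u ω))‖ ^ 2 ∂μ ≤ K * ∫ ω, ‖u ω‖ ^ 2 ∂μ := by
  have h := integrable_mul_of_condExp_le (M.past_le k) (B.integrable_frobSq_sq k i)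
    (ae_of_all _ fun ω => sq_nonneg _) B.nonneg (B.condExp_frobSq_sq_le k i)
    (measurable_norm_sq hu) (fun ω => sq_nonneg _) hu2.integrable_norm_sq
  have hle : ∀ ω, ‖Matrix.toEuclideanLin (M.H i k ω).transpose
      (Matrix.toEuclideanLin (M.H i k ω) (u ω))‖ ^ 2 ≤ M.frobSq i k ω ^ 2 * ‖u ω‖ ^ 2 := by
    intro ω
    refine (norm_sq_toEuclideanLin_transpose_le _ _).trans ?_
    rw [sq (M.frobSq i k ω), mul_assoc]
    exact mul_le_mul_of_nonneg_left (norm_sq_toEuclideanLin_le _ _) (M.frobSq_nonneg i k ω)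
  have hm := memLp_two_of_norm_sq_le (μ := μ) (measurable_toEuclideanLin
      (fun r c => (M.measurable_H_dataSigma i k c r).mono (M.dataSigma_le k) le_rfl)
    (measurable_toEuclideanLin
      (fun r c => (M.measurable_H_dataSigma i k r c).mono (M.dataSigma_le k) le_rfl)
    (hu.mono (M.past_le k) le_rfl))).aestronglyMeasurable h.1 (ae_of_all _ hle)
  exact ⟨hm, (integral_mono hm.integrable_norm_sq h.1 hle).trans h.2⟩

/-- Both factors live at instant k, so conditioning on the past does not separate them; independence
of noise and data factors the second moment instead. -/
lemma obsNoise (hA2 : M.NoiseAssumption μ) (k : ℕ) (i : Fin N) :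
    MemLp (fun ω => Matrix.toEuclideanLin (M.H i k ω).transpose (M.v i k ω)) 2 μ ∧
      ∫ ω, ‖Matrix.toEuclideanLin (M.H i k ω).transpose (M.v i k ω)‖ ^ 2 ∂μ ≤ K * K := by
  have hmv : Measurable[M.noiseSigma k] fun ω => ‖M.v i k ω‖ ^ 2 :=
    measurable_norm_sq (M.measurable_v_noiseSigma i k)
  have hind : IndepFun (M.frobSq i k) (fun ω => ‖M.v i k ω‖ ^ 2) μ := by
    rw [IndepFun_iff_Indep]
    refine indep_of_indep_of_le_left (indep_of_indep_of_le_right hA2.2.2.1.symm ?_) ?_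
    · exact hmv.comap_le.trans (le_iSup M.noiseSigma k)
    · exact (M.measurable_frobSq i k).comap_le.trans (le_iSup M.dataSigma k)
  have hv := (hA2.memLp_v i k).integrable_norm_sq
  have hint := hind.integrable_mul (B.integrable_frobSq k i) hv
  have heq := hind.integral_fun_mul_eq_mul_integral (B.integrable_frobSq k i).1 hv.1
  have hle : ∀ ω, ‖Matrix.toEuclideanLin (M.H i k ω).transpose (M.v i k ω)‖ ^ 2
      ≤ M.frobSq i k ω * ‖M.v i k ω‖ ^ 2 := fun ω => norm_sq_toEuclideanLin_transpose_le _ _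
  have hm := memLp_two_of_norm_sq_le (μ := μ) (measurable_toEuclideanLin
      (fun r c => (M.measurable_H_dataSigma i k c r).mono (M.dataSigma_le k) le_rfl)
    (M.measurable_v i k)).aestronglyMeasurable hint (ae_of_all _ hle)
  refine ⟨hm, (integral_mono hm.integrable_norm_sq hint hle).trans ?_⟩
  change ∫ ω, M.frobSq i k ω * ‖M.v i k ω‖ ^ 2 ∂μ ≤ K * K
  rw [heq]
  refine mul_le_mul ?_ (B.integral_v_le k i) (integral_nonneg fun ω => sq_nonneg _) B.nonneg
  rw [← integral_condExp (M.past_le k)]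
  refine (integral_mono_ae integrable_condExp (integrable_const K) (B.condExp_frobSq_le k i)).trans ?_
  simp

lemma integrable_A (k : ℕ) (i j : Fin N) : Integrable (fun ω => M.A k ω i j) μ := by
  simpa using B.weight_mul i j (k := k) (integrable_const (1 : ℝ))

lemma channelNoise (hA2 : M.NoiseAssumption μ) {k : ℕ} (i j : Fin N)
    {w : Ω → EuclideanSpace ℝ (Fin n)} (hw : Measurable[M.past k] w) (hw2 : MemLp w 2 μ) :
    MemLp (fun ω => M.f j i (w ω) • M.ξ j i k ω) 2 μ ∧
      ∫ ω, ‖M.f j i (w ω) • M.ξ j i k ω‖ ^ 2 ∂μ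
        ≤ K * (2 * K ^ 2 * ∫ ω, ‖w ω‖ ^ 2 ∂μ + 2 * K ^ 2) := by
  have hg : Measurable[M.past k] fun ω => M.f j i (w ω) ^ 2 :=
    ((M.measurable_f j i).comp hw).pow_const 2
  have hbi : Integrable (fun ω => 2 * K ^ 2 * ‖w ω‖ ^ 2 + 2 * K ^ 2) μ :=
    (hw2.integrable_norm_sq.const_mul _).add (integrable_const _)
  have hb : ∀ ω, M.f j i (w ω) ^ 2 ≤ 2 * K ^ 2 * ‖w ω‖ ^ 2 + 2 * K ^ 2 := by
    intro ω
    have h1 := pow_le_pow_left₀ (abs_nonneg _) (B.abs_f_le j i (w ω)) 2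
    rw [sq_abs] at h1
    nlinarith [sq_nonneg (K * ‖w ω‖ - K)]
  have hgi : Integrable (fun ω => M.f j i (w ω) ^ 2) μ := by
    refine hbi.mono' (hg.mono (M.past_le k) le_rfl).aestronglyMeasurable (ae_of_all _ fun ω => ?_)
    rw [Real.norm_of_nonneg (sq_nonneg _)]
    exact hb ω
  have h := integrable_mul_of_condExp_le (M.past_le k) (hA2.memLp_ξ j i k).integrable_norm_sq
    (ae_of_all _ fun ω => sq_nonneg _) B.nonneg (B.condExp_ξ_le k j i) hg
    (fun ω => sq_nonneg _) hgi
  have heq : ∀ ω, ‖M.f j i (w ω) • M.ξ j i k ω‖ ^ 2 = ‖M.ξ j i k ω‖ ^ 2 * M.f j i (w ω) ^ 2 := by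
    intro ω
    rw [norm_smul, mul_pow, Real.norm_eq_abs, sq_abs, mul_comm]
  have hm := memLp_two_of_norm_sq_le (μ := μ) (f := fun ω => M.f j i (w ω) • M.ξ j i k ω)
    ((((M.measurable_f j i).comp (hw.mono (M.past_le k) le_rfl)).smul
      (M.measurable_ξ j i k)).aestronglyMeasurable) h.1 (ae_of_all _ fun ω => (heq ω).le)
  refine ⟨hm, ?_⟩
  simp_rw [heq]
  refine h.2.trans (mul_le_mul_of_nonneg_left ?_ B.nonneg)
  refine (integral_mono hgi hbi hb).trans_eq ?_
  rw [integral_add (hw2.integrable_norm_sq.const_mul _) (integrable_const _), integral_const_mul]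
  simp

lemma integral_inner_obs_v (hA2 : M.NoiseAssumption μ) {k : ℕ} (i : Fin N)
    {u : Ω → EuclideanSpace ℝ (Fin n)} (hu : Measurable[M.past k] u) (hu2 : MemLp u 2 μ) :
    ∫ ω, inner ℝ (Matrix.toEuclideanLin (M.H i k ω) (u ω)) (M.v i k ω) ∂μ = 0 := by
  refine integral_inner_eq_zero_of_condExp_eq_zero
    (sup_le (M.past_le k) (M.dataSigma_le k)) ?_ ((hA2.memLp_v i k).integrable (by norm_num))
    ((B.obs i hu hu2).1.integrable_inner (hA2.memLp_v i k)) (hA2.condExp_v i k)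
  have hmeas : Measurable[M.past k ⊔ M.dataSigma k]
      fun ω => Matrix.toEuclideanLin (M.H i k ω) (u ω) :=
    measurable_toEuclideanLin (fun r c => (M.measurable_H_dataSigma i k r c).mono le_sup_right le_rfl)
      (hu.mono le_sup_left le_rfl)
  exact hmeas.stronglyMeasurable

lemma integral_inner_channelNoise (hA2 : M.NoiseAssumption μ) {k : ℕ} (i j : Fin N)
    {u w : Ω → EuclideanSpace ℝ (Fin n)} (hu : Measurable[M.past k] u) (hu2 : MemLp u 2 μ)
    (hw : Measurable[M.past k] w) (hw2 : MemLp w 2 μ) :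
    ∫ ω, inner ℝ (u ω) (M.A k ω i j • M.f j i (w ω) • M.ξ j i k ω) ∂μ = 0 := by
  have hint := hu2.integrable_inner (B.weight_smul i j (k := k) (B.channelNoise hA2 i j hw hw2).1).1
  -- Moving the weight and the intensity onto u leaves a left factor measurable with respect to the
  -- past and the current data, orthogonal to ξ.
  have heq : ∀ ω, inner ℝ (u ω) (M.A k ω i j • M.f j i (w ω) • M.ξ j i k ω)
      = inner ℝ ((M.A k ω i j * M.f j i (w ω)) • u ω) (M.ξ j i k ω) := by
    intro ω
    rw [smul_smul, inner_smul_left, inner_smul_right]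
    rfl
  simp_rw [heq] at hint ⊢
  refine integral_inner_eq_zero_of_condExp_eq_zero
    (sup_le (M.past_le k) (M.dataSigma_le k)) (Measurable.stronglyMeasurable ?_)
    ((hA2.memLp_ξ j i k).integrable (by norm_num)) hint (hA2.condExp_ξ j i k)
  exact Measurable.smul (((M.measurable_A_dataSigma k i j).mono le_sup_right le_rfl).mul
    (((M.measurable_f j i).comp hw).mono le_sup_left le_rfl)) (hu.mono le_sup_left le_rfl)

end UniformBounds

/-- The innovation and consensus increment of node `i` at instant `k` when the estimation errors
are `u`. -/
noncomputable def drift (M : RegressionNetwork Ω N n m) (k : ℕ)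
    (u : Fin N → Ω → EuclideanSpace ℝ (Fin n)) (i : Fin N) (ω : Ω) : EuclideanSpace ℝ (Fin n) :=
  (Matrix.toEuclideanLin (M.H i k ω).transpose (M.v i k ω)
    - Matrix.toEuclideanLin (M.H i k ω).transpose (Matrix.toEuclideanLin (M.H i k ω) (u i ω)))
  + ∑ j, (M.A k ω i j • (u j ω - u i ω) + M.A k ω i j • M.f j i (u j ω - u i ω) • M.ξ j i k ω)

/-- The total mean square of a family of random vectors. -/
noncomputable def energy (μ : Measure Ω) (u : Fin N → Ω → EuclideanSpace ℝ (Fin n)) : ℝ :=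
  ∑ i, ∫ ω, ‖u i ω‖ ^ 2 ∂μ

lemma integral_norm_sq_le_energy (u : Fin N → Ω → EuclideanSpace ℝ (Fin n)) (i : Fin N) :
    ∫ ω, ‖u i ω‖ ^ 2 ∂μ ≤ energy μ u :=
  Finset.single_le_sum (f := fun i => ∫ ω, ‖u i ω‖ ^ 2 ∂μ)
    (fun _ _ => integral_nonneg fun _ => sq_nonneg _) (Finset.mem_univ i)

lemma energy_nonneg (u : Fin N → Ω → EuclideanSpace ℝ (Fin n)) : 0 ≤ energy μ u :=
  Finset.sum_nonneg fun _ _ => integral_nonneg fun _ => sq_nonneg _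

/-- The mean of the quadratic form of the regression matrices at instant `k`. -/
noncomputable def obsForm (M : RegressionNetwork Ω N n m) (μ : Measure Ω) (k : ℕ)
    (u : Fin N → Ω → EuclideanSpace ℝ (Fin n)) : ℝ :=
  ∑ i, ∫ ω, ‖Matrix.toEuclideanLin (M.H i k ω) (u i ω)‖ ^ 2 ∂μ

/-- The mean of the quadratic form of the Laplacian of the symmetrized graph at instant `k`. -/
noncomputable def graphForm (M : RegressionNetwork Ω N n m) (μ : Measure Ω) (k : ℕ)
    (u : Fin N → Ω → EuclideanSpace ℝ (Fin n)) : ℝ :=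
  (1 / 2) * ∑ i, ∑ j, ∫ ω, M.A k ω i j * ‖u i ω - u j ω‖ ^ 2 ∂μ

/-! ### The drift and its quadratic forms -/

namespace UniformBounds

variable {u w : Fin N → Ω → EuclideanSpace ℝ (Fin n)} {k : ℕ}

lemma measurable_norm_sub_sq (hu : ∀ i, Measurable[M.past k] (u i)) (i j : Fin N) :
    Measurable[M.past k] fun ω => ‖u i ω - u j ω‖ ^ 2 :=
  measurable_norm_sq ((hu i).sub (hu j))

lemma integrable_norm_sub_sq (hu2 : ∀ i, MemLp (u i) 2 μ) (i j : Fin N) :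
    Integrable (fun ω => ‖u i ω - u j ω‖ ^ 2) μ :=
  ((hu2 i).sub (hu2 j)).integrable_norm_sq

lemma obsForm_nonneg : 0 ≤ M.obsForm μ k u :=
  Finset.sum_nonneg fun _ _ => integral_nonneg fun _ => sq_nonneg _

variable (B : M.UniformBounds μ K)
include B

lemma graphForm_le (hu2 : ∀ i, MemLp (u i) 2 μ) :
    M.graphForm μ k u ≤ 2 * K * N ^ 2 * energy μ u := by
  have key : ∀ i j, ∫ ω, M.A k ω i j * ‖u i ω - u j ω‖ ^ 2 ∂μ ≤ K * (4 * energy μ u) := by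
    intro i j
    have h1 : ∫ ω, M.A k ω i j * ‖u i ω - u j ω‖ ^ 2 ∂μ ≤ ∫ ω, K * ‖u i ω - u j ω‖ ^ 2 ∂μ := by
      refine integral_mono_ae (B.weight_mul i j (integrable_norm_sub_sq hu2 i j))
        ((integrable_norm_sub_sq hu2 i j).const_mul K) ?_
      filter_upwards [B.abs_A_le] with ω hω
      exact mul_le_mul_of_nonneg_right ((le_abs_self _).trans (hω k i j)) (sq_nonneg _)
    rw [integral_const_mul] at h1
    have := integral_norm_sub_sq_le (hu2 i) (hu2 j)
    refine h1.trans (mul_le_mul_of_nonneg_left ?_ B.nonneg)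
    linarith [integral_norm_sq_le_energy (μ := μ) u i, integral_norm_sq_le_energy (μ := μ) u j]
  have h := Finset.sum_le_sum fun i (_ : i ∈ Finset.univ) =>
    Finset.sum_le_sum fun j (_ : j ∈ Finset.univ) => key i j
  simp only [Finset.sum_const, Finset.card_univ, Fintype.card_fin, nsmul_eq_mul] at h
  rw [graphForm]
  linarith

variable [IsProbabilityMeasure μ]

lemma memLp_drift (hA2 : M.NoiseAssumption μ) (hu : ∀ i, Measurable[M.past k] (u i))
    (hu2 : ∀ i, MemLp (u i) 2 μ) (i : Fin N) : MemLp (M.drift k u i) 2 μ :=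
  ((B.obsNoise hA2 k i).1.sub (B.gram i (hu i) (hu2 i)).1).add
    (memLp_finsetSum _ fun j _ => (B.weight_smul i j ((hu2 j).sub (hu2 i))).1.add
      (B.weight_smul i j
        (B.channelNoise hA2 i j ((hu j).sub (hu i)) ((hu2 j).sub (hu2 i))).1).1)

lemma integral_drift_sq_le (hA2 : M.NoiseAssumption μ) (hu : ∀ i, Measurable[M.past k] (u i))
    (hu2 : ∀ i, MemLp (u i) 2 μ) (i : Fin N) :
    ∫ ω, ‖M.drift k u i ω‖ ^ 2 ∂μ
      -- Splitting by ‖x + y‖² ≤ 2‖x‖² + 2‖y‖² at each level gives 4K² from the observation noise,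
      -- 4K from the Gram term, and 2N² times 8K² + 16K⁵ from the consensus and channel-noise terms.
      ≤ (4 * K ^ 2 + 4 * K + 2 * N * (N * (8 * K ^ 2 + 16 * K ^ 5))) * (energy μ u + 1) := by
  have hK := B.nonneg
  have he := energy_nonneg (μ := μ) u
  have h1 := B.obsNoise hA2 k i
  have h2 := B.gram i (hu i) (hu2 i)
  have hw : ∀ j, MemLp (fun ω => u j ω - u i ω) 2 μ := fun j => (hu2 j).sub (hu2 i)
  have h3 := fun j => B.weight_smul i j (k := k) (hw j)
  have h4 := fun j => B.channelNoise hA2 i j ((hu j).sub (hu i)) (hw j)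
  have h5 := fun j => B.weight_smul i j (k := k) (h4 j).1
  have h6 : ∀ j, ∫ ω, ‖u j ω - u i ω‖ ^ 2 ∂μ ≤ 4 * energy μ u := fun j => by
    have := integral_norm_sub_sq_le (hu2 j) (hu2 i)
    linarith [integral_norm_sq_le_energy (μ := μ) u i, integral_norm_sq_le_energy (μ := μ) u j]
  have h7 : ∀ j, ∫ ω, ‖M.A k ω i j • (u j ω - u i ω)
      + M.A k ω i j • M.f j i (u j ω - u i ω) • M.ξ j i k ω‖ ^ 2 ∂μ
      ≤ (8 * K ^ 2 + 16 * K ^ 5) * (energy μ u + 1) := by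
    intro j
    refine (integral_norm_add_sq_le (h3 j).1 (h5 j).1).trans ?_
    have h8 := (h3 j).2.trans (mul_le_mul_of_nonneg_left (h6 j) (sq_nonneg K))
    have h9 : K * (2 * K ^ 2 * ∫ ω, ‖u j ω - u i ω‖ ^ 2 ∂μ + 2 * K ^ 2)
        ≤ K * (2 * K ^ 2 * (4 * energy μ u) + 2 * K ^ 2) := by
      gcongr
      exact h6 j
    have h10 := (h5 j).2.trans (mul_le_mul_of_nonneg_left ((h4 j).2.trans h9) (sq_nonneg K))
    have h11 : 0 ≤ K ^ 5 := by positivity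
    nlinarith [sq_nonneg K]
  have hsum := integral_norm_sum_sq_le Finset.univ (fun j _ => (h3 j).1.add (h5 j).1)
  have h8 := hsum.trans (mul_le_mul_of_nonneg_left (Finset.sum_le_sum fun j _ => h7 j)
    (Nat.cast_nonneg _))
  simp only [Finset.sum_const, Finset.card_univ, Fintype.card_fin, nsmul_eq_mul] at h8
  have h9 := integral_norm_add_sq_le (h1.1.sub h2.1)
    (memLp_finsetSum Finset.univ fun j _ => (h3 j).1.add (h5 j).1)
  have h10 := integral_norm_sub_sq_le h1.1 h2.1
  have h11 := mul_le_mul_of_nonneg_left (integral_norm_sq_le_energy (μ := μ) u i) hK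
  have h12 : 0 ≤ K * K * energy μ u := by positivity
  refine h9.trans ?_
  have h13 := h1.2
  have h14 := h2.2
  simp only [Pi.sub_apply, Pi.add_apply] at h8 h9 h10 ⊢
  nlinarith

lemma integral_inner_drift (hA2 : M.NoiseAssumption μ) (hu : ∀ i, Measurable[M.past k] (u i))
    (hu2 : ∀ i, MemLp (u i) 2 μ) (i : Fin N) :
    ∫ ω, inner ℝ (u i ω) (M.drift k u i ω) ∂μ
      = -(∫ ω, ‖Matrix.toEuclideanLin (M.H i k ω) (u i ω)‖ ^ 2 ∂μ)
        - ∑ j, ∫ ω, M.A k ω i j * inner ℝ (u i ω) (u i ω - u j ω) ∂μ := by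
  have hw : ∀ j, MemLp (fun ω => u j ω - u i ω) 2 μ := fun j => (hu2 j).sub (hu2 i)
  have hobs := B.obs i (hu i) (hu2 i)
  have h1 := (hu2 i).integrable_inner (B.obsNoise hA2 k i).1
  have h3 := fun j => (hu2 i).integrable_inner (B.weight_smul i j (k := k) (hw j)).1
  have h5 : ∀ j, Integrable (fun ω => inner ℝ (u i ω)
      (M.A k ω i j • M.f j i (u j ω - u i ω) • M.ξ j i k ω)) μ := fun j =>
    (hu2 i).integrable_inner
      (B.weight_smul i j (k := k) (B.channelNoise hA2 i j ((hu j).sub (hu i)) (hw j)).1).1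
  have h0 : Integrable (fun ω =>
      inner ℝ (u i ω) (Matrix.toEuclideanLin (M.H i k ω).transpose (M.v i k ω))
        - ‖Matrix.toEuclideanLin (M.H i k ω) (u i ω)‖ ^ 2) μ := h1.sub hobs.1.integrable_norm_sq
  have heq : ∀ ω, inner ℝ (u i ω) (M.drift k u i ω)
      = (inner ℝ (u i ω) (Matrix.toEuclideanLin (M.H i k ω).transpose (M.v i k ω))
        - ‖Matrix.toEuclideanLin (M.H i k ω) (u i ω)‖ ^ 2)
        + ∑ j, (inner ℝ (u i ω) (M.A k ω i j • (u j ω - u i ω))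
          + inner ℝ (u i ω) (M.A k ω i j • M.f j i (u j ω - u i ω) • M.ξ j i k ω)) := by
    intro ω
    rw [drift, inner_add_right, inner_sub_right, inner_sum]
    congr 2
    · rw [inner_toEuclideanLin_transpose, real_inner_self_eq_norm_sq]
    · exact funext fun j => inner_add_right (𝕜 := ℝ) (u i ω) _ _
  have hsum : Integrable (fun ω => ∑ j, (inner ℝ (u i ω) (M.A k ω i j • (u j ω - u i ω))
      + inner ℝ (u i ω) (M.A k ω i j • M.f j i (u j ω - u i ω) • M.ξ j i k ω))) μ :=
    integrable_finsetSum _ fun j _ => (h3 j).add (h5 j)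
  have h6 : ∀ j, Integrable (fun ω => inner ℝ (u i ω) (M.A k ω i j • (u j ω - u i ω))
      + inner ℝ (u i ω) (M.A k ω i j • M.f j i (u j ω - u i ω) • M.ξ j i k ω)) μ :=
    fun j => (h3 j).add (h5 j)
  simp_rw [heq]
  rw [integral_add h0 hsum,
    integral_sub h1 hobs.1.integrable_norm_sq, integral_finsetSum _ fun j _ => h6 j]
  have hzero : ∫ ω, inner ℝ (u i ω) (Matrix.toEuclideanLin (M.H i k ω).transpose (M.v i k ω)) ∂μ
      = 0 := by
    simp_rw [inner_toEuclideanLin_transpose]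
    exact B.integral_inner_obs_v hA2 i (hu i) (hu2 i)
  rw [hzero, zero_sub, sub_eq_add_neg (-_), ← Finset.sum_neg_distrib]
  congr 1
  refine Finset.sum_congr rfl fun j _ => ?_
  rw [integral_add (h3 j) (h5 j), B.integral_inner_channelNoise hA2 i j (hu i) (hu2 i)
    (w := fun ω => u j ω - u i ω) ((hu j).sub (hu i)) (hw j), add_zero, ← integral_neg]
  refine integral_congr_ae (ae_of_all _ fun ω => ?_)
  dsimp only
  rw [inner_smul_right, ← neg_sub (u i ω), inner_neg_right]
  ring

/-- The weights may be negative and unbalanced; only their conditional expectations have signs and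
balance. This replacement gives access to both. -/
lemma integral_weight_mul {s : ℕ} (i j : Fin N) {g : Ω → ℝ} (hg : Measurable[M.past k] g)
    (hgi : Integrable g μ) :
    ∫ ω, M.A s ω i j * g ω ∂μ = ∫ ω, (μ[fun ω' => M.A s ω' i j | M.past k]) ω * g ω ∂μ := by
  rw [← integral_condExp (M.past_le k)]
  exact integral_congr_ae (condExp_mul_of_stronglyMeasurable_right hg.stronglyMeasurable
    (B.weight_mul i j hgi) (B.integrable_A s i j))

lemma integrable_condExp_weight_mul {s : ℕ} (i j : Fin N) {g : Ω → ℝ}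
    (hg : Measurable[M.past k] g) (hgi : Integrable g μ) :
    Integrable (fun ω => (μ[fun ω' => M.A s ω' i j | M.past k]) ω * g ω) μ :=
  integrable_condExp.congr (condExp_mul_of_stronglyMeasurable_right hg.stronglyMeasurable
    (B.weight_mul i j hgi) (B.integrable_A s i j))

lemma graphForm_nonneg (hbal : M.CondBalanced μ) (hu : ∀ i, Measurable[M.past k] (u i))
    (hu2 : ∀ i, MemLp (u i) 2 μ) : 0 ≤ M.graphForm μ k u := by
  refine mul_nonneg (by norm_num) (Finset.sum_nonneg fun i _ => Finset.sum_nonneg fun j _ => ?_)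
  rw [B.integral_weight_mul i j (measurable_norm_sub_sq hu i j) (integrable_norm_sub_sq hu2 i j)]
  refine integral_nonneg_of_ae ?_
  filter_upwards [hbal k] with ω hω
  exact mul_nonneg (hω.1 i j) (sq_nonneg _)

lemma graphForm_le_two_mul_add (hbal : M.CondBalanced μ) (hu : ∀ i, Measurable[M.past k] (u i))
    (hu2 : ∀ i, MemLp (u i) 2 μ) (hw : ∀ i, Measurable[M.past k] (w i))
    (hw2 : ∀ i, MemLp (w i) 2 μ) :
    M.graphForm μ k u
      ≤ 2 * M.graphForm μ k w + 2 * M.graphForm μ k (fun i ω => u i ω - w i ω) := by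
  have hz : ∀ i, Measurable[M.past k] fun ω => u i ω - w i ω := fun i => (hu i).sub (hw i)
  have hz2 : ∀ i, MemLp (fun ω => u i ω - w i ω) 2 μ := fun i => (hu2 i).sub (hw2 i)
  have key : ∀ i j, ∫ ω, M.A k ω i j * ‖u i ω - u j ω‖ ^ 2 ∂μ
      ≤ 2 * ∫ ω, M.A k ω i j * ‖w i ω - w j ω‖ ^ 2 ∂μ
        + 2 * ∫ ω, M.A k ω i j * ‖(u i ω - w i ω) - (u j ω - w j ω)‖ ^ 2 ∂μ := by
    intro i j
    have i1 := B.integrable_condExp_weight_mul (s := k) i j (measurable_norm_sub_sq hu i j)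
      (integrable_norm_sub_sq hu2 i j)
    have i2 := B.integrable_condExp_weight_mul (s := k) i j (measurable_norm_sub_sq hw i j)
      (integrable_norm_sub_sq hw2 i j)
    have i3 := B.integrable_condExp_weight_mul (s := k) i j (measurable_norm_sub_sq hz i j)
      (integrable_norm_sub_sq hz2 i j)
    rw [B.integral_weight_mul i j (measurable_norm_sub_sq hu i j) (integrable_norm_sub_sq hu2 i j),
      B.integral_weight_mul i j (measurable_norm_sub_sq hw i j) (integrable_norm_sub_sq hw2 i j),
      B.integral_weight_mul i j (measurable_norm_sub_sq hz i j) (integrable_norm_sub_sq hz2 i j),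
      ← integral_const_mul, ← integral_const_mul,
      ← integral_add (i2.const_mul 2) (i3.const_mul 2)]
    refine integral_mono_ae i1 ((i2.const_mul 2).add (i3.const_mul 2)) ?_
    filter_upwards [hbal k] with ω hω
    have h1 := norm_add_sq_le_two_mul (w i ω - w j ω) ((u i ω - w i ω) - (u j ω - w j ω))
    have h2 : (w i ω - w j ω) + ((u i ω - w i ω) - (u j ω - w j ω)) = u i ω - u j ω := by abel
    rw [h2] at h1
    have h3 := mul_le_mul_of_nonneg_left h1 (hω.1 i j)
    change (μ[fun ω' => M.A k ω' i j | M.past k]) ω * _ ≤ (μ[fun ω' => M.A k ω' i j | M.past k]) ω * _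
      at h3
    linarith
  rw [graphForm, graphForm, graphForm, ← mul_assoc, ← mul_assoc, mul_comm 2 (1 / 2 : ℝ), mul_assoc,
    mul_assoc, ← mul_add]
  refine mul_le_mul_of_nonneg_left ?_ (by norm_num)
  simp_rw [Finset.mul_sum, ← Finset.sum_add_distrib]
  exact Finset.sum_le_sum fun i _ => Finset.sum_le_sum fun j _ => key i j

/-- Polarization splits ⟨u_i, u_i - u_j⟩ into half of ‖u_i - u_j‖² and half of ‖u_i‖² - ‖u_j‖².
Summed against the conditional weights, the second part has coefficient in-degree minus out-degree
at each node, which balance makes zero. -/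
lemma sum_integral_weight_inner (hbal : M.CondBalanced μ) (hu : ∀ i, Measurable[M.past k] (u i))
    (hu2 : ∀ i, MemLp (u i) 2 μ) :
    ∑ i, ∑ j, ∫ ω, M.A k ω i j * inner ℝ (u i ω) (u i ω - u j ω) ∂μ = M.graphForm μ k u := by
  have hsq : ∀ i, Measurable[M.past k] fun ω => ‖u i ω‖ ^ 2 := fun i => measurable_norm_sq (hu i)
  have hsqi : ∀ i, Integrable (fun ω => ‖u i ω‖ ^ 2) μ := fun i => (hu2 i).integrable_norm_sq
  have hdiff : ∀ i j, Measurable[M.past k] fun ω => ‖u i ω‖ ^ 2 - ‖u j ω‖ ^ 2 :=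
    fun i j => (hsq i).sub (hsq j)
  have hdiffi : ∀ i j, Integrable (fun ω => ‖u i ω‖ ^ 2 - ‖u j ω‖ ^ 2) μ :=
    fun i j => (hsqi i).sub (hsqi j)
  have key : ∀ i j, ∫ ω, M.A k ω i j * inner ℝ (u i ω) (u i ω - u j ω) ∂μ
      = (1 / 2) * ∫ ω, M.A k ω i j * ‖u i ω - u j ω‖ ^ 2 ∂μ
        + (1 / 2) * ∫ ω, (μ[fun ω' => M.A k ω' i j | M.past k]) ω
            * (‖u i ω‖ ^ 2 - ‖u j ω‖ ^ 2) ∂μ := by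
    intro i j
    rw [← B.integral_weight_mul i j (hdiff i j) (hdiffi i j), ← integral_const_mul,
      ← integral_const_mul, ← integral_add
        ((B.weight_mul i j (integrable_norm_sub_sq hu2 i j)).const_mul _)
        ((B.weight_mul i j (hdiffi i j)).const_mul _)]
    refine integral_congr_ae (ae_of_all _ fun ω => ?_)
    dsimp only
    rw [inner_sub_right, real_inner_self_eq_norm_sq, norm_sub_sq_real]
    ring
  have hzero : ∑ i, ∑ j, ∫ ω, (μ[fun ω' => M.A k ω' i j | M.past k]) ω
      * (‖u i ω‖ ^ 2 - ‖u j ω‖ ^ 2) ∂μ = 0 := by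
    have hint := fun i j => B.integrable_condExp_weight_mul (s := k) i j (hdiff i j) (hdiffi i j)
    have h1 : ∀ i, ∑ j, ∫ ω, (μ[fun ω' => M.A k ω' i j | M.past k]) ω
        * (‖u i ω‖ ^ 2 - ‖u j ω‖ ^ 2) ∂μ = ∫ ω, ∑ j, (μ[fun ω' => M.A k ω' i j | M.past k]) ω
        * (‖u i ω‖ ^ 2 - ‖u j ω‖ ^ 2) ∂μ := fun i =>
      (integral_finsetSum _ fun j _ => hint i j).symm
    rw [Finset.sum_congr rfl fun i _ => h1 i,
      ← integral_finsetSum _ fun i _ => integrable_finsetSum _ fun j _ => hint i j]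
    have h2 : (fun ω => ∑ i, ∑ j, (μ[fun ω' => M.A k ω' i j | M.past k]) ω
        * (‖u i ω‖ ^ 2 - ‖u j ω‖ ^ 2)) =ᵐ[μ] fun _ => (0 : ℝ) := by
      filter_upwards [hbal k] with ω hω
      have h3 : ∀ i, ∑ j, (μ[fun ω' => M.A k ω' i j | M.past k]) ω
          = ∑ j, (μ[fun ω' => M.A k ω' j i | M.past k]) ω := hω.2
      simp_rw [mul_sub, Finset.sum_sub_distrib]
      rw [Finset.sum_comm (f := fun i j => (μ[fun ω' => M.A k ω' i j | M.past k]) ω * ‖u j ω‖ ^ 2)]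
      simp_rw [← Finset.sum_mul, h3]
      exact sub_self _
    exact (integral_congr_ae h2).trans (integral_zero Ω ℝ)
  simp_rw [key, Finset.sum_add_distrib, ← Finset.mul_sum]
  rw [hzero, graphForm]
  ring

lemma sum_integral_inner_drift (hA2 : M.NoiseAssumption μ) (hbal : M.CondBalanced μ)
    (hu : ∀ i, Measurable[M.past k] (u i)) (hu2 : ∀ i, MemLp (u i) 2 μ) :
    ∑ i, ∫ ω, inner ℝ (u i ω) (M.drift k u i ω) ∂μ
      = -(M.obsForm μ k u + M.graphForm μ k u) := by
  rw [Finset.sum_congr rfl fun i _ => B.integral_inner_drift hA2 hu hu2 i,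
    Finset.sum_sub_distrib, Finset.sum_neg_distrib, B.sum_integral_weight_inner hbal hu hu2, obsForm]
  ring

lemma obsForm_le (hu : ∀ i, Measurable[M.past k] (u i)) (hu2 : ∀ i, MemLp (u i) 2 μ) :
    M.obsForm μ k u ≤ K * energy μ u := by
  rw [obsForm, energy, Finset.mul_sum]
  exact Finset.sum_le_sum fun i _ => (B.obs i (hu i) (hu2 i)).2

lemma obsForm_add_le (hu : ∀ i, Measurable[M.past k] (u i))
    (hu2 : ∀ i, MemLp (u i) 2 μ) (hw : ∀ i, Measurable[M.past k] (w i))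
    (hw2 : ∀ i, MemLp (w i) 2 μ) :
    M.obsForm μ k u
      ≤ 2 * M.obsForm μ k w + 2 * M.obsForm μ k (fun i ω => u i ω - w i ω) := by
  rw [obsForm, obsForm, obsForm, Finset.mul_sum, Finset.mul_sum, ← Finset.sum_add_distrib]
  refine Finset.sum_le_sum fun i _ => ?_
  refine le_trans (le_of_eq ?_) (integral_norm_add_sq_le (B.obs i (hw i) (hw2 i)).1
    (B.obs i ((hu i).sub (hw i)) ((hu2 i).sub (hw2 i))).1)
  refine integral_congr_ae (ae_of_all _ fun ω => ?_)
  dsimp only [Pi.sub_apply]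
  rw [← map_add, add_sub_cancel]

end UniformBounds

end RegressionNetwork

/-! ### Evolution of the estimation errors -/

namespace RegressionNetwork

variable {Ω : Type*} [mΩ : MeasurableSpace Ω] {μ : Measure Ω} {N n : ℕ} {m : Fin N → ℕ}
  {M : RegressionNetwork Ω N n m} {K : ℝ}

/-- The estimation error of node `i` at instant `k`. -/
noncomputable def err (M : RegressionNetwork Ω N n m) (a b lam : ℕ → ℝ) (k : ℕ) (i : Fin N)
    (ω : Ω) : EuclideanSpace ℝ (Fin n) :=
  M.estimate a b lam k ω i - M.trueParam

lemma err_succ (a lam : ℕ → ℝ) (k : ℕ) (i : Fin N) (ω : Ω) :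
    M.err a a lam (k + 1) i ω = M.err a a lam k i ω
      + (a k • M.drift k (M.err a a lam k) i ω - lam k • (M.err a a lam k i ω + M.trueParam)) := by
  have hsum : ∑ j ∈ M.neighbors k ω i, M.A k ω i j •
        (M.estimate a a lam k ω j + M.f j i (M.estimate a a lam k ω j - M.estimate a a lam k ω i)
          • M.ξ j i k ω - M.estimate a a lam k ω i)
      = ∑ j, (M.A k ω i j • (M.err a a lam k j ω - M.err a a lam k i ω)
        + M.A k ω i j • M.f j i (M.err a a lam k j ω - M.err a a lam k i ω) • M.ξ j i k ω) := by
    rw [neighbors, Finset.sum_filter]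
    refine Finset.sum_congr rfl fun j _ => ?_
    simp only [err, sub_sub_sub_cancel_right]
    split_ifs with h
    · rw [← smul_add]
      congr 1
      abel
    · rw [not_not.mp h]
      simp
  have hy : M.y i k ω - Matrix.toEuclideanLin (M.H i k ω) (M.estimate a a lam k ω i)
      = M.v i k ω - Matrix.toEuclideanLin (M.H i k ω) (M.err a a lam k i ω) := by
    rw [y, err, map_sub]
    abel
  rw [drift, ← hsum, ← map_sub, ← hy]
  simp only [err, estimate, sub_add_cancel, smul_add]
  abel

lemma measurable_err (a lam : ℕ → ℝ) (k : ℕ) (i : Fin N) :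
    Measurable[M.past k] (M.err a a lam k i) := by
  induction k generalizing i with
  | zero => exact measurable_const (a := M.init i - M.trueParam)
  | succ k ih =>
    have hpast := M.past_mono (Nat.le_succ k)
    have hdata := M.dataSigma_le_past_succ k
    have hnoise := M.noiseSigma_le_past_succ k
    have hu : ∀ i, Measurable[M.past (k + 1)] (M.err a a lam k i) :=
      fun i => (ih i).mono hpast le_rfl
    have hA : ∀ j, Measurable[M.past (k + 1)] fun ω => M.A k ω i j :=
      fun j => (M.measurable_A_dataSigma k i j).mono hdata le_rfl
    have hH : ∀ r c, Measurable[M.past (k + 1)] fun ω => M.H i k ω r c :=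
      fun r c => (M.measurable_H_dataSigma i k r c).mono hdata le_rfl
    have hd : Measurable[M.past (k + 1)] (M.drift k (M.err a a lam k) i) := by
      refine Measurable.add (Measurable.sub ?_ ?_) (Finset.measurable_sum _ fun j _ =>
        Measurable.add ?_ ?_)
      · exact measurable_toEuclideanLin (fun r c => hH c r)
          ((M.measurable_v_noiseSigma i k).mono hnoise le_rfl)
      · exact measurable_toEuclideanLin (fun r c => hH c r) (measurable_toEuclideanLin hH (hu i))
      · exact Measurable.smul (hA j) ((hu j).sub (hu i))
      · exact Measurable.smul (hA j) (Measurable.smul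
          ((M.measurable_f j i).comp ((hu j).sub (hu i)))
          ((M.measurable_ξ_noiseSigma j i k).mono hnoise le_rfl))
    have heq : M.err a a lam (k + 1) i = fun ω => M.err a a lam k i ω
      + (a k • M.drift k (M.err a a lam k) i ω - lam k • (M.err a a lam k i ω + M.trueParam)) :=
      funext fun ω => err_succ a lam k i ω
    rw [heq]
    exact (hu i).add ((hd.const_smul (a k)).sub (((hu i).add measurable_const).const_smul (lam k)))

lemma energy_add_le {u w : Fin N → Ω → EuclideanSpace ℝ (Fin n)} (hu : ∀ i, MemLp (u i) 2 μ)
    (hw : ∀ i, MemLp (w i) 2 μ) :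
    energy μ (fun i ω => u i ω + w i ω) ≤ 2 * energy μ u + 2 * energy μ w := by
  rw [energy, energy, energy, Finset.mul_sum, Finset.mul_sum, ← Finset.sum_add_distrib]
  exact Finset.sum_le_sum fun i _ => integral_norm_add_sq_le (hu i) (hw i)

lemma energy_sub_comm (u w : Fin N → Ω → EuclideanSpace ℝ (Fin n)) :
    energy μ (fun i ω => u i ω - w i ω) = energy μ (fun i ω => w i ω - u i ω) := by
  simp_rw [energy, norm_sub_rev]

namespace UniformBounds

variable [IsProbabilityMeasure μ] (B : M.UniformBounds μ K)
include B

lemma memLp_err (hA2 : M.NoiseAssumption μ) (a lam : ℕ → ℝ) (k : ℕ) (i : Fin N) :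
    MemLp (M.err a a lam k i) 2 μ := by
  induction k generalizing i with
  | zero => exact memLp_const (M.init i - M.trueParam)
  | succ k ih =>
    have heq : M.err a a lam (k + 1) i = fun ω => M.err a a lam k i ω
      + (a k • M.drift k (M.err a a lam k) i ω - lam k • (M.err a a lam k i ω + M.trueParam)) :=
      funext fun ω => err_succ a lam k i ω
    rw [heq]
    exact (ih i).add (((B.memLp_drift hA2 (measurable_err a lam k) ih i).const_smul (a k)).sub
      (((ih i).add (memLp_const _)).const_smul (lam k)))

/-- The one-step estimates for the mean square error and for the mean square increment. -/
lemma exists_step_bound (hA2 : M.NoiseAssumption μ) (hbal : M.CondBalanced μ) {a lam : ℕ → ℝ}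
    {c κ : ℝ} (hκ : 0 ≤ κ) (ha : ∀ k, 0 ≤ a k) (hac : ∀ k, a k ≤ c) (hl : ∀ k, 0 ≤ lam k)
    (hla : ∀ k, lam k ≤ κ * a k ^ 2) : ∃ C, 0 ≤ C ∧ ∀ k,
    energy μ (M.err a a lam (k + 1)) ≤ energy μ (M.err a a lam k)
      - 2 * a k * (M.obsForm μ k (M.err a a lam k) + M.graphForm μ k (M.err a a lam k))
      + C * a k ^ 2 * (energy μ (M.err a a lam k) + 1) ∧
    energy μ (fun i ω => M.err a a lam (k + 1) i ω - M.err a a lam k i ω)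
      ≤ C * a k ^ 2 * (energy μ (M.err a a lam k) + 1) := by
  have hK := B.nonneg
  set Cd : ℝ := 4 * K ^ 2 + 4 * K + 2 * N * (N * (8 * K ^ 2 + 16 * K ^ 5)) with hCd
  have hCd0 : 0 ≤ Cd := by positivity
  set x0 := M.trueParam with hx0
  -- Chosen so that λ(k) + 4λ(k)² ≤ κ' a(k)²: the first summand bounds the regularization cross
  -- term, the second its square.
  set κ' : ℝ := κ + 4 * (κ ^ 2 * c ^ 2) with hκ'
  have hκ'0 : 0 ≤ κ' := by positivity
  refine ⟨N * (2 * Cd) + κ' * (1 + N * ‖x0‖ ^ 2), by positivity, fun k => ?_⟩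
  set u := M.err a a lam k with hu
  have hum : ∀ i, Measurable[M.past k] (u i) := measurable_err a lam k
  have hu2 : ∀ i, MemLp (u i) 2 μ := B.memLp_err hA2 a lam k
  have hp2 : ∀ i, MemLp (M.drift k u i) 2 μ := B.memLp_drift hA2 hum hu2
  have hdrift : ∀ i, ∫ ω, ‖M.drift k u i ω‖ ^ 2 ∂μ ≤ Cd * (energy μ u + 1) :=
    B.integral_drift_sq_le hA2 hum hu2
  have he := energy_nonneg (μ := μ) u
  have hlam2 : lam k + 4 * lam k ^ 2 ≤ κ' * a k ^ 2 := by
    have h1 : lam k ^ 2 ≤ (κ * a k ^ 2) ^ 2 := pow_le_pow_left₀ (hl k) (hla k) 2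
    have h2 : a k ^ 2 ≤ c ^ 2 := pow_le_pow_left₀ (ha k) (hac k) 2
    have h3 : (κ * a k ^ 2) ^ 2 ≤ κ ^ 2 * c ^ 2 * a k ^ 2 := by
      calc (κ * a k ^ 2) ^ 2 = κ ^ 2 * a k ^ 2 * a k ^ 2 := by ring
        _ ≤ _ := by gcongr
    linarith [hla k]
  have hq : ∀ x : EuclideanSpace ℝ (Fin n), ‖x + x0‖ ^ 2 ≤ 2 * ‖x‖ ^ 2 + 2 * ‖x0‖ ^ 2 :=
    fun x => norm_add_sq_le_two_mul x x0
  have hincr : ∀ i ω, ‖M.err a a lam (k + 1) i ω - u i ω‖ ^ 2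
      ≤ 2 * a k ^ 2 * ‖M.drift k u i ω‖ ^ 2 + 4 * lam k ^ 2 * (‖u i ω‖ ^ 2 + ‖x0‖ ^ 2) := by
    intro i ω
    rw [err_succ, add_sub_cancel_left]
    refine (norm_sub_sq_le_two_mul _ _).trans ?_
    rw [norm_smul, norm_smul, mul_pow, mul_pow, Real.norm_eq_abs, sq_abs, Real.norm_eq_abs, sq_abs]
    have := mul_le_mul_of_nonneg_left (hq (u i ω)) (sq_nonneg (lam k))
    linarith
  have hstep : ∀ i ω, ‖M.err a a lam (k + 1) i ω‖ ^ 2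
      ≤ ‖u i ω‖ ^ 2 + 2 * a k * inner ℝ (u i ω) (M.drift k u i ω)
        + (2 * a k ^ 2 * ‖M.drift k u i ω‖ ^ 2 + κ' * a k ^ 2 * (‖u i ω‖ ^ 2 + ‖x0‖ ^ 2)) := by
    intro i ω
    have h1 := hincr i ω
    rw [err_succ, add_sub_cancel_left] at h1
    rw [err_succ, norm_add_sq_real, inner_sub_right, inner_smul_right, inner_smul_right,
      inner_add_right, real_inner_self_eq_norm_sq]
    change _ ≤ _ at h1
    have h2 : -(inner ℝ (u i ω) x0) ≤ ‖u i ω‖ * ‖x0‖ := by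
      have := neg_le_of_abs_le (abs_real_inner_le_norm (u i ω) x0)
      linarith
    -- The shrinkage pulls towards 0 instead of the true parameter; by Young's inequality the bias
    -- costs at most λ(k) times squared norms.
    have h3 : -(2 * (lam k * (‖u i ω‖ ^ 2 + inner ℝ (u i ω) x0)))
        ≤ lam k * (‖u i ω‖ ^ 2 + ‖x0‖ ^ 2) := by
      have h4 : -(2 * (‖u i ω‖ ^ 2 + inner ℝ (u i ω) x0)) ≤ ‖u i ω‖ ^ 2 + ‖x0‖ ^ 2 := by
        nlinarith [sq_nonneg (‖u i ω‖ - ‖x0‖), sq_nonneg ‖u i ω‖]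
      have := mul_le_mul_of_nonneg_left h4 (hl k)
      linarith
    have h5 := mul_le_mul_of_nonneg_right hlam2
      (add_nonneg (sq_nonneg ‖u i ω‖) (sq_nonneg ‖x0‖))
    linarith
  have hi1 : ∀ i, Integrable (fun ω => 2 * a k ^ 2 * ‖M.drift k u i ω‖ ^ 2
      + κ' * a k ^ 2 * (‖u i ω‖ ^ 2 + ‖x0‖ ^ 2)) μ := fun i =>
    ((hp2 i).integrable_norm_sq.const_mul _).add
      (((hu2 i).integrable_norm_sq.add (integrable_const _)).const_mul _)
  have hI1 : ∀ i, ∫ ω, (2 * a k ^ 2 * ‖M.drift k u i ω‖ ^ 2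
      + κ' * a k ^ 2 * (‖u i ω‖ ^ 2 + ‖x0‖ ^ 2)) ∂μ
      ≤ 2 * a k ^ 2 * (Cd * (energy μ u + 1))
        + κ' * a k ^ 2 * (∫ ω, ‖u i ω‖ ^ 2 ∂μ + ‖x0‖ ^ 2) := by
    intro i
    have hi2 : Integrable (fun ω => ‖u i ω‖ ^ 2 + ‖x0‖ ^ 2) μ :=
      (hu2 i).integrable_norm_sq.add (integrable_const _)
    rw [integral_add ((hp2 i).integrable_norm_sq.const_mul _) (hi2.const_mul _),
      integral_const_mul, integral_const_mul,
      integral_add (hu2 i).integrable_norm_sq (integrable_const _)]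
    have := hdrift i
    simp only [integral_const, probReal_univ, one_smul]
    gcongr
  have hsumI1 : ∑ i : Fin N, (2 * a k ^ 2 * (Cd * (energy μ u + 1))
        + κ' * a k ^ 2 * (∫ ω, ‖u i ω‖ ^ 2 ∂μ + ‖x0‖ ^ 2))
      ≤ (N * (2 * Cd) + κ' * (1 + N * ‖x0‖ ^ 2)) * a k ^ 2 * (energy μ u + 1) := by
    have hsplit : ∑ i : Fin N, (2 * a k ^ 2 * (Cd * (energy μ u + 1))
        + κ' * a k ^ 2 * (∫ ω, ‖u i ω‖ ^ 2 ∂μ + ‖x0‖ ^ 2))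
        = N * (2 * a k ^ 2 * (Cd * (energy μ u + 1)))
          + κ' * a k ^ 2 * (energy μ u + N * ‖x0‖ ^ 2) := by
      rw [Finset.sum_add_distrib, ← Finset.mul_sum (f := fun i => ∫ ω, ‖u i ω‖ ^ 2 ∂μ + ‖x0‖ ^ 2),
        Finset.sum_add_distrib]
      simp only [Finset.sum_const, Finset.card_univ, Fintype.card_fin, nsmul_eq_mul]
      rfl
    rw [hsplit]
    have h1 : energy μ u + N * ‖x0‖ ^ 2 ≤ (1 + N * ‖x0‖ ^ 2) * (energy μ u + 1) := by
      nlinarith [mul_nonneg (mul_nonneg (Nat.cast_nonneg (α := ℝ) N) (sq_nonneg ‖x0‖)) he]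
    have h2 := mul_le_mul_of_nonneg_left h1 (mul_nonneg hκ'0 (sq_nonneg (a k)))
    linarith
  have hnew2 : ∀ i, MemLp (M.err a a lam (k + 1) i) 2 μ := B.memLp_err hA2 a lam (k + 1)
  constructor
  · have hin : ∀ i, Integrable (fun ω => inner ℝ (u i ω) (M.drift k u i ω)) μ :=
      fun i => (hu2 i).integrable_inner (hp2 i)
    have h1 : ∀ i, ∫ ω, ‖M.err a a lam (k + 1) i ω‖ ^ 2 ∂μ
        ≤ ∫ ω, ‖u i ω‖ ^ 2 ∂μ + 2 * a k * ∫ ω, inner ℝ (u i ω) (M.drift k u i ω) ∂μ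
          + (2 * a k ^ 2 * (Cd * (energy μ u + 1))
        + κ' * a k ^ 2 * (∫ ω, ‖u i ω‖ ^ 2 ∂μ + ‖x0‖ ^ 2)) := by
      intro i
      have h0 : Integrable (fun ω => ‖u i ω‖ ^ 2 + 2 * a k * inner ℝ (u i ω) (M.drift k u i ω)) μ :=
        (hu2 i).integrable_norm_sq.add ((hin i).const_mul _)
      refine (integral_mono (hnew2 i).integrable_norm_sq (h0.add (hi1 i)) (hstep i)).trans ?_
      refine (integral_add h0 (hi1 i)).le.trans ?_
      rw [integral_add (hu2 i).integrable_norm_sq ((hin i).const_mul _), integral_const_mul]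
      linarith [hI1 i]
    have h2 := Finset.sum_le_sum fun i (_ : i ∈ Finset.univ) => h1 i
    rw [Finset.sum_add_distrib, Finset.sum_add_distrib, ← Finset.mul_sum,
      B.sum_integral_inner_drift hA2 hbal hum hu2] at h2
    change energy μ _ ≤ energy μ u + _ + _ at h2
    linarith
  · have h1 : ∀ i, ∫ ω, ‖M.err a a lam (k + 1) i ω - u i ω‖ ^ 2 ∂μ
        ≤ 2 * a k ^ 2 * (Cd * (energy μ u + 1))
        + κ' * a k ^ 2 * (∫ ω, ‖u i ω‖ ^ 2 ∂μ + ‖x0‖ ^ 2) := by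
      intro i
      refine (integral_mono ((hnew2 i).sub (hu2 i)).integrable_norm_sq (hi1 i)
        fun ω => (hincr i ω).trans ?_).trans (hI1 i)
      have : 4 * lam k ^ 2 ≤ κ' * a k ^ 2 := by linarith [hl k]
      gcongr
    exact (Finset.sum_le_sum fun i _ => h1 i).trans hsumI1

/-- Each increment is second order in the gain, and so is a sum of boundedly many of them. This is
what permits replacing the errors inside a window by those at its start. -/
lemma exists_energy_diff_le (hA2 : M.NoiseAssumption μ) {a lam : ℕ → ℝ} {c C : ℝ} (hC : 0 ≤ C)
    (ha : ∀ k, 0 ≤ a k) (hac : ∀ k, a k ≤ c) (hanti : Antitone a)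
    (hincr : ∀ k, energy μ (fun i ω => M.err a a lam (k + 1) i ω - M.err a a lam k i ω)
      ≤ C * a k ^ 2 * (energy μ (M.err a a lam k) + 1)) (J : ℕ) :
    ∃ C', 0 ≤ C' ∧ ∀ k, ∀ j ≤ J,
      energy μ (fun i ω => M.err a a lam (k + j) i ω - M.err a a lam k i ω)
        ≤ C' * a k ^ 2 * (energy μ (M.err a a lam k) + 1) := by
  have hmem := B.memLp_err hA2 a lam
  induction J with
  | zero =>
    refine ⟨0, le_rfl, fun k j hj => ?_⟩
    rw [Nat.le_zero.mp hj]
    simp [energy]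
  | succ J ih =>
    obtain ⟨C', hC', h⟩ := ih
    -- With d the mean-square displacement after J steps, the next one is at most 2d + 2C a(k)²(2d +
    -- 2e(k) + 1), and a(k)² ≤ c² in the term with d.
    refine ⟨(2 + 4 * C * c ^ 2) * C' + 4 * C, by positivity, fun k j hj => ?_⟩
    have he := energy_nonneg (μ := μ) (M.err a a lam k)
    rcases Nat.le_succ_iff.mp hj with hj | rfl
    · refine (h k j hj).trans ?_
      gcongr
      nlinarith [mul_nonneg (mul_nonneg hC (sq_nonneg c)) hC']
    · have h1 := h k J le_rfl
      have h2 := hincr (k + J)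
      set d := energy μ (fun i ω => M.err a a lam (k + J) i ω - M.err a a lam k i ω) with hd
      have hd0 : 0 ≤ d := energy_nonneg _
      have h3 : energy μ (M.err a a lam (k + J)) ≤ 2 * d + 2 * energy μ (M.err a a lam k) := by
        have := energy_add_le (μ := μ)
          (u := fun i ω => M.err a a lam (k + J) i ω - M.err a a lam k i ω)
          (w := M.err a a lam k) (fun i => (hmem _ i).sub (hmem _ i)) (hmem k)
        simpa only [sub_add_cancel] using this
      have h4 := energy_add_le (μ := μ)
        (u := fun i ω => M.err a a lam (k + J) i ω - M.err a a lam k i ω)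
        (w := fun i ω => M.err a a lam (k + J + 1) i ω - M.err a a lam (k + J) i ω)
        (fun i => (hmem _ i).sub (hmem _ i)) (fun i => (hmem _ i).sub (hmem _ i))
      simp only [sub_add_sub_cancel'] at h4
      change _ ≤ 2 * d + _ at h4
      have h5 : a (k + J) ^ 2 ≤ a k ^ 2 :=
        pow_le_pow_left₀ (ha _) (hanti (Nat.le_add_right k J)) 2
      have h6 : a k ^ 2 ≤ c ^ 2 := pow_le_pow_left₀ (ha k) (hac k) 2
      have h7 : C * a (k + J) ^ 2 * (energy μ (M.err a a lam (k + J)) + 1)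
          ≤ C * a k ^ 2 * (2 * d + 2 * energy μ (M.err a a lam k) + 1) := by
        have := energy_nonneg (μ := μ) (M.err a a lam (k + J))
        gcongr
      have h8 : C * a k ^ 2 * (2 * d) ≤ C * c ^ 2 * (2 * d) := by gcongr
      have h9 : (2 + 4 * C * c ^ 2) * d
          ≤ (2 + 4 * C * c ^ 2) * (C' * a k ^ 2 * (energy μ (M.err a a lam k) + 1)) := by gcongr
      have h10 : 0 ≤ C * a k ^ 2 := by positivity
      rw [← add_assoc k J 1]
      linarith

end UniformBounds

end RegressionNetwork

/-! ### Laplacians as Dirichlet forms -/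

section GraphLaplacian

lemma graphLaplacian_symmetrizedAdjacency_apply {N : ℕ} (W : Matrix (Fin N) (Fin N) ℝ)
    (i j : Fin N) : graphLaplacian (symmetrizedAdjacency W) i j
      = (if i = j then ∑ l, (1 / 2) * (W i l + W l i) else 0) - (1 / 2) * (W i j + W j i) := by
  simp [graphLaplacian, symmetrizedAdjacency, inDegree, Matrix.diagonal_apply, mul_add]

lemma sum_graphLaplacian_apply {N : ℕ} (W : Matrix (Fin N) (Fin N) ℝ) (i : Fin N) :
    ∑ j, graphLaplacian W i j = 0 := by
  simp [graphLaplacian, inDegree, Matrix.diagonal_apply]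

lemma sum_graphLaplacian_symmetrizedAdjacency_inner {N : ℕ} {E : Type*} [NormedAddCommGroup E]
    [InnerProductSpace ℝ E] (W : Matrix (Fin N) (Fin N) ℝ) (z : Fin N → E) :
    ∑ i, ∑ j, graphLaplacian (symmetrizedAdjacency W) i j * inner ℝ (z i) (z j)
      = (1 / 2) * ∑ i, ∑ j, W i j * ‖z i - z j‖ ^ 2 := by
  simp_rw [graphLaplacian_symmetrizedAdjacency_apply, sub_mul, ite_mul, zero_mul,
    Finset.sum_sub_distrib, Finset.sum_ite_eq, Finset.mem_univ, if_true,
    real_inner_self_eq_norm_sq, norm_sub_sq_real, mul_add, mul_sub, add_mul, Finset.sum_add_distrib,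
    Finset.sum_sub_distrib, add_mul, Finset.sum_mul, Finset.sum_add_distrib]
  have h1 : ∑ i, ∑ j, (1 / 2) * W j i * ‖z i‖ ^ 2 = ∑ i, ∑ j, (1 / 2) * W i j * ‖z j‖ ^ 2 :=
    Finset.sum_comm
  have h2 : ∑ i, ∑ j, (1 / 2) * W j i * inner ℝ (z i) (z j)
      = ∑ i, ∑ j, (1 / 2) * W i j * inner ℝ (z i) (z j) := by
    rw [Finset.sum_comm]
    simp_rw [real_inner_comm]
  rw [h1, h2]
  simp_rw [mul_assoc, ← Finset.mul_sum, mul_left_comm _ (2 : ℝ), ← Finset.mul_sum]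
  ring

/-- A scalar inequality for S passes to vector-valued families by applying it to each coordinate and
adding. -/
lemma mul_sum_norm_sq_le_of_dotProduct {N n : ℕ} {S : Matrix (Fin N) (Fin N) ℝ} {θ : ℝ}
    (hS : ∀ x : Fin N → ℝ, ∑ i, x i = 0 → θ * (x ⬝ᵥ x) ≤ x ⬝ᵥ S.mulVec x)
    {z : Fin N → EuclideanSpace ℝ (Fin n)} (hz : ∑ i, z i = 0) :
    θ * ∑ i, ‖z i‖ ^ 2 ≤ ∑ i, ∑ j, S i j * inner ℝ (z i) (z j) := by
  have h1 : ∀ c, θ * ∑ i, z i c * z i c ≤ ∑ i, ∑ j, S i j * (z i c * z j c) := by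
    intro c
    have hzc : ∑ i, z i c = 0 := by
      have := congrArg (fun x : EuclideanSpace ℝ (Fin n) => x c) hz
      simpa using this
    have := hS (fun i => z i c) hzc
    refine this.trans_eq ?_
    simp only [dotProduct, Matrix.mulVec, Finset.mul_sum]
    exact Finset.sum_congr rfl fun i _ => Finset.sum_congr rfl fun j _ => by ring
  have h2 := Finset.sum_le_sum fun c (_ : c ∈ Finset.univ) => h1 c
  rw [← Finset.mul_sum, Finset.sum_comm] at h2
  have h3 : ∀ i, ∑ c, z i c * z i c = ‖z i‖ ^ 2 := fun i => by
    rw [EuclideanSpace.norm_sq_eq]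
    exact Finset.sum_congr rfl fun c _ => by rw [Real.norm_eq_abs, sq_abs, sq]
  have h4 : ∑ c, ∑ i, ∑ j, S i j * (z i c * z j c) = ∑ i, ∑ j, S i j * inner ℝ (z i) (z j) := by
    rw [Finset.sum_comm]
    refine Finset.sum_congr rfl fun i _ => ?_
    rw [Finset.sum_comm]
    refine Finset.sum_congr rfl fun j _ => ?_
    rw [← Finset.mul_sum, PiLp.inner_apply]
    congr 1
    exact Finset.sum_congr rfl fun c _ => by simp [mul_comm]
  rw [h4] at h2
  simpa only [h3] using h2

end GraphLaplacian

/-! ### From conditional eigenvalue bounds to mean quadratic forms -/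

namespace RegressionNetwork

variable {Ω : Type*} [mΩ : MeasurableSpace Ω] {μ : Measure Ω} {N n : ℕ} {m : Fin N → ℕ}
  {M : RegressionNetwork Ω N n m} {K : ℝ}

namespace UniformBounds

variable (B : M.UniformBounds μ K)
include B

lemma integrable_laplacian_mul {s : ℕ} (i j : Fin N) {g : Ω → ℝ} (hg : Integrable g μ) :
    Integrable (fun ω => graphLaplacian (symmetrizedAdjacency (M.A s ω)) i j * g ω) μ := by
  have h1 : ∀ i j, Integrable (fun ω => (1 / 2) * (M.A s ω i j + M.A s ω j i) * g ω) μ := by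
    intro i j
    refine (((B.weight_mul i j (k := s) hg).add (B.weight_mul j i (k := s) hg)).const_mul
      (1 / 2)).congr (ae_of_all _ fun ω => ?_)
    simp only [Pi.add_apply]
    ring
  simp_rw [graphLaplacian_symmetrizedAdjacency_apply, sub_mul]
  refine Integrable.sub ?_ (h1 i j)
  by_cases hij : i = j
  · simp_rw [if_pos hij, Finset.sum_mul]
    exact integrable_finsetSum _ fun l _ => h1 i l
  · simp_rw [if_neg hij, zero_mul]
    exact integrable_zero _ _ _

lemma sum_integral_laplacian_inner {s : ℕ} {z : Fin N → Ω → EuclideanSpace ℝ (Fin n)}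
    (hz2 : ∀ i, MemLp (z i) 2 μ) :
    ∑ i, ∑ j, ∫ ω, graphLaplacian (symmetrizedAdjacency (M.A s ω)) i j
      * inner ℝ (z i ω) (z j ω) ∂μ = M.graphForm μ s z := by
  have hL := fun i j => B.integrable_laplacian_mul i j (s := s) ((hz2 i).integrable_inner (hz2 j))
  have hA := fun i j => B.weight_mul i j (k := s) (integrable_norm_sub_sq hz2 i j)
  rw [graphForm, Finset.sum_congr rfl fun i _ =>
    (integral_finsetSum Finset.univ fun j _ => hL i j).symm,
    ← integral_finsetSum _ fun i _ => integrable_finsetSum _ fun j _ => hL i j,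
    Finset.sum_congr rfl fun i _ => (integral_finsetSum Finset.univ fun j _ => hA i j).symm,
    ← integral_finsetSum _ fun i _ => integrable_finsetSum _ fun j _ => hA i j,
    ← integral_const_mul]
  exact integral_congr_ae (ae_of_all _ fun ω =>
    sum_graphLaplacian_symmetrizedAdjacency_inner (M.A s ω) fun i => z i ω)

variable [IsProbabilityMeasure μ]

lemma integrable_laplacian (s : ℕ) (i j : Fin N) :
    Integrable (fun ω => graphLaplacian (symmetrizedAdjacency (M.A s ω)) i j) μ := by
  simpa using B.integrable_laplacian_mul i j (s := s) (integrable_const (1 : ℝ))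

/-- Joint connectedness bounds the graph forms below on centred families. -/
lemma mul_energy_le_sum_graphForm {k : ℕ} {I : Finset ℕ} {θ : ℝ} (hθ : 0 < θ)
    (hconn : ∀ᵐ ω ∂μ, θ ≤ lambdaTwo (∑ s ∈ I, condExpMatrix μ (M.past k)
      (fun ω' => graphLaplacian (symmetrizedAdjacency (M.A s ω'))) ω))
    {z : Fin N → Ω → EuclideanSpace ℝ (Fin n)} (hz : ∀ i, Measurable[M.past k] (z i))
    (hz2 : ∀ i, MemLp (z i) 2 μ) (hz0 : ∀ ω, ∑ i, z i ω = 0) :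
    θ * energy μ z ≤ ∑ s ∈ I, M.graphForm μ s z := by
  set L : ℕ → Fin N → Fin N → Ω → ℝ := fun s i j ω =>
    graphLaplacian (symmetrizedAdjacency (M.A s ω)) i j with hL
  have hLi : ∀ s i j, Integrable (L s i j) μ := fun s i j => B.integrable_laplacian s i j
  have hgm : ∀ i j, Measurable[M.past k] fun ω => inner ℝ (z i ω) (z j ω) := fun i j =>
    Measurable.inner (hz i) (hz j)
  have hgi : ∀ i j, Integrable (fun ω => inner ℝ (z i ω) (z j ω)) μ := fun i j =>
    (hz2 i).integrable_inner (hz2 j)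
  have hpull : ∀ s i j, μ[fun ω => L s i j ω * inner ℝ (z i ω) (z j ω) | M.past k]
      =ᵐ[μ] fun ω => (μ[L s i j | M.past k]) ω * inner ℝ (z i ω) (z j ω) := fun s i j =>
    condExp_mul_of_stronglyMeasurable_right (hgm i j).stronglyMeasurable
      (B.integrable_laplacian_mul i j (hgi i j)) (hLi s i j)
  have hpi : ∀ s i j, Integrable (fun ω => (μ[L s i j | M.past k]) ω
      * inner ℝ (z i ω) (z j ω)) μ := fun s i j => integrable_condExp.congr (hpull s i j)
  have hform : ∀ s, M.graphForm μ s z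
      = ∫ ω, ∑ i, ∑ j, (μ[L s i j | M.past k]) ω * inner ℝ (z i ω) (z j ω) ∂μ := by
    intro s
    rw [← B.sum_integral_laplacian_inner hz2, integral_finsetSum _ fun i _ =>
      integrable_finsetSum _ fun j _ => hpi s i j]
    refine Finset.sum_congr rfl fun i _ => ?_
    rw [integral_finsetSum _ fun j _ => hpi s i j]
    refine Finset.sum_congr rfl fun j _ => ?_
    rw [← integral_condExp (M.past_le k)]
    exact integral_congr_ae (hpull s i j)
  have hfi : ∀ s, Integrable (fun ω => ∑ i, ∑ j, (μ[L s i j | M.past k]) ω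
      * inner ℝ (z i ω) (z j ω)) μ := fun s =>
    integrable_finsetSum _ fun i _ => integrable_finsetSum _ fun j _ => hpi s i j
  rw [Finset.sum_congr rfl fun s _ => hform s, ← integral_finsetSum _ fun s _ => hfi s, energy,
    ← integral_finsetSum _ fun i _ => (hz2 i).integrable_norm_sq, ← integral_const_mul]
  refine integral_mono_ae ((integrable_finsetSum _ fun i _ =>
    (hz2 i).integrable_norm_sq).const_mul θ) (integrable_finsetSum _ fun s _ => hfi s) ?_
  -- Laplacian rows sum to zero, and conditional expectation preserves this almost surely; so 1 lies
  -- in the kernel of the summed conditional Laplacian.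
  have hrow : ∀ᵐ ω ∂μ, ∀ s i, ∑ j, (μ[L s i j | M.past k]) ω = 0 := by
    refine ae_all_iff.mpr fun s => ae_all_iff.mpr fun i => ?_
    have h1 := condExp_finsetSum (m := M.past k) (s := Finset.univ) (f := fun j => L s i j)
      fun j _ => hLi s i j
    have h2 : ∑ j, L s i j = 0 := by
      ext ω
      rw [Finset.sum_apply]
      exact sum_graphLaplacian_apply _ i
    rw [h2, condExp_zero] at h1
    filter_upwards [h1] with ω hω
    rw [Finset.sum_apply] at hω
    exact hω.symm
  filter_upwards [hconn, hrow] with ω h1 h2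
  set S := ∑ s ∈ I, condExpMatrix μ (M.past k)
    (fun ω' => graphLaplacian (symmetrizedAdjacency (M.A s ω'))) ω with hS
  have hSapp : ∀ i j, S i j = ∑ s ∈ I, (μ[L s i j | M.past k]) ω := by
    intro i j
    rw [hS, Matrix.sum_apply]
    rfl
  have hker : S.mulVec 1 = 0 := by
    ext i
    simp only [Matrix.mulVec, dotProduct, Pi.one_apply, mul_one, hSapp, Pi.zero_apply]
    rw [Finset.sum_comm]
    exact Finset.sum_eq_zero fun s _ => h2 s i
  refine (mul_sum_norm_sq_le_of_dotProduct (lambdaTwo_mul_dotProduct_le hθ h1 hker)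
    (hz0 ω)).trans_eq ?_
  simp_rw [hSapp, Finset.sum_mul]
  rw [Finset.sum_comm' (t' := Finset.univ) (s' := fun _ => I) (by simp)]
  refine Finset.sum_congr rfl fun i _ => ?_
  rw [Finset.sum_comm]

/-- Joint observability bounds the observation forms below on constant families. -/
lemma mul_integral_le_sum_obsForm {k : ℕ} {I : Finset ℕ} (hI : ∀ s ∈ I, k ≤ s) {θ : ℝ}
    (hθ : 0 < θ)
    (hobs : ∀ᵐ ω ∂μ, θ ≤ lambdaMin (∑ i, ∑ s ∈ I, condExpMatrix μ (M.past k)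
      (fun ω' => (M.H i s ω').transpose * M.H i s ω') ω))
    {p : Ω → EuclideanSpace ℝ (Fin n)} (hp : Measurable[M.past k] p) (hp2 : MemLp p 2 μ) :
    θ * ∫ ω, ‖p ω‖ ^ 2 ∂μ ≤ ∑ s ∈ I, M.obsForm μ s fun _ => p := by
  set G : Fin N → ℕ → Fin n → Fin n → Ω → ℝ := fun i s c d ω =>
    ((M.H i s ω).transpose * M.H i s ω) c d with hG
  have hGm : ∀ i s c d, Measurable (G i s c d) := by
    intro i s c d
    simp only [hG, Matrix.mul_apply, Matrix.transpose_apply]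
    exact Finset.measurable_sum _ fun r _ => (M.measurable_H i s r c).mul (M.measurable_H i s r d)
  have hGi : ∀ i s c d, Integrable (G i s c d) μ := fun i s c d =>
    (B.integrable_frobSq s i).mono' (hGm i s c d).aestronglyMeasurable
      (ae_of_all _ fun ω => M.abs_gram_apply_le i s ω c d)
  have hpc : ∀ c, Measurable[M.past k] fun ω => p ω c := fun c =>
    (EuclideanSpace.proj (𝕜 := ℝ) c).continuous.measurable.comp hp
  have hgm : ∀ c d, Measurable[M.past k] fun ω => p ω c * p ω d := fun c d => (hpc c).mul (hpc d)
  -- Since k ≤ s, p is also known at time s, so the conditional moment bound given `M.past s`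
  -- applies.
  have hGp : ∀ i, ∀ s ∈ I, ∀ c d, Integrable (fun ω => G i s c d ω * (p ω c * p ω d)) μ := by
    intro i s hs c d
    have h1 := integrable_mul_of_condExp_le (M.past_le s) (B.integrable_frobSq s i)
      (ae_of_all _ (M.frobSq_nonneg i s)) B.nonneg (B.condExp_frobSq_le s i)
      (measurable_norm_sq (hp.mono (M.past_mono (hI s hs)) le_rfl)) (fun ω => sq_nonneg _)
      hp2.integrable_norm_sq
    refine h1.1.mono' ((hGm i s c d).mul ((hgm c d).mono (M.past_le k)
      le_rfl)).aestronglyMeasurable (ae_of_all _ fun ω => ?_)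
    rw [norm_mul, norm_mul, sq]
    exact mul_le_mul (M.abs_gram_apply_le i s ω c d) (mul_le_mul (PiLp.norm_apply_le _ _)
      (PiLp.norm_apply_le _ _) (norm_nonneg _) (norm_nonneg _)) (by positivity)
      (M.frobSq_nonneg i s ω)
  have hpint : ∀ c d, Integrable (fun ω => p ω c * p ω d) μ := by
    intro c d
    refine hp2.integrable_norm_sq.mono' ((hgm c d).mono (M.past_le k)
      le_rfl).aestronglyMeasurable (ae_of_all _ fun ω => ?_)
    rw [norm_mul, sq]
    exact mul_le_mul (PiLp.norm_apply_le _ _) (PiLp.norm_apply_le _ _) (norm_nonneg _)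
      (norm_nonneg _)
  have hpull : ∀ i, ∀ s ∈ I, ∀ c d, μ[fun ω => G i s c d ω * (p ω c * p ω d) | M.past k]
      =ᵐ[μ] fun ω => (μ[G i s c d | M.past k]) ω * (p ω c * p ω d) := fun i s hs c d =>
    condExp_mul_of_stronglyMeasurable_right (hgm c d).stronglyMeasurable
      (hGp i s hs c d) (hGi i s c d)
  have hpi : ∀ i, ∀ s ∈ I, ∀ c d, Integrable (fun ω => (μ[G i s c d | M.past k]) ω
      * (p ω c * p ω d)) μ := fun i s hs c d => integrable_condExp.congr (hpull i s hs c d)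
  have hfi : ∀ i, ∀ s ∈ I, Integrable (fun ω => ∑ c, ∑ d, (μ[G i s c d | M.past k]) ω
      * (p ω c * p ω d)) μ := fun i s hs =>
    integrable_finsetSum _ fun c _ => integrable_finsetSum _ fun d _ => hpi i s hs c d
  have hform : ∀ i, ∀ s ∈ I, ∫ ω, ‖Matrix.toEuclideanLin (M.H i s ω) (p ω)‖ ^ 2 ∂μ
      = ∫ ω, ∑ c, ∑ d, (μ[G i s c d | M.past k]) ω * (p ω c * p ω d) ∂μ := by
    intro i s hs
    simp_rw [norm_sq_toEuclideanLin]
    rw [integral_finsetSum _ fun c _ => integrable_finsetSum _ fun d _ => hGp i s hs c d,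
      integral_finsetSum _ fun c _ => integrable_finsetSum _ fun d _ => hpi i s hs c d]
    refine Finset.sum_congr rfl fun c _ => ?_
    rw [integral_finsetSum _ fun d _ => hGp i s hs c d,
      integral_finsetSum _ fun d _ => hpi i s hs c d]
    refine Finset.sum_congr rfl fun d _ => ?_
    rw [← integral_condExp (M.past_le k)]
    exact integral_congr_ae (hpull i s hs c d)
  have hsum : ∑ s ∈ I, M.obsForm μ s (fun _ => p)
      = ∫ ω, ∑ i, ∑ s ∈ I, ∑ c, ∑ d, (μ[G i s c d | M.past k]) ω * (p ω c * p ω d) ∂μ := by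
    rw [integral_finsetSum _ fun i _ => integrable_finsetSum _ fun s hs => hfi i s hs]
    simp_rw [obsForm]
    rw [Finset.sum_comm]
    refine Finset.sum_congr rfl fun i _ => ?_
    rw [integral_finsetSum _ fun s hs => hfi i s hs]
    exact Finset.sum_congr rfl fun s hs => hform i s hs
  rw [hsum, ← integral_const_mul]
  refine integral_mono_ae (hp2.integrable_norm_sq.const_mul θ)
    (integrable_finsetSum _ fun i _ => integrable_finsetSum _ fun s hs => hfi i s hs) ?_
  filter_upwards [hobs] with ω h1
  have h2 := lambdaMin_mul_dotProduct_le hθ h1 (p ω).ofLp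
  have h3 : (p ω).ofLp ⬝ᵥ (p ω).ofLp = ‖p ω‖ ^ 2 := by
    rw [EuclideanSpace.norm_sq_eq]
    exact Finset.sum_congr rfl fun c _ => by rw [Real.norm_eq_abs, sq_abs, sq]
  rw [h3] at h2
  refine h2.trans_eq ?_
  rw [Matrix.sum_mulVec, dotProduct_sum]
  refine Finset.sum_congr rfl fun i _ => ?_
  rw [Matrix.sum_mulVec, dotProduct_sum]
  refine Finset.sum_congr rfl fun s _ => ?_
  simp only [dotProduct, Matrix.mulVec, Finset.mul_sum]
  refine Finset.sum_congr rfl fun c _ => Finset.sum_congr rfl fun d _ => ?_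
  change p ω c * ((μ[G i s c d | M.past k]) ω * p ω d) = _
  ring

end UniformBounds

end RegressionNetwork

/-! ### Coercivity over windows and the decay rate -/

namespace RegressionNetwork

variable {Ω : Type*} [mΩ : MeasurableSpace Ω] {μ : Measure Ω} {N n : ℕ} {m : Fin N → ℕ}
  {M : RegressionNetwork Ω N n m} {K : ℝ}

lemma energy_centered_decomposition (u : Fin N → Ω → EuclideanSpace ℝ (Fin n))
    (p : Ω → EuclideanSpace ℝ (Fin n)) [IsProbabilityMeasure μ] (hu : ∀ i, MemLp (u i) 2 μ)
    (hp : MemLp p 2 μ) :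
    energy μ u ≤ 2 * energy μ (fun i ω => u i ω - p ω) + 2 * (N * ∫ ω, ‖p ω‖ ^ 2 ∂μ) := by
  have h := energy_add_le (μ := μ) (u := fun i ω => u i ω - p ω) (w := fun _ => p)
    (fun i => (hu i).sub hp) (fun _ => hp)
  simp only [sub_add_cancel] at h
  refine h.trans_eq ?_
  simp [energy]

namespace UniformBounds

variable [IsProbabilityMeasure μ] (B : M.UniformBounds μ K)
include B

/-- Over a window of fixed length, the observation and graph forms are jointly coercive on families
determined by the past of the window. -/
lemma exists_coercive (hbal : M.CondBalanced μ)
    (hconn : UniformlyCondJointlyConnected μ M.past fun k ω => symmetrizedAdjacency (M.A k ω))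
    (hobs : UniformlyCondJointlyObservable μ M.past M.H) :
    ∃ h : ℕ, 0 < h ∧ ∃ c : ℝ, 0 < c ∧ ∀ (q : ℕ) (u : Fin N → Ω → EuclideanSpace ℝ (Fin n)),
      (∀ i, Measurable[M.past (q * h)] (u i)) → (∀ i, MemLp (u i) 2 μ) →
      c * energy μ u ≤ ∑ s ∈ Finset.Ico (q * h) ((q + 1) * h),
        (M.obsForm μ s u + M.graphForm μ s u) := by
  obtain ⟨h₁, hh₁, θ₁, hθ₁, hconn⟩ := hconn
  obtain ⟨h₂, hh₂, θ₂, hθ₂, hobs⟩ := hobs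
  have hK := B.nonneg
  set C : ℝ := 4 * N / θ₂ + (2 + 4 * N * h₂ * K / θ₂) / θ₁ with hC
  have hC0 : 0 < C := by positivity
  -- Windows of length h₁h₂ start at multiples of both h₁ and h₂, so each contains a connectivity
  -- window and an observability window with the same start.
  refine ⟨h₁ * h₂, Nat.mul_pos hh₁ hh₂, C⁻¹, by positivity, fun q u hu hu2 => ?_⟩
  set k := q * (h₁ * h₂) with hk
  have hkend : (q + 1) * (h₁ * h₂) = k + h₁ * h₂ := by rw [hk]; ring
  set p : Ω → EuclideanSpace ℝ (Fin n) := fun ω => (N : ℝ)⁻¹ • ∑ i, u i ω with hp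
  have hsum : Measurable[M.past k] fun ω => ∑ i, u i ω := Finset.measurable_sum _ fun i _ => hu i
  have hpm : Measurable[M.past k] p := hsum.const_smul (N : ℝ)⁻¹
  have hsum2 : MemLp (fun ω => ∑ i, u i ω) 2 μ := memLp_finsetSum _ fun i _ => hu2 i
  have hp2 : MemLp p 2 μ := hsum2.const_smul (N : ℝ)⁻¹
  set z : Fin N → Ω → EuclideanSpace ℝ (Fin n) := fun i ω => u i ω - p ω with hz
  have hzm : ∀ i, Measurable[M.past k] (z i) := fun i => (hu i).sub hpm
  have hz2 : ∀ i, MemLp (z i) 2 μ := fun i => (hu2 i).sub hp2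
  have hz0 : ∀ ω, ∑ i, z i ω = 0 := by
    intro ω
    rcases Nat.eq_zero_or_pos N with hN | hN
    · subst hN
      simp
    · simp only [hz, hp, Finset.sum_sub_distrib, Finset.sum_const, Finset.card_univ,
        Fintype.card_fin]
      rw [← Nat.cast_smul_eq_nsmul ℝ, smul_smul,
        mul_inv_cancel₀ (Nat.cast_ne_zero.mpr hN.ne'), one_smul, sub_self]
  have hum : ∀ s, k ≤ s → ∀ i, Measurable[M.past s] (u i) := fun s hs i =>
    (hu i).mono (M.past_mono hs) le_rfl
  have hobs0 : ∀ s, 0 ≤ M.obsForm μ s u := fun s => obsForm_nonneg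
  have hgraph0 : ∀ s, k ≤ s → 0 ≤ M.graphForm μ s u := fun s hs =>
    B.graphForm_nonneg hbal (hum s hs) hu2
  -- The graph form sees only differences, so it agrees on u and on the centred z; instants beyond
  -- the first h₁ contribute nonnegatively.
  have hgraph : θ₁ * energy μ z ≤ ∑ s ∈ Finset.Ico k (k + h₁ * h₂), M.graphForm μ s u := by
    have hk1 : q * h₂ * h₁ = k := by rw [hk]; ring
    have hk2 : (q * h₂ + 1) * h₁ = k + h₁ := by rw [add_mul, hk1, one_mul]
    have h1 := B.mul_energy_le_sum_graphForm (k := k) (I := Finset.Ico k (k + h₁)) hθ₁ (by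
      filter_upwards [hconn] with ω hω
      have h2 := hω (q * h₂)
      rwa [hk1, hk2] at h2) hzm hz2 hz0
    have h2 : ∀ s, M.graphForm μ s z = M.graphForm μ s u := fun s => by
      simp only [graphForm, hz, sub_sub_sub_cancel_right]
    rw [Finset.sum_congr rfl fun s _ => h2 s] at h1
    refine h1.trans (Finset.sum_le_sum_of_subset_of_nonneg
      (Finset.Ico_subset_Ico_right (Nat.add_le_add_left (Nat.le_mul_of_pos_right h₁ hh₂) k))
      fun s hs _ => hgraph0 s (Finset.mem_Ico.mp hs).1)
  -- Observability applies to the constant family p; passing back to u costs the observation form of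
  -- the deviations, bounded by K times their energy.
  have hobsm : θ₂ * ∫ ω, ‖p ω‖ ^ 2 ∂μ
      ≤ 2 * ∑ s ∈ Finset.Ico k (k + h₁ * h₂), M.obsForm μ s u + 2 * (h₂ * (K * energy μ z)) := by
    have hk1 : q * h₁ * h₂ = k := by rw [hk]; ring
    have hk2 : (q * h₁ + 1) * h₂ = k + h₂ := by rw [add_mul, hk1, one_mul]
    have h1 := B.mul_integral_le_sum_obsForm (k := k) (I := Finset.Ico k (k + h₂))
      (fun s hs => (Finset.mem_Ico.mp hs).1) hθ₂ (by
      filter_upwards [hobs] with ω hω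
      have h2 := hω (q * h₁)
      rwa [hk1, hk2] at h2) hpm hp2
    have h2 : ∀ s ∈ Finset.Ico k (k + h₂), M.obsForm μ s (fun _ => p)
        ≤ 2 * M.obsForm μ s u + 2 * (K * energy μ z) := by
      intro s hs
      have hks := (Finset.mem_Ico.mp hs).1
      have hpms : ∀ _ : Fin N, Measurable[M.past s] p := fun _ =>
        hpm.mono (M.past_mono hks) le_rfl
      have h3 := B.obsForm_add_le hpms (fun _ => hp2) (hum s hks) hu2
      have h4 := B.obsForm_le (k := s) (u := fun i ω => p ω - u i ω)
        (fun i => (hpms i).sub (hum s hks i)) (fun i => hp2.sub (hu2 i))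
      rw [energy_sub_comm (fun _ => p) u] at h4
      linarith
    have h3 := h1.trans (Finset.sum_le_sum h2)
    rw [Finset.sum_add_distrib, ← Finset.mul_sum] at h3
    simp only [Finset.sum_const, Nat.card_Ico, add_tsub_cancel_left, nsmul_eq_mul] at h3
    have h4 : ∑ s ∈ Finset.Ico k (k + h₂), M.obsForm μ s u
        ≤ ∑ s ∈ Finset.Ico k (k + h₁ * h₂), M.obsForm μ s u :=
      Finset.sum_le_sum_of_subset_of_nonneg
        (Finset.Ico_subset_Ico_right (Nat.add_le_add_left (Nat.le_mul_of_pos_left h₂ hh₁) k))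
        fun s _ _ => hobs0 s
    linarith
  have hdec := energy_centered_decomposition u p hu2 hp2
  change energy μ u ≤ 2 * energy μ z + _ at hdec
  rw [hkend, Finset.sum_add_distrib, inv_mul_le_iff₀ hC0]
  set X := ∑ s ∈ Finset.Ico k (k + h₁ * h₂), M.obsForm μ s u with hX
  set Y := ∑ s ∈ Finset.Ico k (k + h₁ * h₂), M.graphForm μ s u with hY
  have hX0 : 0 ≤ X := Finset.sum_nonneg fun s _ => hobs0 s
  have hY0 : 0 ≤ Y := Finset.sum_nonneg fun s hs => hgraph0 s (Finset.mem_Ico.mp hs).1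
  have e1 : ∫ ω, ‖p ω‖ ^ 2 ∂μ ≤ (2 * X + 2 * (h₂ * (K * energy μ z))) / θ₂ := by
    rw [le_div_iff₀ hθ₂]; linarith
  have e2 : energy μ z ≤ Y / θ₁ := by rw [le_div_iff₀ hθ₁]; linarith
  calc energy μ u ≤ 2 * energy μ z + 2 * (N * ∫ ω, ‖p ω‖ ^ 2 ∂μ) := hdec
    _ ≤ 2 * energy μ z + 2 * (N * ((2 * X + 2 * (h₂ * (K * energy μ z))) / θ₂)) := by gcongr
    _ = 4 * N / θ₂ * X + (2 + 4 * N * h₂ * K / θ₂) * energy μ z := by ring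
    _ ≤ 4 * N / θ₂ * X + (2 + 4 * N * h₂ * K / θ₂) * (Y / θ₁) := by gcongr
    _ = 4 * N / θ₂ * X + (2 + 4 * N * h₂ * K / θ₂) / θ₁ * Y := by ring
    _ ≤ C * (X + Y) := by
        have h1 : 0 ≤ 4 * N / θ₂ := by positivity
        have h2 : 0 ≤ (2 + 4 * N * h₂ * K / θ₂) / θ₁ := by positivity
        rw [hC]
        nlinarith [mul_nonneg h1 hY0, mul_nonneg h2 hX0]

/-- The mean square error decays like `k ^ (-τ)`. -/
lemma exists_energy_err_le (hA2 : M.NoiseAssumption μ) (hbal : M.CondBalanced μ)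
    (hconn : UniformlyCondJointlyConnected μ M.past fun k ω => symmetrizedAdjacency (M.A k ω))
    (hobs : UniformlyCondJointlyObservable μ M.past M.H) {a lam : ℕ → ℝ} {c₁ c₂ τ : ℝ}
    (hc₁ : 0 < c₁) (hc₂ : 0 < c₂) (hτ : 0 < τ) (hτ' : τ < 1)
    (ha : ∀ k : ℕ, a k = c₁ / ((k : ℝ) + 1) ^ τ)
    (hlam : ∀ k : ℕ, lam k = c₂ / ((k : ℝ) + 1) ^ (2 * τ)) :
    ∃ C, 0 ≤ C ∧ ∀ t : ℕ, energy μ (M.err a a lam t) ≤ C * ((t : ℝ) + 1) ^ (-τ) := by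
  have hK := B.nonneg
  have ha0 : ∀ k, 0 ≤ a k := fun k => by rw [ha]; positivity
  have hanti : Antitone a := fun k l hkl => by
    rw [ha, ha]
    have : (k : ℝ) ≤ l := by exact_mod_cast hkl
    gcongr
  have hac : ∀ k, a k ≤ c₁ := fun k => by
    have := hanti (Nat.zero_le k)
    rw [ha 0] at this
    simpa using this
  have hlam0 : ∀ k, 0 ≤ lam k := fun k => by rw [hlam]; positivity
  have hlam' : ∀ k, lam k ≤ c₂ / c₁ ^ 2 * a k ^ 2 := fun k => by
    rw [hlam, ha, div_pow, mul_comm 2 τ, Real.rpow_mul (by positivity), Real.rpow_ofNat]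
    exact le_of_eq (by field_simp)
  obtain ⟨h, hh, c, hc, hcoer⟩ := B.exists_coercive hbal hconn hobs
  obtain ⟨C, hC, hstep⟩ := B.exists_step_bound hA2 hbal (by positivity) ha0 hac hlam0 hlam'
  obtain ⟨C', hC', hdiff⟩ := B.exists_energy_diff_le hA2 hC ha0 hac hanti (fun k => (hstep k).2) h
  have hm := fun k => measurable_err (M := M) a lam k
  have h2 := B.memLp_err hA2 a lam
  set δ := M.err a a lam with hδ
  set D : ℕ → ℝ := fun s => M.obsForm μ s (δ s) + M.graphForm μ s (δ s) with hD
  have hD0 : ∀ s, 0 ≤ D s := fun s =>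
    add_nonneg obsForm_nonneg (B.graphForm_nonneg hbal (hm s) (h2 s))
  set Q : ℝ := K + 2 * K * N ^ 2 with hQ
  -- The constant c/2 and the term with Q C' come from comparing the forms at the frozen errors with
  -- those at the current ones, form(δ(k)) ≤ 2 form(δ(s)) + 2 form(δ(k) - δ(s)).
  refine exists_le_mul_rpow_neg_of_window hh hc₁ hτ hτ' ha (fun k => energy_nonneg (δ k)) hD0
    (c := c / 2) (C := C + h * (Q * C')) (by positivity) (by positivity) (fun k => ?_) fun q => ?_
  · refine (hstep k).1.trans ?_
    have := energy_nonneg (μ := μ) (δ k)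
    gcongr
    exact le_add_of_nonneg_right (by positivity)
  · set k := q * h with hk
    have hkend : (q + 1) * h = k + h := by rw [hk]; ring
    have h3 := hcoer q (δ k) (hm k) (h2 k)
    rw [← hk, hkend] at h3
    rw [hkend]
    have h4 : ∀ s ∈ Finset.Ico k (k + h), M.obsForm μ s (δ k) + M.graphForm μ s (δ k)
        ≤ 2 * D s + 2 * (Q * (C' * a k ^ 2 * (energy μ (δ k) + 1))) := by
      intro s hs
      rw [Finset.mem_Ico] at hs
      have hmk : ∀ i, Measurable[M.past s] (δ k i) := fun i =>
        (hm k i).mono (M.past_mono hs.1) le_rfl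
      have e1 := B.obsForm_add_le hmk (h2 k) (hm s) (h2 s)
      have e2 := B.graphForm_le_two_mul_add hbal hmk (h2 k) (hm s) (h2 s)
      have e3 := B.obsForm_le (k := s) (u := fun i ω => δ k i ω - δ s i ω)
        (fun i => (hmk i).sub (hm s i)) (fun i => (h2 k i).sub (h2 s i))
      have e4 := B.graphForm_le (k := s) (u := fun i ω => δ k i ω - δ s i ω)
        (fun i => (h2 k i).sub (h2 s i))
      rw [energy_sub_comm] at e3 e4
      have e5 := hdiff k (s - k) (by omega)
      rw [Nat.add_sub_cancel' hs.1] at e5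
      have e6 := mul_le_mul_of_nonneg_left e5 (by positivity : 0 ≤ Q)
      simp only [hD]
      rw [hQ] at e6 ⊢
      linarith
    have h5 := h3.trans (Finset.sum_le_sum h4)
    rw [Finset.sum_add_distrib, ← Finset.mul_sum] at h5
    simp only [Finset.sum_const, Nat.card_Ico, add_tsub_cancel_left, nsmul_eq_mul] at h5
    have h6 : 0 ≤ C * a k ^ 2 * (energy μ (δ k) + 1) := by
      have := energy_nonneg (μ := μ) (δ k)
      positivity
    linarith

/-- The residual is H u - v, and the cross term has mean zero because v is centred given the past
and the current H. What remains separates the excess loss from an irreducible noise term. -/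
lemma loss_expansion (hA2 : M.NoiseAssumption μ) {t : ℕ} (j : Fin N)
    {u : Ω → EuclideanSpace ℝ (Fin n)} (hu : Measurable[M.past t] u) (hu2 : MemLp u 2 μ) :
    Integrable (fun ω => M.loss j t (u ω + M.trueParam) ω) μ ∧
      ∫ ω, M.loss j t (u ω + M.trueParam) ω ∂μ
        = (1 / 2) * ∫ ω, ‖Matrix.toEuclideanLin (M.H j t ω) (u ω)‖ ^ 2 ∂μ
          + (1 / 2) * ∫ ω, ‖M.v j t ω‖ ^ 2 ∂μ := by
  have hH := (B.obs j hu hu2).1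
  have hv := hA2.memLp_v j t
  have hin := hH.integrable_inner hv
  have heq : ∀ ω, M.loss j t (u ω + M.trueParam) ω
      = (1 / 2) * ‖Matrix.toEuclideanLin (M.H j t ω) (u ω)‖ ^ 2 + (1 / 2) * ‖M.v j t ω‖ ^ 2
        - inner ℝ (Matrix.toEuclideanLin (M.H j t ω) (u ω)) (M.v j t ω) := by
    intro ω
    have h1 : Matrix.toEuclideanLin (M.H j t ω) (u ω + M.trueParam) - M.y j t ω
        = Matrix.toEuclideanLin (M.H j t ω) (u ω) - M.v j t ω := by
      rw [y, map_add]
      abel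
    rw [loss, h1, norm_sub_sq_real]
    ring
  simp_rw [heq]
  have h1 : Integrable (fun ω => (1 / 2) * ‖Matrix.toEuclideanLin (M.H j t ω) (u ω)‖ ^ 2
      + (1 / 2) * ‖M.v j t ω‖ ^ 2) μ :=
    (hH.integrable_norm_sq.const_mul _).add (hv.integrable_norm_sq.const_mul _)
  refine ⟨h1.sub hin, ?_⟩
  rw [integral_sub h1 hin, B.integral_inner_obs_v hA2 j hu hu2, sub_zero,
    integral_add (hH.integrable_norm_sq.const_mul _) (hv.integrable_norm_sq.const_mul _),
    integral_const_mul, integral_const_mul]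

end UniformBounds

end RegressionNetwork

/-! ### The regret bound -/

theorem theorem3 {Ω : Type*} [MeasurableSpace Ω] (μ : Measure Ω) [IsProbabilityMeasure μ]
    {N n : ℕ} {m : Fin N → ℕ} (M : RegressionNetwork Ω N n m)
    (a b lam : ℕ → ℝ) (c₁ c₂ τ : ℝ) (hc₁ : 0 < c₁) (hc₂ : 0 < c₂)
    (hτ : 1 / 2 < τ) (hτ' : τ < 1)
    (ha : ∀ k : ℕ, a k = c₁ / ((k : ℝ) + 1) ^ τ)
    (hb : ∀ k : ℕ, b k = c₁ / ((k : ℝ) + 1) ^ τ)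
    (hlam : ∀ k : ℕ, lam k = c₂ / ((k : ℝ) + 1) ^ (2 * τ))
    (hbal : M.CondBalanced μ)
    (hA1 : M.LinearNoiseIntensity)
    (hA2 : M.NoiseAssumption μ)
    (hconn : UniformlyCondJointlyConnected μ M.past
      (fun k ω => symmetrizedAdjacency (M.A k ω)))
    (hobs : UniformlyCondJointlyObservable μ M.past M.H)
    (h : ℕ) (hh : 0 < h) (ρ₀ : ℝ) (hρ₀ : 0 < ρ₀)
    (hmom : M.MomentBound μ h ρ₀) :
    (∀ j t z, Integrable (M.loss j t z) μ) ∧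
    (∀ i j t, Integrable (fun ω => M.loss j t (M.estimate a b lam t ω i) ω) μ) ∧
    (∀ T, ∃ z, M.IsLinearOptimal μ T z) ∧
    ∀ xLMS : ℕ → EuclideanSpace ℝ (Fin n), (∀ T, M.IsLinearOptimal μ T (xLMS T)) →
      ∀ i, (fun T : ℕ => M.regret μ a b lam i T (xLMS T)) =O[atTop]
        fun T : ℕ => (T : ℝ) ^ (1 - τ) * Real.log T := by
  obtain rfl : b = a := funext fun k => (hb k).trans (ha k).symm
  obtain ⟨K, B⟩ := RegressionNetwork.exists_uniformBounds hA1 hA2 hmom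
  have hest : ∀ i t ω, M.estimate b b lam t ω i = M.err b b lam t i ω + M.trueParam :=
    fun i t ω => (sub_add_cancel _ _).symm
  have hexp := fun i j t => B.loss_expansion hA2 (t := t) j
    (RegressionNetwork.measurable_err b lam t i) (B.memLp_err hA2 b lam t i)
  have hconst := fun j t z => B.loss_expansion hA2 (t := t) j (u := fun _ => z - M.trueParam)
    measurable_const (memLp_const _)
  simp only [sub_add_cancel] at hconst
  simp only [← hest] at hexp
  have hmin : ∀ T, M.IsLinearOptimal μ T M.trueParam := by
    intro T z _
    change ∑ t ∈ Finset.range (T + 1), ∑ j, ∫ ω, M.loss j t M.trueParam ω ∂μ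
      ≤ ∑ t ∈ Finset.range (T + 1), ∑ j, ∫ ω, M.loss j t z ω ∂μ
    refine Finset.sum_le_sum fun t _ => Finset.sum_le_sum fun j _ => ?_
    rw [(hconst j t z).2, (hconst j t M.trueParam).2]
    simp only [sub_self, map_zero, norm_zero, ne_eq, OfNat.ofNat_ne_zero, not_false_eq_true,
      zero_pow, integral_zero, mul_zero, zero_add]
    exact le_add_of_nonneg_left (by positivity)
  refine ⟨fun j t z => (hconst j t z).1, fun i j t => (hexp i j t).1,
    fun T => ⟨M.trueParam, hmin T⟩, fun xLMS hx i => ?_⟩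
  obtain ⟨C, hC, hrate⟩ := B.exists_energy_err_le hA2 hbal hconn hobs hc₁ hc₂ (by linarith) hτ'
    ha hlam
  have hregret : ∀ T, M.regret μ b b lam i T (xLMS T) = ∑ t ∈ Finset.range (T + 1), ∑ j,
      (1 / 2) * ∫ ω, ‖Matrix.toEuclideanLin (M.H j t ω) (M.err b b lam t i ω)‖ ^ 2 ∂μ := by
    intro T
    -- Minimizers need not be unique, but all have the optimal value, so the true parameter may
    -- replace the chosen one and the noise terms cancel.
    have h1 : ∑ t ∈ Finset.range (T + 1), ∑ j, ∫ ω, M.loss j t (xLMS T) ω ∂μ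
        = ∑ t ∈ Finset.range (T + 1), ∑ j, ∫ ω, M.loss j t M.trueParam ω ∂μ :=
      le_antisymm (hx T (Set.mem_univ _)) (hmin T (Set.mem_univ _))
    rw [RegressionNetwork.regret, h1]
    simp_rw [← Finset.sum_sub_distrib]
    refine Finset.sum_congr rfl fun t _ => Finset.sum_congr rfl fun j _ => ?_
    rw [(hexp i j t).2, (hconst j t M.trueParam).2]
    simp
  refine isBigO_rpow_mul_log_of_sum_le (C := N * ((1 / 2) * K)) (by linarith) hτ' hC
    (by have := B.nonneg; positivity) hrate (fun T => ?_) fun T => ?_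
  · rw [hregret]
    positivity
  · rw [hregret, Finset.mul_sum]
    refine Finset.sum_le_sum fun t _ => ?_
    have h1 : ∀ j ∈ Finset.univ, (1 / 2) * ∫ ω, ‖Matrix.toEuclideanLin (M.H j t ω)
        (M.err b b lam t i ω)‖ ^ 2 ∂μ
        ≤ (1 / 2) * (K * RegressionNetwork.energy μ (M.err b b lam t)) := fun j _ => by
      have h2 := (B.obs j (RegressionNetwork.measurable_err b lam t i)
        (B.memLp_err hA2 b lam t i)).2
      have h3 := mul_le_mul_of_nonneg_left (RegressionNetwork.integral_norm_sq_le_energy (μ := μ)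
        (M.err b b lam t) i) B.nonneg
      linarith
    refine (Finset.sum_le_card_nsmul _ _ _ h1).trans_eq ?_
    simp
    ring
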